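/- Let $d\ge 2$ and let $Z=\mathbf R^d\times\mathbf R$, with points $(\xi,\tau)$ and Lebesgue measure. For a function $m$ on $Z^3$, let $\|m\|_{[3;Z]}$ be the best constant for which $$\Big|\int_{z_1+z_2+z_3=0} m(z_1,z_2,z_3)\prod_{j=1}^3 f_j(z_j)\Big|\le \|m\|_{[3;Z]}\prod_{j=1}^3\|f_j\|_{L^2(Z)}$$ holds for all complex test functions $f_1,f_2,f_3$ (continuous with compact support), where the integral is taken with respect to $dz_1\,dz_2$, $z_3=-z_1-z_2$. Consider the $(++-)$ Schrödinger dispersion relations $h_1(\xi)=h_2(\xi)=|\xi|^2$, $h_3(\xi)=-|\xi|^2$, and put $\lambda_j=\tau_j-h_j(\xi_j)$ and $h(\xi)=h_1(\xi_1)+h_2(\xi_2)+h_3(\xi_3)$. Conventions on constants: for $A\ge1$ and $K\geq 1$, $x\sim y$ means $x\le Ay$ and $y\le Ax$; $x\lesssim y$ means $x\le Ay$; $x\gg y$ means $x\ge Ky$; and a chain $x\sim y\gg z$ means $x\sim y$, $x\gg z$ and $y\gg z$. For $N_1,N_2,N_3,L_1,L_2,L_3,H>0$ let $X=X_{N_1,N_2,N_3;H;L_1,L_2,L_3}$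 be the characteristic function of the set where $|h(\xi)|\sim H$, $|\xi_j|\sim N_j$ and $|\lambda_j|\sim L_j$ for $j=1,2,3$. Write $N_{max}\ge N_{med}\ge N_{min}$ for $N_1,N_2,N_3$ in decreasing order, and similarly $L_{max}\ge L_{med}\ge L_{min}$. Then for every $A\ge 1$ there is $K_0\ge1$, depending only on $d$ and $A$, such that for all $K\ge K_0$ and $\varepsilon>0$ there is a constant $C>0$, depending only on $d,A,K,\varepsilon$, with the following property. Let $N_1,N_2,N_3,L_1,L_2,L_3,H>0$ satisfy $$N_{max}\sim N_{med},\qquad L_{max}\sim\max(H,L_{med}),\qquad H\lesssim N_1N_2 .$$ * ((++) case.) If $N_1\sim N_2\gg N_3$, then $\|X\|_{[3;Z]}=0$ unless $C^{-1}N_1^2\le H\le CN_1^2$, in which case $$\|X\|_{[3;Z]}\le C\,L_{min}^{1/2}N_{max}^{-1/2}N_{min}^{(d-1)/2}\min(N_{max}N_{min},L_{med})^{1/2}.$$ * ((+-) coherence.) If $N_1\sim N_3\gg N_2$ and $H\sim L_2\gg L_1,L_3,N_2^2$, or if the same holds with the roles of the indices $1$ and $2$ reversed, then $$\|X\|_{[3;Z]}\le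 C\,L_{min}^{1/2}N_{max}^{-1/2}N_{min}^{(d-1)/2}\min\Big(H,\frac{H}{N_{min}^2}L_{med}\Big)^{1/2}.$$ * In all other cases, $$\|X\|_{[3;Z]}\le C\,L_{min}^{1/2}N_{max}^{-1/2}N_{min}^{(d-1)/2}\min(H,L_{med})^{1/2}\min\Big(1,\frac{H}{N_{min}^2}\Big)^{1/2-\varepsilon}.$$ When $d=2$ the same holds with $\varepsilon=0$. -/

import Mathlib

open MeasureTheory
open scoped ENNReal

noncomputable section

namespace DyadicBlock

/-! ### The norm of a multiplier on the hyperplane `ξ₁ + ξ₂ + ξ₃ = 0` -/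

/-- The point of the hyperplane `{(ξ₁, ξ₂, ξ₃) : ξ₁ + ξ₂ + ξ₃ = 0}` of `Z³` whose first two
coordinates are given. Indices `1, 2, 3` are written `0, 1, 2` throughout. -/
def gammaPoint {Z : Type*} [AddCommGroup Z] (p : Z × Z) : Fin 3 → Z :=
  ![p.1, p.2, -p.1 - p.2]

/-- `C` is an admissible constant for the multiplier `m`: for all complex test functions
`f₁, f₂, f₃` (continuous with compact support), the integral over the hyperplane of
`m(ξ₁, ξ₂, ξ₃) f₁(ξ₁) f₂(ξ₂) f₃(ξ₃)` converges absolutely and is at most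
`C ‖f₁‖₂ ‖f₂‖₂ ‖f₃‖₂` in absolute value. The measure on the hyperplane is `dξ₁ dξ₂`. -/
def IsMultiplierBound {Z : Type*} [AddCommGroup Z] [TopologicalSpace Z] [MeasureSpace Z]
    (m : (Fin 3 → Z) → ℂ) (C : ℝ≥0∞) : Prop :=
  ∀ f : Fin 3 → Z → ℂ, (∀ j, Continuous (f j)) → (∀ j, HasCompactSupport (f j)) →
    Integrable (fun p : Z × Z => m (gammaPoint p) * ∏ j, f j (gammaPoint p j)) ∧
    ‖∫ p : Z × Z, m (gammaPoint p) * ∏ j, f j (gammaPoint p j)‖ₑ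
      ≤ C * ∏ j, eLpNorm (f j) 2 volume

/-- The norm `‖m‖_{[3; Z]}`: the best admissible constant (`∞` if there is no finite one). -/
def multiplierNorm {Z : Type*} [AddCommGroup Z] [TopologicalSpace Z] [MeasureSpace Z]
    (m : (Fin 3 → Z) → ℂ) : ℝ≥0∞ :=
  sInf {C | IsMultiplierBound m C}

/-! ### Comparison of sizes -/

/-- `x ∼ y` with constant `A`: `x ≤ A y` and `y ≤ A x`. -/
def Sim (A x y : ℝ) : Prop := x ≤ A * y ∧ y ≤ A * x

/-- `x ≫ y` with constant `K`: `y ≤ K⁻¹ x`, for `K > 0`. -/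
def MuchGreater (K x y : ℝ) : Prop := K * y ≤ x

/-- The chain `x ∼ y ≫ z`. -/
def SimMuchGreater (A K x y z : ℝ) : Prop :=
  Sim A x y ∧ MuchGreater K x z ∧ MuchGreater K y z

/-- The largest of three numbers. -/
def max3 (v : Fin 3 → ℝ) : ℝ := max (max (v 0) (v 1)) (v 2)

/-- The smallest of three numbers. -/
def min3 (v : Fin 3 → ℝ) : ℝ := min (min (v 0) (v 1)) (v 2)

/-- The median of three numbers. -/
def med3 (v : Fin 3 → ℝ) : ℝ := max (min (v 0) (v 1)) (min (max (v 0) (v 1)) (v 2))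

/-! ### The `(++-)` Schrödinger dispersion relations -/

/-- The space-time frequency space `ℝ^d × ℝ`, with points `(ξ, τ)`. -/
abbrev Freq (d : ℕ) : Type := EuclideanSpace ℝ (Fin d) × ℝ

/-- `h₁(ξ) = h₂(ξ) = |ξ|²` and `h₃(ξ) = -|ξ|²`. -/
def dispersion {d : ℕ} : Fin 3 → EuclideanSpace ℝ (Fin d) → ℝ :=
  ![fun ξ => ‖ξ‖ ^ 2, fun ξ => ‖ξ‖ ^ 2, fun ξ => -‖ξ‖ ^ 2]

/-- The modulation `λ_j = τ_j - h_j(ξ_j)`. -/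
def modulation {d : ℕ} (j : Fin 3) (z : Freq d) : ℝ := z.2 - dispersion j z.1

/-- The resonance function `h(ξ) = h₁(ξ₁) + h₂(ξ₂) + h₃(ξ₃)`. -/
def resonance {d : ℕ} (z : Fin 3 → Freq d) : ℝ := ∑ j, dispersion j (z j).1

/-- The region `|h(ξ)| ∼ H`, `|ξ_j| ∼ N_j`, `|λ_j| ∼ L_j`, `j = 1, 2, 3`, where all the
relations `∼` have the constant `A`. -/
def blockSet (d : ℕ) (A H : ℝ) (N L : Fin 3 → ℝ) : Set (Fin 3 → Freq d) :=
  {z | Sim A |resonance z| H ∧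
    ∀ j, Sim A ‖(z j).1‖ (N j) ∧ Sim A |modulation j (z j)| (L j)}

/-- The multiplier `X_{N₁,N₂,N₃;H;L₁,L₂,L₃}`. -/
def blockMultiplier (d : ℕ) (A H : ℝ) (N L : Fin 3 → ℝ) : (Fin 3 → Freq d) → ℂ :=
  (blockSet d A H N L).indicator 1

/-- The norm `‖X_{N₁,N₂,N₃;H;L₁,L₂,L₃}‖_{[3; ℝ^d × ℝ]}`. -/
def blockNorm (d : ℕ) (A H : ℝ) (N L : Fin 3 → ℝ) : ℝ≥0∞ :=
  multiplierNorm (blockMultiplier d A H N L)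

/-! ### Admissible parameters and the three regimes -/

/-- Positive parameters with `N_max ∼ N_med`, `L_max ∼ max(H, L_med)` and `H ≲ N₁ N₂`. -/
structure Admissible (A H : ℝ) (N L : Fin 3 → ℝ) : Prop where
  N_pos : ∀ j, 0 < N j
  L_pos : ∀ j, 0 < L j
  H_pos : 0 < H
  N_comp : Sim A (max3 N) (med3 N)
  L_comp : Sim A (max3 L) (max H (med3 L))
  H_le : H ≤ A * (N 0 * N 1)

/-- The `(++)` high-high case `N₁ ∼ N₂ ≫ N₃`. -/
def PlusPlus (A K : ℝ) (N : Fin 3 → ℝ) : Prop := SimMuchGreater A K (N 0) (N 1) (N 2)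

/-- For `i = 1`, `j = 2`, the coherent case `N₁ ∼ N₃ ≫ N₂`, `H ∼ L₂ ≫ L₁, L₃, N₂²`; for
`i = 2`, `j = 1`, the same with the roles of `1` and `2` reversed. -/
def CoherentAt (i j : Fin 3) (A K H : ℝ) (N L : Fin 3 → ℝ) : Prop :=
  SimMuchGreater A K (N i) (N 2) (N j) ∧
    SimMuchGreater A K H (L j) (L i) ∧ SimMuchGreater A K H (L j) (L 2) ∧
    SimMuchGreater A K H (L j) (N j ^ 2)

/-- The `(+-)`-coherent case. -/
def PlusMinusCoherent (A K H : ℝ) (N L : Fin 3 → ℝ) : Prop :=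
  CoherentAt 0 1 A K H N L ∨ CoherentAt 1 0 A K H N L

/-- The factor `L_min^{1/2} N_max^{-1/2} N_min^{(d-1)/2}` common to all the bounds. -/
def commonFactor (d : ℕ) (N L : Fin 3 → ℝ) : ℝ :=
  min3 L ^ (1 / 2 : ℝ) * max3 N ^ (-1 / 2 : ℝ) * min3 N ^ (((d : ℝ) - 1) / 2)

end DyadicBlock

end

open DyadicBlock

/-!
Indices are `0, 1, 2`. On the hyperplane `z₀ + z₁ + z₂ = 0` the resonance function is
`h = -2 ξ₀ · ξ₁`, and `λ₀ + λ₁ + λ₂ = -h`. A bound for the norm of a characteristic function is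
obtained as a bound `SqBound X M` for the square of its trilinear form on nonnegative functions
(`multiplierNorm_indicator_le`). There are three tools.

* Cauchy–Schwarz (`SqBound.of_fiber`): with `z_k` fixed, `M` is the measure of the set of the
  possible `z_i`.
* Cauchy–Schwarz applied twice (`SqBound.of_fourfold`): for two triples `z, z'` in `X` with a common
  entry `z_k = z_k'` and with `z_i` and `z_j'` fixed, `M` is the measure of the set of the possible
  `z_k`.
* Almost orthogonality (`SqBound.of_local`): if `ξ_i + ξ_j` is bounded by a multiple of `r`, then
  `ξ_i` may be localised to a ball of radius `r`.

Integration in the time frequencies yields the factor `L_min` (or the smaller of two of the `L_j`),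
and turns the modulations into a constraint on `h`, or on the difference of the two values of `h`.
What is left is the volume of sets of spatial frequencies lying in a ball, in a slab and in a thin
neighbourhood of a quadric. It is estimated by packing disjoint translates in a direction that is
transversal to the quadric (`volume_le_of_slices`).

In the `(++)` case the first tool suffices, with the third one if the low frequency wave has the
largest modulation. In the `(+-)` cases let `b` be the low frequency wave among `0, 1`, and `a` the
other one. The first tool gives the bound with `min(H, L_med)`. If `H ≪ N_b²`, then `ξ_a` and `ξ_b`
are nearly orthogonal, and the second tool gains the full factor `H / N_b²`: one slab confines the
component along one of them, and the quadric confines the component along the other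
(`sqBound_high_gain`, `sqBound_middle_gain`). If `L_b` dominates the other modulations, then
`H ∼ L_b`, and the second tool with `k = b` gives the bound with `(H / N_b²) L_med` (`sqBound_low`).
This is the coherent case when `H ≫ N_b²`, and otherwise it is no worse than the generic bound. The
argument loses no power of `H / N_min²` in any dimension, so that `ε` plays no role.
-/

noncomputable section

namespace DyadicBlock

/-! ### The trilinear form on nonnegative functions -/

section Form

theorem measurable_vec3 {Z α : Type*} [MeasurableSpace Z] [MeasurableSpace α] {f g h : α → Z}
    (hf : Measurable f) (hg : Measurable g) (hh : Measurable h) :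
    Measurable fun a => ![f a, g a, h a] := by
  refine measurable_pi_lambda _ fun j => ?_
  fin_cases j
  exacts [hf, hg, hh]

theorem measurableSet_perm {Z : Type*} [MeasurableSpace Z] (σ : Equiv.Perm (Fin 3))
    {X : Set (Fin 3 → Z)} (hX : MeasurableSet X) :
    MeasurableSet {z : Fin 3 → Z | z ∘ σ ∈ X} :=
  (measurable_pi_lambda (fun z : Fin 3 → Z => z ∘ σ) fun _ => measurable_pi_apply _) hX

theorem exists_perm {i j : Fin 3} (hij : i ≠ j) : ∃ σ : Equiv.Perm (Fin 3), σ i = 0 ∧ σ j = 1 := by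
  revert hij; revert i j; decide

variable {Z : Type*} [AddCommGroup Z] [MeasureSpace Z]

/-- The trilinear form `∫ 1_X(z₁, z₂, z₃) f₁(z₁) f₂(z₂) f₃(z₃)` over `z₁ + z₂ + z₃ = 0`, for
`[0, ∞]`-valued functions. -/
def triForm (X : Set (Fin 3 → Z)) (f : Fin 3 → Z → ℝ≥0∞) : ℝ≥0∞ :=
  ∫⁻ p : Z × Z, X.indicator 1 (gammaPoint p) * ∏ j, f j (gammaPoint p j)

/-- `M` bounds the square of the norm of the multiplier `1_X`, tested on nonnegative measurable
functions. -/
def SqBound (X : Set (Fin 3 → Z)) (M : ℝ≥0∞) : Prop :=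
  ∀ f : Fin 3 → Z → ℝ≥0∞, (∀ j, Measurable (f j)) →
    triForm X f ^ 2 ≤ M * ∏ j, ∫⁻ z, f j z ^ 2

theorem SqBound.mono {X Y : Set (Fin 3 → Z)} {M M' : ℝ≥0∞} (h : SqBound Y M)
    (hXY : ∀ z ∈ X, ∑ j, z j = 0 → z ∈ Y) (hM : M ≤ M') : SqBound X M' := by
  intro f hf
  refine le_trans ?_ ((h f hf).trans (by gcongr))
  refine pow_le_pow_left' (lintegral_mono fun p => mul_le_mul' ?_ le_rfl) 2
  by_cases hp : gammaPoint p ∈ X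
  · have : gammaPoint p ∈ Y := hXY _ hp (by simp [gammaPoint, Fin.sum_univ_three])
    simp [hp, this]
  · simp [hp]

theorem sq_lintegral_mul_le {α : Type*} [MeasurableSpace α] (μ : Measure α) {f g : α → ℝ≥0∞}
    (hf : AEMeasurable f μ) (hg : AEMeasurable g μ) :
    (∫⁻ a, f a * g a ∂μ) ^ 2 ≤ (∫⁻ a, f a ^ 2 ∂μ) * ∫⁻ a, g a ^ 2 ∂μ := by
  have h := ENNReal.lintegral_mul_le_Lp_mul_Lq μ Real.HolderConjugate.two_two hf hg
  simp only [Pi.mul_apply, ENNReal.rpow_two] at h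
  calc (∫⁻ a, f a * g a ∂μ) ^ 2
      ≤ ((∫⁻ a, f a ^ 2 ∂μ) ^ (1 / 2 : ℝ) * (∫⁻ a, g a ^ 2 ∂μ) ^ (1 / 2 : ℝ)) ^ 2 := by gcongr
    _ = _ := by
      rw [mul_pow, ← ENNReal.rpow_natCast, ← ENNReal.rpow_natCast, ← ENNReal.rpow_mul,
        ← ENNReal.rpow_mul]
      norm_num

theorem two_mul_le_add_sq_ennreal (a b : ℝ≥0∞) : 2 * (a * b) ≤ a ^ 2 + b ^ 2 := by
  wlog h : a ≤ b generalizing a b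
  · rw [mul_comm a b, add_comm]; exact this b a (le_of_not_ge h)
  obtain ⟨c, rfl⟩ := exists_add_of_le h
  calc 2 * (a * (a + c)) ≤ 2 * (a * (a + c)) + c ^ 2 := le_self_add
    _ = _ := by ring

variable [MeasurableAdd₂ Z] [MeasurableNeg Z]

@[fun_prop]
theorem measurable_gammaPoint : Measurable (gammaPoint : Z × Z → Fin 3 → Z) := by
  refine measurable_pi_lambda _ fun j => ?_
  fin_cases j
  · exact measurable_fst
  · exact measurable_snd
  · have : Measurable fun p : Z × Z => -p.1 - p.2 := by
      simp only [sub_eq_add_neg]; fun_prop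
    exact this

variable [SFinite (volume : Measure Z)]

theorem lintegral_gammaPoint {F : (Fin 3 → Z) → ℝ≥0∞} (hF : Measurable F) :
    ∫⁻ p : Z × Z, F (gammaPoint p) = ∫⁻ x, ∫⁻ y, F ![x, y, -x - y] :=
  lintegral_prod _ (hF.comp measurable_gammaPoint).aemeasurable

variable [(volume : Measure Z).IsAddLeftInvariant] [(volume : Measure Z).IsNegInvariant]

/-- The measure `dz₁ dz₂` on the plane `z₁ + z₂ + z₃ = 0` is invariant under permutations of the
three coordinates. -/
theorem lintegral_gammaPoint_comp_perm (σ : Equiv.Perm (Fin 3)) :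
    ∀ {F : (Fin 3 → Z) → ℝ≥0∞}, Measurable F →
      ∫⁻ p : Z × Z, F (gammaPoint p ∘ σ) = ∫⁻ p : Z × Z, F (gammaPoint p) := by
  have hmeas : ∀ τ : Equiv.Perm (Fin 3), Measurable fun z : Fin 3 → Z => z ∘ τ := fun τ =>
    measurable_pi_lambda _ fun j => measurable_pi_apply _
  have h01 : ∀ {F : (Fin 3 → Z) → ℝ≥0∞}, Measurable F →
      ∫⁻ p : Z × Z, F (gammaPoint p ∘ Equiv.swap 0 1) = ∫⁻ p : Z × Z, F (gammaPoint p) := by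
    intro F hF
    rw [Measure.volume_eq_prod, ← lintegral_prod_swap]
    refine lintegral_congr fun p => congrArg F ?_
    funext j
    fin_cases j <;> simp [gammaPoint, Equiv.swap_apply_def, sub_eq_add_neg, add_comm]
  have h12 : ∀ {F : (Fin 3 → Z) → ℝ≥0∞}, Measurable F →
      ∫⁻ p : Z × Z, F (gammaPoint p ∘ Equiv.swap 1 2) = ∫⁻ p : Z × Z, F (gammaPoint p) := by
    intro F hF
    rw [lintegral_gammaPoint hF, lintegral_gammaPoint (F := fun z => F (z ∘ Equiv.swap 1 2))
      (hF.comp (hmeas _))]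
    refine lintegral_congr fun x => ?_
    rw [← lintegral_sub_left_eq_self _ (-x)]
    refine lintegral_congr fun y => congrArg F ?_
    funext j
    fin_cases j <;> simp [Equiv.swap_apply_def]
  have h02 : ∀ {F : (Fin 3 → Z) → ℝ≥0∞}, Measurable F →
      ∫⁻ p : Z × Z, F (gammaPoint p ∘ Equiv.swap 0 2) = ∫⁻ p : Z × Z, F (gammaPoint p) := by
    intro F hF
    have : (Equiv.swap 0 2 : Equiv.Perm (Fin 3)) =
        Equiv.swap 0 1 * (Equiv.swap 1 2 * Equiv.swap 0 1) := by decide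
    rw [← h01 hF, ← h12 (F := fun z => F (z ∘ Equiv.swap 0 1)) (hF.comp (hmeas _)),
      ← h01 (F := fun z => F ((z ∘ Equiv.swap 1 2) ∘ Equiv.swap 0 1))
        ((hF.comp (hmeas _)).comp (hmeas _)), this]
    rfl
  induction σ using Equiv.Perm.swap_induction_on with
  | one => intro F _; rfl
  | swap_mul τ a b hab ih =>
    intro F hF
    have key : ∀ {F : (Fin 3 → Z) → ℝ≥0∞}, Measurable F →
        ∫⁻ p : Z × Z, F (gammaPoint p ∘ Equiv.swap a b) = ∫⁻ p : Z × Z, F (gammaPoint p) := by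
      fin_cases a <;> fin_cases b <;> first
        | exact absurd rfl hab
        | exact h01
        | exact h02
        | exact h12
        | (rw [Equiv.swap_comm]; first | exact h01 | exact h02 | exact h12)
    rw [← ih hF, ← key (F := fun z => F (z ∘ τ)) (hF.comp (hmeas _))]
    rfl

theorem SqBound.of_perm (σ : Equiv.Perm (Fin 3)) {X : Set (Fin 3 → Z)} (hX : MeasurableSet X)
    {M : ℝ≥0∞} (h : SqBound {z | z ∘ σ ∈ X} M) : SqBound X M := by
  intro f hf
  have hF : Measurable fun z : Fin 3 → Z => X.indicator 1 z * ∏ j, f j (z j) :=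
    (measurable_one.indicator hX).mul
      (Finset.measurable_prod _ fun j _ => (hf j).comp (measurable_pi_apply j))
  have h1 := h (fun j => f (σ.symm j)) (fun j => hf _)
  have h2 : triForm {z | z ∘ σ ∈ X} (fun j => f (σ.symm j)) = triForm X f := by
    unfold triForm
    rw [← lintegral_gammaPoint_comp_perm σ hF]
    refine lintegral_congr fun p => ?_
    congr 1
    rw [← Equiv.prod_comp σ]
    simp
  rw [h2] at h1
  rwa [Equiv.prod_comp σ.symm (fun j => ∫⁻ z, f j z ^ 2)] at h1

/-- Cauchy–Schwarz: for each fixed value of one variable, the possible values of another one fill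
a set of measure at most `M`. -/
theorem SqBound.of_fiber {X : Set (Fin 3 → Z)} (hX : MeasurableSet X) {k i : Fin 3} (hki : k ≠ i)
    {M : ℝ≥0∞}
    (h : ∀ w, volume {x | ∃ ζ ∈ X, ∑ j, ζ j = 0 ∧ ζ k = w ∧ ζ i = x} ≤ M) : SqBound X M := by
  obtain ⟨σ, hk, hi⟩ := exists_perm hki
  refine SqBound.of_perm σ hX ?_
  set Y := {z : Fin 3 → Z | z ∘ σ ∈ X} with hYdef
  have hY : MeasurableSet Y := measurableSet_perm σ hX
  have hfib : ∀ w, volume {x | ![w, x, -w - x] ∈ Y} ≤ M := by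
    intro w
    refine le_trans (measure_mono ?_) (h w)
    intro x hx
    refine ⟨![w, x, -w - x] ∘ σ, hx, ?_, by simp [hk], by simp [hi]⟩
    simp only [Function.comp_apply]
    rw [Equiv.sum_comp σ (![w, x, -w - x])]
    simp [Fin.sum_univ_three]
  clear_value Y
  intro f hf
  have hm3 : Measurable fun p : Z × Z => -p.1 - p.2 := by
    simp only [sub_eq_add_neg]; fun_prop
  have hI : Measurable fun p : Z × Z =>
      Y.indicator (1 : (Fin 3 → Z) → ℝ≥0∞) ![p.1, p.2, -p.1 - p.2] :=
    (measurable_one.indicator hY).comp (measurable_vec3 measurable_fst measurable_snd hm3)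
  have hg : Measurable fun p : Z × Z => f 1 p.2 * f 2 (-p.1 - p.2) :=
    ((hf 1).comp measurable_snd).mul ((hf 2).comp hm3)
  have hIg : ∀ x, Measurable fun y => Y.indicator (1 : (Fin 3 → Z) → ℝ≥0∞) ![x, y, -x - y] *
      (f 1 y * f 2 (-x - y)) := fun x => (hI.mul hg).comp measurable_prodMk_left
  have e1 : triForm Y f = ∫⁻ x, f 0 x * ∫⁻ y, Y.indicator 1 ![x, y, -x - y] *
      (f 1 y * f 2 (-x - y)) := by
    unfold triForm
    rw [lintegral_gammaPoint (F := fun z => Y.indicator 1 z * ∏ j, f j (z j))]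
    · refine lintegral_congr fun x => ?_
      rw [← lintegral_const_mul _ (hIg x)]
      refine lintegral_congr fun y => ?_
      simp [Fin.prod_univ_three]
      ring
    · exact (measurable_one.indicator hY).mul
        (Finset.measurable_prod _ fun j _ => (hf j).comp (measurable_pi_apply j))
  have e2 : ∀ x, (∫⁻ y, Y.indicator 1 ![x, y, -x - y] * (f 1 y * f 2 (-x - y))) ^ 2 ≤
      M * ∫⁻ y, f 1 y ^ 2 * f 2 (-x - y) ^ 2 := by
    intro x
    refine (sq_lintegral_mul_le _ (hI.comp measurable_prodMk_left).aemeasurable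
      (hg.comp measurable_prodMk_left).aemeasurable).trans ?_
    refine mul_le_mul' ?_ (lintegral_mono fun y => (mul_pow _ _ 2).le)
    have hs : MeasurableSet {y | ![x, y, -x - y] ∈ Y} :=
      ((measurable_vec3 measurable_fst measurable_snd hm3).comp measurable_prodMk_left) hY
    calc ∫⁻ y, Y.indicator (1 : (Fin 3 → Z) → ℝ≥0∞) ![x, y, -x - y] ^ 2
        = ∫⁻ y, {y | ![x, y, -x - y] ∈ Y}.indicator 1 y := by
          refine lintegral_congr fun y => ?_
          by_cases hy : ![x, y, -x - y] ∈ Y <;> simp [hy]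
      _ = volume {y | ![x, y, -x - y] ∈ Y} := lintegral_indicator_one hs
      _ ≤ M := hfib x
  rw [e1]
  calc _ ≤ (∫⁻ x, f 0 x ^ 2) * ∫⁻ x, (∫⁻ y, Y.indicator 1 ![x, y, -x - y] *
      (f 1 y * f 2 (-x - y))) ^ 2 :=
        sq_lintegral_mul_le _ (hf 0).aemeasurable
          (hI.mul hg).lintegral_prod_right'.aemeasurable
    _ ≤ (∫⁻ x, f 0 x ^ 2) * ∫⁻ x, M * ∫⁻ y, f 1 y ^ 2 * f 2 (-x - y) ^ 2 := by
        gcongr with x; exact e2 x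
    _ = (∫⁻ x, f 0 x ^ 2) * (M * ((∫⁻ x, f 1 x ^ 2) * ∫⁻ x, f 2 x ^ 2)) := by
        have hsq : Measurable fun p : Z × Z => f 1 p.2 ^ 2 * f 2 (-p.1 - p.2) ^ 2 :=
          (((hf 1).comp measurable_snd).pow_const 2).mul (((hf 2).comp hm3).pow_const 2)
        rw [lintegral_const_mul _ hsq.lintegral_prod_right', lintegral_lintegral_swap
          (f := fun x y => f 1 y ^ 2 * f 2 (-x - y) ^ 2) hsq.aemeasurable]
        congr 2
        rw [← lintegral_mul_const _ ((hf 1).pow_const 2)]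
        refine lintegral_congr fun y => ?_
        have hc : ∀ x : Z, -x - y = -y - x := fun x => by abel
        simp only [hc]
        have hy' : Measurable fun x => -y - x := by simp only [sub_eq_add_neg]; fun_prop
        have hy : Measurable fun x => f 2 (-y - x) ^ 2 := ((hf 2).comp hy').pow_const 2
        rw [lintegral_const_mul _ hy,
          lintegral_sub_left_eq_self (fun x => f 2 x ^ 2) (-y)]
    _ = _ := by rw [Fin.prod_univ_three]; ring

/-- Fourfold Cauchy–Schwarz. Squaring the bilinear operator dual to `f_k` produces
`f_i(z_i) f_j(z_j) f_i(z_i') f_j(z_j')` with `z_i + z_j = z_i' + z_j' = -z_k`. Pairing the first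
factor with the last one and the two middle ones with each other, it suffices to bound, for fixed
`z_i` and `z_j'`, the measure of the set of those `z_k` for which both triples lie in `X`. -/
theorem SqBound.of_fourfold {X : Set (Fin 3 → Z)} (hX : MeasurableSet X) {i j k : Fin 3}
    (hij : i ≠ j) (hik : i ≠ k) (hjk : j ≠ k) {M : ℝ≥0∞}
    (h : ∀ u v, volume {x | (∃ ζ ∈ X, ∑ l, ζ l = 0 ∧ ζ k = x ∧ ζ i = u) ∧
      ∃ ζ ∈ X, ∑ l, ζ l = 0 ∧ ζ k = x ∧ ζ j = v} ≤ M) : SqBound X M := by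
  obtain ⟨σ, hk, hi⟩ := exists_perm hik.symm
  have hj : σ j = 2 := by
    have h0 : σ j ≠ 0 := fun h0 => hjk (σ.injective (h0.trans hk.symm))
    have h1 : σ j ≠ 1 := fun h1 => hij (σ.injective (hi.trans h1.symm))
    revert h0 h1; generalize σ j = a; revert a; decide
  refine SqBound.of_perm σ hX ?_
  set Y := {z : Fin 3 → Z | z ∘ σ ∈ X} with hYdef
  have hY : MeasurableSet Y := measurableSet_perm σ hX
  have hfib : ∀ u v, volume {x | ![x, u, -x - u] ∈ Y ∧ ![x, -x - v, v] ∈ Y} ≤ M := by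
    intro u v
    refine le_trans (measure_mono ?_) (h u v)
    rintro x ⟨hx, hx'⟩
    refine ⟨⟨![x, u, -x - u] ∘ σ, hx, ?_, by simp [hk], by simp [hi]⟩,
      ⟨![x, -x - v, v] ∘ σ, hx', ?_, by simp [hk], by simp [hj]⟩⟩
    · simp only [Function.comp_apply]
      rw [Equiv.sum_comp σ (![x, u, -x - u])]
      simp [Fin.sum_univ_three]
    · simp only [Function.comp_apply]
      rw [Equiv.sum_comp σ (![x, -x - v, v])]
      simp only [Fin.sum_univ_three, Matrix.cons_val]
      abel
  clear_value Y
  intro f hf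
  have hm3 : Measurable fun p : Z × Z => -p.1 - p.2 := by
    simp only [sub_eq_add_neg]; fun_prop
  have hsubl : ∀ x : Z, Measurable fun y : Z => -x - y := fun x => by
    simp only [sub_eq_add_neg]; fun_prop
  -- `G (x, y)` is the indicator of `Y` at the triple with first two entries `x` and `y`
  set G : Z × Z → ℝ≥0∞ := fun p => Y.indicator 1 ![p.1, p.2, -p.1 - p.2] with hG
  have hI : Measurable G :=
    (measurable_one.indicator hY).comp (measurable_vec3 measurable_fst measurable_snd hm3)
  have hg : Measurable fun p : Z × Z => f 1 p.2 * f 2 (-p.1 - p.2) :=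
    ((hf 1).comp measurable_snd).mul ((hf 2).comp hm3)
  have hIg : ∀ x, Measurable fun y => G (x, y) * (f 1 y * f 2 (-x - y)) := fun x =>
    (hI.mul hg).comp measurable_prodMk_left
  have e1 : triForm Y f = ∫⁻ x, f 0 x * ∫⁻ y, G (x, y) * (f 1 y * f 2 (-x - y)) := by
    unfold triForm
    rw [lintegral_gammaPoint (F := fun z => Y.indicator 1 z * ∏ j, f j (z j))]
    · refine lintegral_congr fun x => ?_
      rw [← lintegral_const_mul _ (hIg x)]
      refine lintegral_congr fun y => ?_
      simp [Fin.prod_univ_three, hG]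
      ring
    · exact (measurable_one.indicator hY).mul
        (Finset.measurable_prod _ fun j _ => (hf j).comp (measurable_pi_apply j))
  have e2 : ∀ x, (∫⁻ y, G (x, y) * (f 1 y * f 2 (-x - y))) ^ 2 ≤
      ∫⁻ y, ∫⁻ y', G (x, y) * G (x, y') * (f 1 y ^ 2 * f 2 (-x - y') ^ 2) := by
    intro x
    have hGx : Measurable fun y => G (x, y) := hI.comp measurable_prodMk_left
    have hf2 : Measurable fun y => f 2 (-x - y) := (hf 2).comp (hsubl x)
    set F : Z × Z → ℝ≥0∞ := fun q => G (x, q.1) * G (x, q.2) * (f 1 q.1 ^ 2 * f 2 (-x - q.2) ^ 2)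
      with hF
    have hFm : Measurable F := by
      exact ((hGx.comp measurable_fst).mul (hGx.comp measurable_snd)).mul
        ((((hf 1).comp measurable_fst).pow_const 2).mul ((hf2.comp measurable_snd).pow_const 2))
    have hswap : ∫⁻ y, ∫⁻ y', F (y', y) = ∫⁻ y, ∫⁻ y', F (y, y') :=
      lintegral_lintegral_swap (f := fun y y' => F (y', y)) (hFm.comp measurable_swap).aemeasurable
    have h2 : 2 * (∫⁻ y, G (x, y) * (f 1 y * f 2 (-x - y))) ^ 2 ≤ 2 * ∫⁻ y, ∫⁻ y', F (y, y') := by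
      have hbase : Measurable fun y => G (x, y) * (f 1 y * f 2 (-x - y)) := hGx.mul ((hf 1).mul hf2)
      calc 2 * (∫⁻ y, G (x, y) * (f 1 y * f 2 (-x - y))) ^ 2
          = ∫⁻ y, ∫⁻ y', 2 * ((G (x, y) * (f 1 y * f 2 (-x - y))) *
              (G (x, y') * (f 1 y' * f 2 (-x - y')))) := by
            rw [sq, ← lintegral_mul_const _ hbase, ← lintegral_const_mul _ (hbase.mul_const _)]
            refine lintegral_congr fun y => ?_
            rw [← lintegral_const_mul _ hbase, ← lintegral_const_mul _ (hbase.const_mul _)]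
        _ ≤ ∫⁻ y, ∫⁻ y', (F (y, y') + F (y', y)) := by
            refine lintegral_mono fun y => lintegral_mono fun y' => ?_
            have := two_mul_le_add_sq_ennreal (f 1 y * f 2 (-x - y')) (f 1 y' * f 2 (-x - y))
            calc 2 * ((G (x, y) * (f 1 y * f 2 (-x - y))) *
                  (G (x, y') * (f 1 y' * f 2 (-x - y'))))
                = G (x, y) * G (x, y') * (2 * ((f 1 y * f 2 (-x - y')) *
                    (f 1 y' * f 2 (-x - y)))) := by ring
              _ ≤ G (x, y) * G (x, y') * ((f 1 y * f 2 (-x - y')) ^ 2 +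
                    (f 1 y' * f 2 (-x - y)) ^ 2) := by gcongr
              _ = F (y, y') + F (y', y) := by simp only [hF]; ring
        _ = 2 * ∫⁻ y, ∫⁻ y', F (y, y') := by
            rw [two_mul]
            conv_rhs => enter [2]; rw [← hswap]
            rw [← lintegral_add_left hFm.lintegral_prod_right']
            refine lintegral_congr fun y => ?_
            have hFy : Measurable fun y' => F (y, y') := hFm.comp measurable_prodMk_left
            rw [lintegral_add_left hFy]
    exact (ENNReal.mul_le_mul_iff_right (by norm_num) (by norm_num)).1 h2
  -- substitute `z_j'` for `z_i'`
  have e3 : ∀ x, ∫⁻ y, ∫⁻ y', G (x, y) * G (x, y') * (f 1 y ^ 2 * f 2 (-x - y') ^ 2) =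
      ∫⁻ y, ∫⁻ v, G (x, y) * G (x, -x - v) * (f 1 y ^ 2 * f 2 v ^ 2) := by
    intro x
    refine lintegral_congr fun y => ?_
    rw [← lintegral_sub_left_eq_self _ (-x)]
    simp
  have hH : Measurable fun q : Z × Z × Z =>
      G (q.1, q.2.1) * G (q.1, -q.1 - q.2.2) * (f 1 q.2.1 ^ 2 * f 2 q.2.2 ^ 2) := by
    have b1 : Measurable fun q : Z × Z × Z => (q.1, q.2.1) := by fun_prop
    have b2 : Measurable fun q : Z × Z × Z => (q.1, -q.1 - q.2.2) := by
      simp only [sub_eq_add_neg]; fun_prop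
    have b3 : Measurable fun q : Z × Z × Z => q.2.1 := by fun_prop
    have b4 : Measurable fun q : Z × Z × Z => q.2.2 := by fun_prop
    exact ((hI.comp b1).mul (hI.comp b2)).mul
      ((((hf 1).comp b3).pow_const 2).mul (((hf 2).comp b4).pow_const 2))
  have e4 : ∫⁻ x, ∫⁻ y, ∫⁻ v, G (x, y) * G (x, -x - v) * (f 1 y ^ 2 * f 2 v ^ 2) ≤
      M * ((∫⁻ x, f 1 x ^ 2) * ∫⁻ x, f 2 x ^ 2) := by
    have c1 : ∀ y, ∫⁻ x, ∫⁻ v, G (x, y) * G (x, -x - v) * (f 1 y ^ 2 * f 2 v ^ 2) ≤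
        f 1 y ^ 2 * (M * ∫⁻ x, f 2 x ^ 2) := by
      intro y
      have hHy : Measurable fun q : Z × Z =>
          G (q.1, y) * G (q.1, -q.1 - q.2) * (f 1 y ^ 2 * f 2 q.2 ^ 2) := by
        have : Measurable fun q : Z × Z => (q.1, y, q.2) := by fun_prop
        exact hH.comp this
      rw [lintegral_lintegral_swap
        (f := fun x v => G (x, y) * G (x, -x - v) * (f 1 y ^ 2 * f 2 v ^ 2)) hHy.aemeasurable,
        ← lintegral_const_mul M ((hf 2).pow_const 2),
        ← lintegral_const_mul _ (((hf 2).pow_const 2).const_mul M)]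
      refine lintegral_mono fun v => ?_
      have m1 : Measurable fun x => (![x, y, -x - y] : Fin 3 → Z) :=
        measurable_vec3 measurable_id measurable_const (by simp only [sub_eq_add_neg]; fun_prop)
      have m2 : Measurable fun x => (![x, -x - v, v] : Fin 3 → Z) :=
        measurable_vec3 measurable_id (by simp only [sub_eq_add_neg]; fun_prop) measurable_const
      have hs : MeasurableSet {x | ![x, y, -x - y] ∈ Y ∧ ![x, -x - v, v] ∈ Y} :=
        (m1 hY).inter (m2 hY)
      have hGG : ∀ x, G (x, y) * G (x, -x - v) =
          {x | ![x, y, -x - y] ∈ Y ∧ ![x, -x - v, v] ∈ Y}.indicator 1 x := by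
        intro x
        by_cases h1 : ![x, y, -x - y] ∈ Y <;> by_cases h2 : ![x, -x - v, v] ∈ Y <;>
          simp [hG, h1, h2]
      simp only [hGG]
      rw [lintegral_mul_const _ (measurable_one.indicator hs), lintegral_indicator_one hs]
      calc _ ≤ M * (f 1 y ^ 2 * f 2 v ^ 2) := by gcongr; exact hfib y v
        _ = _ := by ring
    have hH2 : Measurable fun q : Z × Z =>
        ∫⁻ v, G (q.1, q.2) * G (q.1, -q.1 - v) * (f 1 q.2 ^ 2 * f 2 v ^ 2) := by
      have b0 : Measurable fun q : (Z × Z) × Z => (q.1.1, q.1.2, q.2) := by fun_prop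
      exact (hH.comp b0).lintegral_prod_right'
    rw [lintegral_lintegral_swap (f := fun x y => ∫⁻ v, G (x, y) * G (x, -x - v) *
      (f 1 y ^ 2 * f 2 v ^ 2)) hH2.aemeasurable]
    refine (lintegral_mono c1).trans_eq ?_
    rw [lintegral_mul_const _ ((hf 1).pow_const 2)]
    ring
  rw [e1]
  calc _ ≤ (∫⁻ x, f 0 x ^ 2) * ∫⁻ x, (∫⁻ y, G (x, y) * (f 1 y * f 2 (-x - y))) ^ 2 :=
        sq_lintegral_mul_le _ (hf 0).aemeasurable
          (hI.mul hg).lintegral_prod_right'.aemeasurable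
    _ ≤ (∫⁻ x, f 0 x ^ 2) * (M * ((∫⁻ x, f 1 x ^ 2) * ∫⁻ x, f 2 x ^ 2)) := by
        gcongr
        refine le_trans (lintegral_mono fun x => ?_) e4
        rw [← e3 x]
        exact e2 x
    _ = _ := by rw [Fin.prod_univ_three]; ring

end Form

/-! ### Volumes of sets with short slices -/

section Volume

open Metric

open scoped RealInnerProductSpace

variable {d : ℕ}

/-- If all slices of `S` in the direction `a` are shorter than `t`, then the translates of `S` by
multiples of `2 t a` are disjoint; there is room in `U` for about `r / (2 t)` of them. -/
theorem volume_le_of_slices {S U : Set (EuclideanSpace ℝ (Fin d))} (hS : MeasurableSet S)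
    (a : EuclideanSpace ℝ (Fin d)) {t r : ℝ} (ht : 0 < t) (hr : 0 < r)
    (hslice : ∀ x ∈ S, ∀ s : ℝ, x + s • a ∈ S → |s| ≤ t)
    (hU : ∀ x ∈ S, ∀ s : ℝ, 0 ≤ s → s ≤ r → x + s • a ∈ U) :
    volume S ≤ ENNReal.ofReal (2 * t / r) * volume U := by
  set m := ⌊r / (2 * t)⌋₊
  set T : ℕ → Set (EuclideanSpace ℝ (Fin d)) := fun k => (fun x => x + (-(k * (2 * t))) • a) ⁻¹' S
  have hTm : ∀ k, MeasurableSet (T k) := fun k => (measurable_add_const _) hS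
  have hTv : ∀ k, volume (T k) = volume S := fun k => measure_preimage_add_right _ _ _
  have hdisj : (↑(Finset.range (m + 1)) : Set ℕ).PairwiseDisjoint T := by
    intro k _ l _ hkl
    refine Set.disjoint_left.2 fun x hx hx' => hkl ?_
    have h1 := hslice _ hx ((k - l : ℝ) * (2 * t)) (by
      have : x + (-(k * (2 * t))) • a + ((k - l : ℝ) * (2 * t)) • a
          = x + (-(l * (2 * t))) • a := by module
      rw [this]; exact hx')
    rw [abs_mul, abs_of_pos (by positivity : 0 < 2 * t)] at h1
    have h2 : |(k : ℝ) - l| < 1 := by nlinarith [abs_nonneg ((k : ℝ) - l)]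
    have h3 : |(k : ℤ) - l| < 1 := by exact_mod_cast h2
    have := Int.abs_lt_one_iff.1 h3
    omega
  have hsub : ⋃ k ∈ Finset.range (m + 1), T k ⊆ U := by
    refine Set.iUnion₂_subset fun k hk x hx => ?_
    have hk' : k ≤ m := by simpa [Nat.lt_succ_iff] using hk
    have h1 : (k : ℝ) ≤ r / (2 * t) := le_trans (by exact_mod_cast hk')
      (Nat.floor_le (by positivity))
    have h2 := hU _ hx (k * (2 * t)) (by positivity) (by rwa [le_div_iff₀ (by positivity)] at h1)
    have : x + (-(k * (2 * t))) • a + ((k : ℝ) * (2 * t)) • a = x := by module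
    rwa [this] at h2
  have h1 : ((m + 1 : ℕ) : ℝ≥0∞) * volume S ≤ volume U := by
    calc _ = ∑ k ∈ Finset.range (m + 1), volume (T k) := by simp [hTv]
      _ = _ := (measure_biUnion_finset hdisj fun k _ => hTm k).symm
      _ ≤ _ := measure_mono hsub
  have h2 : ENNReal.ofReal (r / (2 * t)) ≤ ((m + 1 : ℕ) : ℝ≥0∞) := by
    rw [← ENNReal.ofReal_natCast]
    refine ENNReal.ofReal_le_ofReal ?_
    push_cast
    exact (Nat.lt_floor_add_one _).le
  calc volume S = ENNReal.ofReal (2 * t / r) * (ENNReal.ofReal (r / (2 * t)) * volume S) := by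
        rw [← mul_assoc, ← ENNReal.ofReal_mul (by positivity)]
        have : 2 * t / r * (r / (2 * t)) = 1 := by field_simp
        simp [this]
    _ ≤ ENNReal.ofReal (2 * t / r) * volume U := by gcongr; exact (by gcongr : _ ≤ _).trans h1

/-- The volume of the unit ball. -/
def unitVol (d : ℕ) : ℝ := volume.real (ball (0 : EuclideanSpace ℝ (Fin d)) 1)

theorem unitVol_nonneg (d : ℕ) : 0 ≤ unitVol d := measureReal_nonneg

theorem unitVol_pos (d : ℕ) : 0 < unitVol d :=
  ENNReal.toReal_pos (measure_ball_pos _ _ one_pos).ne' measure_ball_lt_top.ne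

theorem volume_closedBall_eq (q : EuclideanSpace ℝ (Fin d)) {R : ℝ} (hR : 0 ≤ R) :
    volume (closedBall q R) = ENNReal.ofReal (R ^ d * unitVol d) := by
  rw [Measure.addHaar_closedBall _ _ hR, ENNReal.ofReal_mul (by positivity), unitVol,
    ofReal_measureReal measure_ball_lt_top.ne]
  simp

theorem volume_ball_eq (hd : 1 ≤ d) (q : EuclideanSpace ℝ (Fin d)) {R : ℝ} (hR : 0 ≤ R) :
    volume (ball q R) = ENNReal.ofReal (R ^ d * unitVol d) := by
  have : Nonempty (Fin d) := ⟨⟨0, hd⟩⟩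
  rw [Measure.addHaar_ball _ _ hR, ENNReal.ofReal_mul (by positivity), unitVol,
    ofReal_measureReal measure_ball_lt_top.ne]
  simp

theorem volume_le_of_slices_ball (hd : 1 ≤ d) {S : Set (EuclideanSpace ℝ (Fin d))}
    (hS : MeasurableSet S) {q a : EuclideanSpace ℝ (Fin d)} (ha : ‖a‖ = 1) {t R : ℝ} (ht : 0 < t)
    (hR : 0 < R) (hSR : S ⊆ closedBall q R)
    (hslice : ∀ x ∈ S, ∀ s : ℝ, x + s • a ∈ S → |s| ≤ t) :
    volume S ≤ ENNReal.ofReal (2 ^ (d + 1) * unitVol d * t * R ^ (d - 1)) := by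
  refine (volume_le_of_slices (U := closedBall q (2 * R)) hS a ht hR hslice ?_).trans_eq ?_
  · intro x hx s hs0 hsR
    have h1 := mem_closedBall_iff_norm.1 (hSR hx)
    rw [mem_closedBall_iff_norm]
    calc ‖x + s • a - q‖ = ‖(x - q) + s • a‖ := by congr 1; abel
      _ ≤ ‖x - q‖ + ‖s • a‖ := norm_add_le _ _
      _ ≤ R + R := by
        gcongr
        rw [norm_smul, ha, mul_one, Real.norm_of_nonneg hs0]; exact hsR
      _ = 2 * R := by ring
  · rw [volume_closedBall_eq _ (by positivity), ← ENNReal.ofReal_mul (by positivity)]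
    congr 1
    obtain ⟨k, rfl⟩ := Nat.exists_eq_add_of_le' hd
    simp only [Nat.add_sub_cancel]
    field_simp
    ring

theorem abs_le_of_slab {x e : EuclideanSpace ℝ (Fin d)} (he : ‖e‖ = 1) {c w s : ℝ}
    (h : |⟪e, x⟫ - c| ≤ w) (h' : |⟪e, x + s • e⟫ - c| ≤ w) : |s| ≤ 2 * w := by
  rw [inner_add_right, inner_smul_right, real_inner_self_eq_norm_sq, he] at h'
  rw [abs_le] at *
  constructor <;> linarith [h.1, h.2, h'.1, h'.2]

/-- A subset of a ball of radius `R` that lies in a slab of thickness `w` and has slices of length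
`t` in a direction parallel to the slab. -/
theorem volume_le_of_slices_slab (hd : 2 ≤ d) {S : Set (EuclideanSpace ℝ (Fin d))}
    (hS : MeasurableSet S) {q a e : EuclideanSpace ℝ (Fin d)} (ha : ‖a‖ = 1) (he : ‖e‖ = 1)
    (hae : ⟪e, a⟫ = 0) {t w c R : ℝ} (ht : 0 < t) (hw : 0 < w) (hR : 0 < R)
    (hSR : S ⊆ closedBall q R) (hslab : ∀ x ∈ S, |⟪e, x⟫ - c| ≤ w)
    (hslice : ∀ x ∈ S, ∀ s : ℝ, x + s • a ∈ S → |s| ≤ t) :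
    volume S ≤ ENNReal.ofReal (4 ^ (d + 1) * unitVol d * t * w * R ^ (d - 2)) := by
  set U := closedBall q (2 * R) ∩ {x | |⟪e, x⟫ - c| ≤ w} with hUdef
  have hUm : MeasurableSet U := by
    refine measurableSet_closedBall.inter (measurableSet_le ?_ measurable_const)
    fun_prop
  have hUv : volume U ≤ ENNReal.ofReal (2 ^ (d + 1) * unitVol d * (2 * w) * (2 * R) ^ (d - 1)) :=
    volume_le_of_slices_ball (by omega) hUm he (by positivity) (by positivity)
      Set.inter_subset_left fun x hx s hxs => abs_le_of_slab he hx.2 hxs.2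
  refine (volume_le_of_slices (U := U) hS a ht hR hslice ?_).trans ?_
  · intro x hx s hs0 hsR
    refine ⟨?_, ?_⟩
    · have h1 := mem_closedBall_iff_norm.1 (hSR hx)
      rw [mem_closedBall_iff_norm]
      calc ‖x + s • a - q‖ = ‖(x - q) + s • a‖ := by congr 1; abel
        _ ≤ ‖x - q‖ + ‖s • a‖ := norm_add_le _ _
        _ ≤ R + R := by
          gcongr
          rw [norm_smul, ha, mul_one, Real.norm_of_nonneg hs0]; exact hsR
        _ = 2 * R := by ring
    · show |⟪e, x + s • a⟫ - c| ≤ w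
      rw [inner_add_right, inner_smul_right, hae, mul_zero, add_zero]
      exact hslab x hx
  · refine (mul_le_mul_right hUv _).trans ?_
    rw [← ENNReal.ofReal_mul (by positivity)]
    refine ENNReal.ofReal_le_ofReal (le_of_eq ?_)
    obtain ⟨k, rfl⟩ := Nat.exists_eq_add_of_le' hd
    have h4 : (4 : ℝ) = 2 * 2 := by norm_num
    have h1 : k + 2 - 1 = k + 1 := by omega
    simp only [Nat.add_sub_cancel, h1, h4, mul_pow]
    field_simp
    ring

/-- A spherical shell on which the squared distance to the centre varies by at most `2 w` has the
volume of a slab of thickness `w / R`, however small its inner radius: this needs `d ≥ 2`. -/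
theorem volume_shell_le (hd : 2 ≤ d) {S : Set (EuclideanSpace ℝ (Fin d))}
    {c : EuclideanSpace ℝ (Fin d)} {R m w : ℝ} (hR : 0 ≤ R)
    (hSR : ∀ x ∈ S, ‖x - c‖ ≤ R) (hS : ∀ x ∈ S, |‖x - c‖ ^ 2 - m| ≤ w) :
    volume S ≤ ENNReal.ofReal (2 * d * unitVol d * w * R ^ (d - 2)) := by
  rcases S.eq_empty_or_nonempty with rfl | ⟨x₀, hx₀⟩
  · simp
  set b := min (√(m + w)) R
  set a := √(max (m - w) 0)
  have hb : ∀ x ∈ S, ‖x - c‖ ≤ b := fun x hx => le_min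
    (Real.le_sqrt_of_sq_le (by linarith [(abs_le.1 (hS x hx)).2])) (hSR x hx)
  have ha : ∀ x ∈ S, a ≤ ‖x - c‖ := fun x hx => by
    refine Real.sqrt_le_iff.2 ⟨norm_nonneg _, max_le ?_ (sq_nonneg _)⟩
    linarith [(abs_le.1 (hS x hx)).1]
  have ha0 : 0 ≤ a := Real.sqrt_nonneg _
  have hab : a ≤ b := (ha _ hx₀).trans (hb _ hx₀)
  have hbR : b ≤ R := min_le_right _ _
  have hmw : 0 ≤ m + w := by
    have := abs_le.1 (hS _ hx₀)
    nlinarith [sq_nonneg ‖x₀ - c‖]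
  have hw : 0 ≤ w := (abs_nonneg _).trans (hS _ hx₀)
  have hsq : b ^ 2 - a ^ 2 ≤ 2 * w := by
    have h1 : b ^ 2 ≤ m + w := by
      calc b ^ 2 ≤ √(m + w) ^ 2 := by
            have : 0 ≤ b := ha0.trans hab
            gcongr; exact min_le_left _ _
        _ = _ := Real.sq_sqrt hmw
    have h2 : m - w ≤ a ^ 2 := by
      rw [Real.sq_sqrt (le_max_right _ _)]; exact le_max_left _ _
    linarith
  have hpow : ∀ k : ℕ, b ^ (k + 2) - a ^ (k + 2) ≤ (k + 2) * b ^ k * (b ^ 2 - a ^ 2) := by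
    intro k
    have hb0 : 0 ≤ b := ha0.trans hab
    induction k with
    | zero =>
      simp only [zero_add, Nat.cast_zero, pow_zero, mul_one]
      nlinarith
    | succ k ih =>
      have h1 : a ^ (k + 2) * (b - a) ≤ b ^ (k + 1) * (b ^ 2 - a ^ 2) := by
        calc a ^ (k + 2) * (b - a) = a ^ (k + 1) * (a * (b - a)) := by ring
          _ ≤ b ^ (k + 1) * (b ^ 2 - a ^ 2) := by
            have : 0 ≤ b - a := by linarith
            gcongr
            nlinarith
      have h2 := mul_le_mul_of_nonneg_left ih hb0
      push_cast
      calc b ^ (k + 1 + 2) - a ^ (k + 1 + 2)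
          = b * (b ^ (k + 2) - a ^ (k + 2)) + a ^ (k + 2) * (b - a) := by ring
        _ ≤ b * ((k + 2) * b ^ k * (b ^ 2 - a ^ 2)) + b ^ (k + 1) * (b ^ 2 - a ^ 2) :=
          add_le_add h2 h1
        _ = _ := by ring
  calc volume S ≤ volume (closedBall c b \ ball c a) := measure_mono fun x hx =>
        ⟨mem_closedBall_iff_norm.2 (hb x hx), fun h =>
          absurd (mem_ball_iff_norm.1 h) (not_lt.2 (ha x hx))⟩
    _ = volume (closedBall c b) - volume (ball c a) := measure_sdiff
        ((ball_subset_closedBall).trans (closedBall_subset_closedBall hab))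
        measurableSet_ball.nullMeasurableSet measure_ball_lt_top.ne
    _ = ENNReal.ofReal (b ^ d * unitVol d - a ^ d * unitVol d) := by
        rw [volume_closedBall_eq _ (ha0.trans hab), volume_ball_eq (by omega) _ ha0,
          ENNReal.ofReal_sub _ (by have := unitVol_nonneg d; positivity)]
    _ ≤ _ := by
        refine ENNReal.ofReal_le_ofReal ?_
        obtain ⟨k, rfl⟩ := Nat.exists_eq_add_of_le' hd
        have hb0 : 0 ≤ b := ha0.trans hab
        have hab2 : 0 ≤ b ^ 2 - a ^ 2 := sub_nonneg.2 (pow_le_pow_left₀ ha0 hab 2)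
        have hu := unitVol_nonneg (k + 2)
        simp only [Nat.add_sub_cancel]
        push_cast
        calc b ^ (k + 2) * unitVol (k + 2) - a ^ (k + 2) * unitVol (k + 2)
            = unitVol (k + 2) * (b ^ (k + 2) - a ^ (k + 2)) := by ring
          _ ≤ unitVol (k + 2) * ((k + 2) * b ^ k * (b ^ 2 - a ^ 2)) := by gcongr; exact hpow k
          _ ≤ unitVol (k + 2) * ((k + 2) * R ^ k * (2 * w)) := by gcongr
          _ = _ := by ring

/-- A ball of radius `B n` is covered by a number of balls of radius `c n` independent of `n`. -/
theorem exists_volume_le_of_cover (d : ℕ) (B : ℝ) {c : ℝ} (hc : 0 < c) :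
    ∃ m : ℕ, ∀ (n : ℝ) (q : EuclideanSpace ℝ (Fin d)) (S : Set (EuclideanSpace ℝ (Fin d)))
      (V : ℝ≥0∞), 0 < n → S ⊆ closedBall q (B * n) →
        (∀ p, volume (S ∩ closedBall p (c * n)) ≤ V) → volume S ≤ m * V := by
  obtain ⟨T, -, hTf, hT⟩ :=
    (isCompact_closedBall (0 : EuclideanSpace ℝ (Fin d)) B).finite_cover_balls hc
  lift T to Finset (EuclideanSpace ℝ (Fin d)) using hTf
  refine ⟨T.card, fun n q S V hn hS hV => ?_⟩
  have hcov : S ⊆ ⋃ y ∈ T, S ∩ closedBall (q + n • y) (c * n) := by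
    intro x hx
    have h1 : n⁻¹ • (x - q) ∈ closedBall (0 : EuclideanSpace ℝ (Fin d)) B := by
      rw [mem_closedBall_zero_iff, norm_smul, Real.norm_of_nonneg (by positivity),
        inv_mul_le_iff₀ hn, mul_comm]
      exact mem_closedBall_iff_norm.1 (hS hx)
    obtain ⟨y, hy, hxy⟩ := Set.mem_iUnion₂.1 (hT h1)
    refine Set.mem_iUnion₂.2 ⟨y, hy, hx, ?_⟩
    rw [mem_ball_iff_norm] at hxy
    rw [mem_closedBall_iff_norm]
    have : x - (q + n • y) = n • (n⁻¹ • (x - q) - y) := by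
      rw [smul_sub, smul_smul, mul_inv_cancel₀ hn.ne', one_smul]; abel
    rw [this, norm_smul, Real.norm_of_nonneg hn.le, mul_comm]
    gcongr
  calc volume S ≤ volume (⋃ y ∈ T, S ∩ closedBall (q + n • y) (c * n)) := measure_mono hcov
    _ ≤ ∑ y ∈ T, volume (S ∩ closedBall (q + n • y) (c * n)) := measure_biUnion_finset_le _ _
    _ ≤ ∑ _y ∈ T, V := Finset.sum_le_sum fun y _ => hV _
    _ = _ := by simp

end Volume

/-! ### From square bounds to the multiplier norm -/

section Norm

variable {d : ℕ}

instance : (volume : Measure (Freq d)).IsAddHaarMeasure :=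
  inferInstanceAs
    ((volume : Measure (EuclideanSpace ℝ (Fin d))).prod (volume : Measure ℝ)).IsAddHaarMeasure

theorem multiplierNorm_indicator_le {X : Set (Fin 3 → Freq d)} (hX : MeasurableSet X) {M : ℝ}
    (hM : 0 ≤ M) (h : SqBound X (ENNReal.ofReal M)) :
    multiplierNorm (X.indicator (1 : (Fin 3 → Freq d) → ℂ)) ≤ ENNReal.ofReal (M ^ (1 / 2 : ℝ)) := by
  refine sInf_le fun f hfc hfs => ?_
  have hg : ∀ j, Measurable fun z => ‖f j z‖ₑ := fun j => (hfc j).measurable.enorm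
  have hL2 : ∀ j, eLpNorm (f j) 2 volume = (∫⁻ z, ‖f j z‖ₑ ^ 2) ^ (1 / 2 : ℝ) := by
    intro j
    rw [eLpNorm_eq_lintegral_rpow_enorm_toReal (by norm_num) (by norm_num)]
    norm_num
  have henorm : ∀ p : Freq d × Freq d,
      ‖X.indicator (1 : (Fin 3 → Freq d) → ℂ) (gammaPoint p) * ∏ j, f j (gammaPoint p j)‖ₑ =
        X.indicator 1 (gammaPoint p) * ∏ j, ‖f j (gammaPoint p j)‖ₑ := by
    intro p
    by_cases hp : gammaPoint p ∈ X <;> simp [hp, Fin.prod_univ_three, enorm_mul]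
  have hbound : ∫⁻ p : Freq d × Freq d,
      ‖X.indicator (1 : (Fin 3 → Freq d) → ℂ) (gammaPoint p) * ∏ j, f j (gammaPoint p j)‖ₑ ≤
        ENNReal.ofReal (M ^ (1 / 2 : ℝ)) * ∏ j, eLpNorm (f j) 2 volume := by
    simp only [henorm, hL2]
    have h1 := h (fun j z => ‖f j z‖ₑ) hg
    unfold triForm at h1
    rw [← ENNReal.ofReal_rpow_of_nonneg hM (by norm_num),
      ENNReal.prod_rpow_of_nonneg (by norm_num), ← ENNReal.mul_rpow_of_nonneg _ _ (by norm_num)]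
    rw [← ENNReal.rpow_two] at h1
    have h2 := ENNReal.rpow_le_rpow h1 (by norm_num : (0 : ℝ) ≤ 1 / 2)
    rwa [← ENNReal.rpow_mul, mul_one_div_cancel two_ne_zero, ENNReal.rpow_one] at h2
  have hmeas : Measurable fun p : Freq d × Freq d =>
      X.indicator (1 : (Fin 3 → Freq d) → ℂ) (gammaPoint p) * ∏ j, f j (gammaPoint p j) := by
    refine ((measurable_one.indicator hX).comp measurable_gammaPoint).mul
      (Finset.measurable_prod _ fun j _ => (hfc j).measurable.comp
        ((measurable_pi_apply j).comp measurable_gammaPoint))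
  refine ⟨⟨hmeas.aestronglyMeasurable, lt_of_le_of_lt hbound ?_⟩,
    (enorm_integral_le_lintegral_enorm _).trans hbound⟩
  exact ENNReal.mul_lt_top ENNReal.ofReal_lt_top (ENNReal.prod_lt_top fun j _ =>
    ((hfc j).memLp_of_hasCompactSupport (hfs j)).eLpNorm_lt_top)

end Norm

/-! ### Localisation of one frequency to a ball -/

section Localisation

open Metric

variable {d : ℕ}

theorem SqBound.to_perm (σ : Equiv.Perm (Fin 3)) {X : Set (Fin 3 → Freq d)} (hX : MeasurableSet X)
    {M : ℝ≥0∞} (h : SqBound X M) : SqBound {z | z ∘ σ ∈ X} M := by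
  refine SqBound.of_perm σ.symm (measurableSet_perm σ hX) ?_
  have : {z : Fin 3 → Freq d | z ∘ ⇑σ.symm ∈ {z : Fin 3 → Freq d | z ∘ σ ∈ X}} = X := by
    ext z; simp [Function.comp_assoc]
  rwa [this]

theorem lintegral_ball_mul {g : Freq d → ℝ≥0∞} (hg : Measurable g) (r s : ℝ) :
    ∫⁻ p : EuclideanSpace ℝ (Fin d), ∫⁻ z : Freq d,
        (closedBall (0 : EuclideanSpace ℝ (Fin d)) r).indicator 1 (s • z.1 - p) * g z =
      volume (closedBall (0 : EuclideanSpace ℝ (Fin d)) r) * ∫⁻ z, g z := by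
  have hm : Measurable fun q : EuclideanSpace ℝ (Fin d) × Freq d =>
      (closedBall (0 : EuclideanSpace ℝ (Fin d)) r).indicator
        (1 : EuclideanSpace ℝ (Fin d) → ℝ≥0∞) (s • q.2.1 - q.1) * g q.2 := by
    refine ((measurable_one.indicator measurableSet_closedBall).comp ?_).mul
      (hg.comp measurable_snd)
    fun_prop
  rw [lintegral_lintegral_swap (f := fun p z =>
    (closedBall (0 : EuclideanSpace ℝ (Fin d)) r).indicator 1 (s • z.1 - p) * g z) hm.aemeasurable,
    ← lintegral_const_mul _ hg]
  refine lintegral_congr fun z => ?_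
  have hc : Measurable fun p => (closedBall (0 : EuclideanSpace ℝ (Fin d)) r).indicator
      (1 : EuclideanSpace ℝ (Fin d) → ℝ≥0∞) (s • z.1 - p) :=
    (measurable_one.indicator measurableSet_closedBall).comp (by fun_prop)
  rw [lintegral_mul_const _ hc,
    lintegral_sub_left_eq_self (fun p => (closedBall (0 : EuclideanSpace ℝ (Fin d)) r).indicator
      (1 : EuclideanSpace ℝ (Fin d) → ℝ≥0∞) p), lintegral_indicator_one measurableSet_closedBall]

/-- The case `i = 0`, `j = 1` of `SqBound.of_local`. -/
theorem SqBound.of_local_aux {X : Set (Fin 3 → Freq d)} (hX : MeasurableSet X) {r R : ℝ}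
    (hr : 0 < r) (hR : 0 ≤ R) (hsum : ∀ ζ ∈ X, ∑ l, ζ l = 0 → ‖(ζ 0).1 + (ζ 1).1‖ ≤ R) {M : ℝ≥0∞}
    (h : ∀ p, SqBound (X ∩ {ζ | ‖(ζ 0).1 - p‖ ≤ r}) M) :
    SqBound X (ENNReal.ofReal (((r + R) / r) ^ d) * M) := by
  intro f hf
  -- averaging over the centre `p` of the ball, and Cauchy–Schwarz in `p`
  set χ : ℝ → EuclideanSpace ℝ (Fin d) → ℝ≥0∞ := fun ρ => (closedBall 0 ρ).indicator 1 with hχ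
  have hχm : ∀ ρ, Measurable (χ ρ) := fun ρ => measurable_one.indicator measurableSet_closedBall
  set g : EuclideanSpace ℝ (Fin d) → Fin 3 → Freq d → ℝ≥0∞ := fun p =>
    ![fun z => χ r ((1 : ℝ) • z.1 - p) * f 0 z,
      fun z => χ (r + R) ((-1 : ℝ) • z.1 - p) * f 1 z, f 2] with hgdef
  have hgm : ∀ p j, Measurable (g p j) := by
    intro p j
    fin_cases j
    · exact ((hχm r).comp (by fun_prop)).mul (hf 0)
    · exact ((hχm (r + R)).comp (by fun_prop)).mul (hf 1)
    · exact hf 2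
  set v : ℝ → ℝ≥0∞ := fun ρ => volume (closedBall (0 : EuclideanSpace ℝ (Fin d)) ρ) with hv
  have hχsq : ∀ ρ x, χ ρ x ^ 2 = χ ρ x := by
    intro ρ x
    by_cases hx : x ∈ closedBall 0 ρ <;> simp [hχ, hx]
  have hXi : Measurable fun q : Freq d × Freq d =>
      X.indicator (1 : (Fin 3 → Freq d) → ℝ≥0∞) (gammaPoint q) :=
    (measurable_one.indicator hX).comp measurable_gammaPoint
  have hF : Measurable fun q : Freq d × Freq d =>
      X.indicator (1 : (Fin 3 → Freq d) → ℝ≥0∞) (gammaPoint q) * ∏ j, f j (gammaPoint q j) :=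
    hXi.mul (Finset.measurable_prod _ fun j _ => (hf j).comp
      ((measurable_pi_apply j).comp measurable_gammaPoint))
  have key1 : v r * triForm X f ≤
      ∫⁻ p, triForm (X ∩ {ζ | ‖(ζ 0).1 - p‖ ≤ r}) (g p) := by
    have hm : Measurable fun w : EuclideanSpace ℝ (Fin d) × (Freq d × Freq d) =>
        χ r (w.2.1.1 - w.1) *
          (X.indicator (1 : (Fin 3 → Freq d) → ℝ≥0∞) (gammaPoint w.2) *
            ∏ j, f j (gammaPoint w.2 j)) :=
      ((hχm r).comp (by fun_prop)).mul (hF.comp measurable_snd)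
    calc v r * triForm X f = ∫⁻ p, ∫⁻ q : Freq d × Freq d, χ r (q.1.1 - p) *
          (X.indicator (1 : (Fin 3 → Freq d) → ℝ≥0∞) (gammaPoint q) *
            ∏ j, f j (gammaPoint q j)) := by
          rw [lintegral_lintegral_swap (f := fun p (q : Freq d × Freq d) => χ r (q.1.1 - p) *
            (X.indicator (1 : (Fin 3 → Freq d) → ℝ≥0∞) (gammaPoint q) *
              ∏ j, f j (gammaPoint q j)))
            hm.aemeasurable, triForm, ← lintegral_const_mul _ hF]
          refine lintegral_congr fun q => ?_
          have hc : Measurable fun p => χ r (q.1.1 - p) := (hχm r).comp (by fun_prop)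
          rw [lintegral_mul_const _ hc,
            lintegral_sub_left_eq_self (χ r), lintegral_indicator_one measurableSet_closedBall]
      _ ≤ _ := by
          refine lintegral_mono fun p => lintegral_mono fun q => ?_
          by_cases h1 : q.1.1 - p ∈ closedBall (0 : EuclideanSpace ℝ (Fin d)) r
          · by_cases h2 : gammaPoint q ∈ X
            · have h3 : gammaPoint q ∈ X ∩ {ζ | ‖(ζ 0).1 - p‖ ≤ r} :=
                ⟨h2, by simpa [gammaPoint] using h1⟩
              have h4 : -q.2.1 - p ∈ closedBall (0 : EuclideanSpace ℝ (Fin d)) (r + R) := by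
                rw [mem_closedBall_zero_iff] at h1 ⊢
                have h5 := hsum _ h2 (by simp [gammaPoint, Fin.sum_univ_three])
                calc ‖-q.2.1 - p‖ = ‖(q.1.1 - p) - (q.1.1 + q.2.1)‖ := by congr 1; abel
                  _ ≤ ‖q.1.1 - p‖ + ‖q.1.1 + q.2.1‖ := norm_sub_le _ _
                  _ ≤ r + R := add_le_add h1 h5
              have h6 : χ r (q.1.1 - p) = 1 := Set.indicator_of_mem h1 _
              have h7 : χ (r + R) (-q.2.1 - p) = 1 := Set.indicator_of_mem h4 _
              rw [Set.indicator_of_mem h2, Set.indicator_of_mem h3]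
              simp [hgdef, Fin.prod_univ_three, gammaPoint, h6, h7]
            · simp [h2]
          · simp [hχ, h1]
  have key2 : (∫⁻ p, triForm (X ∩ {ζ | ‖(ζ 0).1 - p‖ ≤ r}) (g p)) ^ 2 ≤
      M * (v r * v (r + R)) * ∏ j, ∫⁻ z, f j z ^ 2 := by
    set a : EuclideanSpace ℝ (Fin d) → ℝ≥0∞ := fun p =>
      ∫⁻ z : Freq d, χ r ((1 : ℝ) • z.1 - p) * f 0 z ^ 2 with ha
    set b : EuclideanSpace ℝ (Fin d) → ℝ≥0∞ := fun p =>
      ∫⁻ z : Freq d, χ (r + R) ((-1 : ℝ) • z.1 - p) * f 1 z ^ 2 with hb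
    have ham : Measurable a := by
      refine Measurable.lintegral_prod_right' (f := fun q : EuclideanSpace ℝ (Fin d) × Freq d =>
        χ r ((1 : ℝ) • q.2.1 - q.1) * f 0 q.2 ^ 2) ?_
      exact ((hχm r).comp (by fun_prop)).mul (((hf 0).comp measurable_snd).pow_const 2)
    have hbm : Measurable b := by
      refine Measurable.lintegral_prod_right' (f := fun q : EuclideanSpace ℝ (Fin d) × Freq d =>
        χ (r + R) ((-1 : ℝ) • q.2.1 - q.1) * f 1 q.2 ^ 2) ?_
      exact ((hχm (r + R)).comp (by fun_prop)).mul (((hf 1).comp measurable_snd).pow_const 2)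
    have hT : ∀ p, triForm (X ∩ {ζ | ‖(ζ 0).1 - p‖ ≤ r}) (g p) ≤
        (M * ∫⁻ z, f 2 z ^ 2) ^ (1 / 2 : ℝ) * (a p ^ (1 / 2 : ℝ) * b p ^ (1 / 2 : ℝ)) := by
      intro p
      have h1 := h p (g p) (hgm p)
      have h2 : ∏ j, ∫⁻ z, g p j z ^ 2 = a p * b p * ∫⁻ z, f 2 z ^ 2 := by
        simp [Fin.prod_univ_three, hgdef, ha, hb, mul_pow, hχsq]
      rw [h2, ← ENNReal.rpow_two] at h1
      have h3 := ENNReal.rpow_le_rpow h1 (by norm_num : (0 : ℝ) ≤ 1 / 2)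
      rw [← ENNReal.rpow_mul, mul_one_div_cancel two_ne_zero, ENNReal.rpow_one] at h3
      refine h3.trans_eq ?_
      rw [← ENNReal.mul_rpow_of_nonneg _ _ (by norm_num),
        ← ENNReal.mul_rpow_of_nonneg _ _ (by norm_num)]
      congr 1; ring
    have hsqrt : ∀ x : ℝ≥0∞, (x ^ (1 / 2 : ℝ)) ^ 2 = x := fun x => by
      rw [← ENNReal.rpow_two, ← ENNReal.rpow_mul]; norm_num
    have hint_a : ∫⁻ p, a p = v r * ∫⁻ z, f 0 z ^ 2 :=
      lintegral_ball_mul ((hf 0).pow_const 2) r 1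
    have hint_b : ∫⁻ p, b p = v (r + R) * ∫⁻ z, f 1 z ^ 2 :=
      lintegral_ball_mul ((hf 1).pow_const 2) (r + R) (-1)
    calc _ ≤ (∫⁻ p, (M * ∫⁻ z, f 2 z ^ 2) ^ (1 / 2 : ℝ) *
            (a p ^ (1 / 2 : ℝ) * b p ^ (1 / 2 : ℝ))) ^ 2 := by
          gcongr with p; exact hT p
      _ = (M * ∫⁻ z, f 2 z ^ 2) * (∫⁻ p, a p ^ (1 / 2 : ℝ) * b p ^ (1 / 2 : ℝ)) ^ 2 := by
          have hab : Measurable fun p => a p ^ (1 / 2 : ℝ) * b p ^ (1 / 2 : ℝ) :=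
            (ham.pow_const _).mul (hbm.pow_const _)
          rw [lintegral_const_mul _ hab, mul_pow, hsqrt]
      _ ≤ (M * ∫⁻ z, f 2 z ^ 2) * ((∫⁻ p, (a p ^ (1 / 2 : ℝ)) ^ 2) *
            ∫⁻ p, (b p ^ (1 / 2 : ℝ)) ^ 2) := by
          gcongr
          exact sq_lintegral_mul_le _ (ham.pow_const _).aemeasurable (hbm.pow_const _).aemeasurable
      _ = _ := by
          simp only [hsqrt]
          rw [hint_a, hint_b, Fin.prod_univ_three]
          ring
  have hvr : v r ≠ 0 := (measure_closedBall_pos _ _ hr).ne'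
  have hvt : v r ≠ ∞ := measure_closedBall_lt_top.ne
  have hvR : v (r + R) = ENNReal.ofReal (((r + R) / r) ^ d) * v r := by
    simp only [hv]
    rw [volume_closedBall_eq _ (by positivity), volume_closedBall_eq _ hr.le,
      ← ENNReal.ofReal_mul (by positivity)]
    congr 1
    rw [div_pow]
    field_simp
  have h3 : (v r * v r) * triForm X f ^ 2 ≤
      (v r * v r) * (ENNReal.ofReal (((r + R) / r) ^ d) * M * ∏ j, ∫⁻ z, f j z ^ 2) := by
    calc (v r * v r) * triForm X f ^ 2 = (v r * triForm X f) ^ 2 := by ring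
      _ ≤ _ := by gcongr
      _ ≤ _ := key2
      _ = _ := by rw [hvR]; ring
  exact (ENNReal.mul_le_mul_iff_right (mul_ne_zero hvr hvr) (ENNReal.mul_ne_top hvt hvt)).1 h3

/-- If `|ξ_i + ξ_j| ≤ R` on `X`, then localising `ξ_i` to a ball of radius `r` confines `ξ_j` to a
ball of radius `r + R`, and the norm of the multiplier is controlled by those of its localisations,
by almost orthogonality. -/
theorem SqBound.of_local {X : Set (Fin 3 → Freq d)} (hX : MeasurableSet X) {i j : Fin 3}
    (hij : i ≠ j) {r R : ℝ} (hr : 0 < r) (hR : 0 ≤ R)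
    (hsum : ∀ ζ ∈ X, ∑ l, ζ l = 0 → ‖(ζ i).1 + (ζ j).1‖ ≤ R) {M : ℝ≥0∞}
    (h : ∀ p, SqBound (X ∩ {ζ | ‖(ζ i).1 - p‖ ≤ r}) M) :
    SqBound X (ENNReal.ofReal (((r + R) / r) ^ d) * M) := by
  obtain ⟨σ, hi, hj⟩ := exists_perm hij
  refine SqBound.of_perm σ hX (SqBound.of_local_aux (measurableSet_perm σ hX) hr hR ?_ ?_)
  · intro ζ hζ h0
    have := hsum _ hζ (by simp only [Function.comp_apply]; rwa [Equiv.sum_comp σ ζ])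
    simpa [hi, hj] using this
  · intro p
    have hm : MeasurableSet {ζ : Fin 3 → Freq d | ‖(ζ i).1 - p‖ ≤ r} :=
      measurableSet_le (by fun_prop) measurable_const
    have := SqBound.to_perm σ (hX.inter hm) (h p)
    convert this using 1
    ext ζ
    simp [hi]

end Localisation

/-! ### Integrating out the time frequencies -/

section TimeFrequency

variable {d : ℕ}

@[fun_prop]
theorem continuous_dispersion (j : Fin 3) : Continuous (dispersion (d := d) j) := by
  fin_cases j
  · exact continuous_norm.pow 2
  · exact continuous_norm.pow 2
  · exact (continuous_norm.pow 2).neg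

/-- The resonance function as a function of the spatial frequencies. -/
def spatialResonance (ξ : Fin 3 → EuclideanSpace ℝ (Fin d)) : ℝ := ∑ j, dispersion j (ξ j)

theorem continuous_spatialResonance :
    Continuous (spatialResonance (d := d)) := by
  unfold spatialResonance
  fun_prop

/-- The frequencies whose spatial part lies in `P` and whose modulations are at most `W`. -/
def modSet (P : Set (Fin 3 → EuclideanSpace ℝ (Fin d))) (W : Fin 3 → ℝ) : Set (Fin 3 → Freq d) :=
  {z | (fun j => (z j).1) ∈ P ∧ ∀ j, |modulation j (z j)| ≤ W j}

theorem measurableSet_modSet {P : Set (Fin 3 → EuclideanSpace ℝ (Fin d))} (hP : MeasurableSet P)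
    (W : Fin 3 → ℝ) : MeasurableSet (modSet P W) := by
  have h1 : Measurable fun z : Fin 3 → Freq d => fun j => (z j).1 := by fun_prop
  refine (h1 hP).inter ?_
  refine MeasurableSet.congr (s := ⋂ j, {z : Fin 3 → Freq d | |modulation j (z j)| ≤ W j})
    (MeasurableSet.iInter fun j => ?_) (Set.ext fun z => Set.mem_iInter)
  refine measurableSet_le (Continuous.measurable ?_) measurable_const
  unfold modulation
  fun_prop

theorem sum_fin_three_of_ne {k i l : Fin 3} (hki : k ≠ i) (hkl : k ≠ l) (hil : i ≠ l)
    {M : Type*} [AddCommMonoid M] (g : Fin 3 → M) : ∑ j, g j = g k + g i + g l := by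
  have : (Finset.univ : Finset (Fin 3)) = {k, i, l} := by
    revert hki hkl hil; revert k i l; decide
  rw [this, Finset.sum_insert (by simp [hki, hkl]), Finset.sum_insert (by simpa using hil),
    Finset.sum_singleton, add_assoc]

theorem sum_modulation {z : Fin 3 → Freq d} (hz : ∑ j, z j = 0) :
    ∑ j, modulation j (z j) = -spatialResonance (fun j => (z j).1) := by
  have : ∑ j, (z j).2 = 0 := by
    have := congrArg Prod.snd hz
    rwa [Prod.snd_sum] at this
  simp [modulation, spatialResonance, Finset.sum_sub_distrib, this]

theorem volume_strip_le (S : Set (EuclideanSpace ℝ (Fin d))) {φ : EuclideanSpace ℝ (Fin d) → ℝ}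
    (hφ : Continuous φ) (w : ℝ) :
    volume {z : Freq d | z.1 ∈ S ∧ |z.2 - φ z.1| ≤ w} ≤ ENNReal.ofReal (2 * w) * volume S := by
  have hm : MeasurableSet {z : Freq d | z.1 ∈ toMeasurable volume S ∧ |z.2 - φ z.1| ≤ w} := by
    have h2 : MeasurableSet {z : Freq d | |z.2 - φ z.1| ≤ w} :=
      measurableSet_le (Continuous.measurable (by fun_prop)) measurable_const
    exact (measurable_fst (measurableSet_toMeasurable _ _)).inter h2
  calc volume {z : Freq d | z.1 ∈ S ∧ |z.2 - φ z.1| ≤ w}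
      ≤ volume {z : Freq d | z.1 ∈ toMeasurable volume S ∧ |z.2 - φ z.1| ≤ w} :=
        measure_mono fun z hz => ⟨subset_toMeasurable _ _ hz.1, hz.2⟩
    _ = ∫⁻ x, volume (Prod.mk x ⁻¹' {z : Freq d | z.1 ∈ toMeasurable volume S ∧
          |z.2 - φ z.1| ≤ w}) := Measure.prod_apply hm
    _ ≤ ∫⁻ x, (toMeasurable volume S).indicator (fun _ => ENNReal.ofReal (2 * w)) x := by
        refine lintegral_mono fun x => ?_
        by_cases hx : x ∈ toMeasurable volume S
        · rw [Set.indicator_of_mem hx, ← Real.volume_closedBall (φ x) w]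
          exact measure_mono fun τ hτ => by simpa [Real.dist_eq] using hτ.2
        · simp [hx]
    _ = _ := by
        rw [lintegral_indicator_const (measurableSet_toMeasurable _ _), measure_toMeasurable]

/-- The distribution of the modulations in `SqBound.of_fiber`: once `z_k` is fixed, the resonance is
determined up to the other two modulations, the smaller of which bounds the time frequency. -/
theorem SqBound.modSet_of_fiber {P : Set (Fin 3 → EuclideanSpace ℝ (Fin d))} (hP : MeasurableSet P)
    {W : Fin 3 → ℝ} {k i l : Fin 3} (hki : k ≠ i) (hkl : k ≠ l) (hil : i ≠ l) {V : ℝ≥0∞}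
    (h : ∀ w c, volume {x | ∃ ξ ∈ P, ∑ j, ξ j = 0 ∧ ξ k = w ∧ ξ i = x ∧
      |spatialResonance ξ - c| ≤ W i + W l} ≤ V) :
    SqBound (modSet P W) (ENNReal.ofReal (2 * min (W i) (W l)) * V) := by
  refine SqBound.of_fiber (measurableSet_modSet hP W) hki fun w => ?_
  set c := -modulation k w
  set S := {x | ∃ ξ ∈ P, ∑ j, ξ j = 0 ∧ ξ k = w.1 ∧ ξ i = x ∧ |spatialResonance ξ - c| ≤ W i + W l}
  have hres : ∀ ζ ∈ modSet P W, ∑ j, ζ j = 0 → ζ k = w → (ζ i).1 ∈ S := by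
    intro ζ hζ h0 hk
    refine ⟨fun j => (ζ j).1, hζ.1, ?_, by simp [hk], rfl, ?_⟩
    · have := congrArg Prod.fst h0
      rwa [Prod.fst_sum] at this
    · have h1 := sum_modulation h0
      rw [sum_fin_three_of_ne hki hkl hil, hk] at h1
      have : spatialResonance (fun j => (ζ j).1) - c =
          -(modulation i (ζ i) + modulation l (ζ l)) := by
        simp only [c]; linarith
      rw [this, abs_neg]
      exact (abs_add_le _ _).trans (add_le_add (hζ.2 i) (hζ.2 l))
  have b1 : volume {x | ∃ ζ ∈ modSet P W, ∑ j, ζ j = 0 ∧ ζ k = w ∧ ζ i = x} ≤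
      ENNReal.ofReal (2 * W i) * V := by
    refine (measure_mono ?_).trans ((volume_strip_le S (continuous_dispersion i) (W i)).trans
      (mul_le_mul_right (h w.1 c) _))
    rintro x ⟨ζ, hζ, h0, hk, rfl⟩
    exact ⟨hres ζ hζ h0 hk, hζ.2 i⟩
  have b2 : volume {x | ∃ ζ ∈ modSet P W, ∑ j, ζ j = 0 ∧ ζ k = w ∧ ζ i = x} ≤
      ENNReal.ofReal (2 * W l) * V := by
    refine (measure_mono ?_).trans ((volume_strip_le S
      (φ := fun x => -w.2 - dispersion l (-w.1 - x)) (by fun_prop) (W l)).trans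
      (mul_le_mul_right (h w.1 c) _))
    rintro x ⟨ζ, hζ, h0, hk, rfl⟩
    refine ⟨hres ζ hζ h0 hk, ?_⟩
    have hl : ζ l = -w - ζ i := by
      rw [sum_fin_three_of_ne hki hkl hil, hk] at h0
      rw [eq_sub_iff_add_eq, eq_neg_iff_add_eq_zero, ← h0]; abel
    have := hζ.2 l
    rw [hl] at this
    simp only [modulation, Prod.fst_sub, Prod.snd_sub, Prod.fst_neg, Prod.snd_neg] at this
    rw [abs_sub_comm]
    calc _ = _ := by congr 1; ring
      _ ≤ _ := this
  rcases min_choice (W i) (W l) with hmin | hmin <;> rw [hmin]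
  exacts [b1, b2]

/-- The distribution of the modulations in `SqBound.of_fourfold`: the common variable `z_k` and both
of the variables derived from it confine the time frequency, and the difference of the two
resonances is determined up to the modulations of the latter. -/
theorem SqBound.modSet_of_fourfold {P : Set (Fin 3 → EuclideanSpace ℝ (Fin d))}
    (hP : MeasurableSet P) {W : Fin 3 → ℝ} {i j k : Fin 3} (hij : i ≠ j) (hik : i ≠ k)
    (hjk : j ≠ k) {V : ℝ≥0∞}
    (h : ∀ u v c, volume {x | ∃ ξ ∈ P, ∃ ξ' ∈ P, ∑ l, ξ l = 0 ∧ ∑ l, ξ' l = 0 ∧ ξ k = x ∧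
      ξ' k = x ∧ ξ i = u ∧ ξ' j = v ∧
      |spatialResonance ξ - spatialResonance ξ' - c| ≤ W i + W j} ≤ V) :
    SqBound (modSet P W) (ENNReal.ofReal (2 * min3 W) * V) := by
  refine SqBound.of_fourfold (measurableSet_modSet hP W) hij hik hjk fun u v => ?_
  set c := modulation j v - modulation i u
  set S := {x | ∃ ξ ∈ P, ∃ ξ' ∈ P, ∑ l, ξ l = 0 ∧ ∑ l, ξ' l = 0 ∧ ξ k = x ∧
      ξ' k = x ∧ ξ i = u.1 ∧ ξ' j = v.1 ∧
      |spatialResonance ξ - spatialResonance ξ' - c| ≤ W i + W j}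
  set T := {x | (∃ ζ ∈ modSet P W, ∑ l, ζ l = 0 ∧ ζ k = x ∧ ζ i = u) ∧
      ∃ ζ ∈ modSet P W, ∑ l, ζ l = 0 ∧ ζ k = x ∧ ζ j = v} with hT
  have hres : ∀ x ∈ T, x.1 ∈ S := by
    rintro x ⟨⟨ζ, hζ, h0, hk, hi⟩, ⟨ζ', hζ', h0', hk', hj⟩⟩
    have hf : ∀ {η : Fin 3 → Freq d}, ∑ l, η l = 0 → ∑ l, (η l).1 = 0 := fun h0 => by
      have := congrArg Prod.fst h0
      rwa [Prod.fst_sum] at this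
    refine ⟨fun j => (ζ j).1, hζ.1, fun j => (ζ' j).1, hζ'.1, hf h0, hf h0', by simp [hk],
      by simp [hk'], by simp [hi], by simp [hj], ?_⟩
    have h1 := sum_modulation h0
    have h2 := sum_modulation h0'
    rw [sum_fin_three_of_ne hik.symm hjk.symm hij, hk, hi] at h1
    rw [sum_fin_three_of_ne hik.symm hjk.symm hij, hk', hj] at h2
    have : spatialResonance (fun j => (ζ j).1) - spatialResonance (fun j => (ζ' j).1) - c =
        modulation i (ζ' i) - modulation j (ζ j) := by
      simp only [c]; linarith
    rw [this]
    exact (abs_sub _ _).trans (add_le_add (hζ'.2 i) (hζ.2 j))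
  have b1 : volume T ≤ ENNReal.ofReal (2 * W k) * V := by
    refine (measure_mono ?_).trans ((volume_strip_le S (continuous_dispersion k) (W k)).trans
      (mul_le_mul_right (h u.1 v.1 c) _))
    rintro x hx
    refine ⟨hres x hx, ?_⟩
    obtain ⟨⟨ζ, hζ, h0, rfl, hi⟩, -⟩ := hx
    exact hζ.2 k
  have hthird : ∀ {b : Fin 3} {y x : Freq d} {ζ : Fin 3 → Freq d}, ζ ∈ modSet P W →
      ζ b = -y - x → |x.2 - (-y.2 - dispersion b (-y.1 - x.1))| ≤ W b := by
    intro b y x ζ hζ hb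
    have := hζ.2 b
    rw [hb] at this
    simp only [modulation, Prod.fst_sub, Prod.snd_sub, Prod.fst_neg, Prod.snd_neg] at this
    rw [abs_sub_comm]
    calc _ = _ := by congr 1; ring
      _ ≤ _ := this
  have b2 : volume T ≤ ENNReal.ofReal (2 * W j) * V := by
    refine (measure_mono ?_).trans ((volume_strip_le S
      (φ := fun x => -u.2 - dispersion j (-u.1 - x)) (by fun_prop) (W j)).trans
      (mul_le_mul_right (h u.1 v.1 c) _))
    rintro x hx
    refine ⟨hres x hx, ?_⟩
    obtain ⟨⟨ζ, hζ, h0, hk, hi⟩, -⟩ := hx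
    refine hthird hζ ?_
    rw [sum_fin_three_of_ne hik.symm hjk.symm hij, hk, hi] at h0
    rw [eq_sub_iff_add_eq, eq_neg_iff_add_eq_zero, ← h0]; abel
  have b3 : volume T ≤ ENNReal.ofReal (2 * W i) * V := by
    refine (measure_mono ?_).trans ((volume_strip_le S
      (φ := fun x => -v.2 - dispersion i (-v.1 - x)) (by fun_prop) (W i)).trans
      (mul_le_mul_right (h u.1 v.1 c) _))
    rintro x hx
    refine ⟨hres x hx, ?_⟩
    obtain ⟨-, ⟨ζ, hζ, h0, hk, hj⟩⟩ := hx
    refine hthird hζ ?_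
    rw [sum_fin_three_of_ne hik.symm hjk.symm hij, hk, hj] at h0
    rw [eq_sub_iff_add_eq, eq_neg_iff_add_eq_zero, ← h0]; abel
  have hall : ∀ a, volume T ≤ ENNReal.ofReal (2 * W a) * V := by
    intro a
    have : a = k ∨ a = i ∨ a = j := by
      revert hij hik hjk; clear * - ; revert i j k a; decide
    rcases this with rfl | rfl | rfl
    exacts [b1, b3, b2]
  obtain ⟨a, ha⟩ : ∃ a, min3 W = W a := by
    rcases min_choice (min (W 0) (W 1)) (W 2) with h1 | h1
    · rcases min_choice (W 0) (W 1) with h2 | h2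
      · exact ⟨0, h1.trans h2⟩
      · exact ⟨1, h1.trans h2⟩
    · exact ⟨2, h1⟩
  rw [ha]
  exact hall a

end TimeFrequency

/-! ### Cauchy–Schwarz bounds from slabs -/

section Fiber

open Metric

open scoped RealInnerProductSpace

variable {d : ℕ}

theorem spatialResonance_eq {ξ : Fin 3 → EuclideanSpace ℝ (Fin d)} (h : ∑ j, ξ j = 0) :
    spatialResonance ξ = -2 * ⟪ξ 0, ξ 1⟫ := by
  rw [Fin.sum_univ_three] at h
  have h2 : ξ 2 = -(ξ 0 + ξ 1) := by rw [eq_neg_iff_add_eq_zero, add_comm]; exact h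
  simp only [spatialResonance, Fin.sum_univ_three, dispersion, Matrix.cons_val, h2, norm_neg,
    norm_add_sq_real]
  ring

theorem exists_center_abs_sub_le (κ w c : ℝ) :
    ∃ c', ∀ r : ℝ, |r| ≤ κ → |r - c| ≤ w → |r - c'| ≤ min κ w := by
  rcases le_total κ w with h | h
  · exact ⟨0, fun r h1 _ => by simpa [h] using h1⟩
  · exact ⟨c, fun r _ h2 => by simpa [h] using h2⟩

theorem abs_sub_le_two_mul {a b c w : ℝ} (ha : |a - c| ≤ w) (hb : |b - c| ≤ w) :
    |b - a| ≤ 2 * w := by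
  rw [abs_le] at *
  constructor <;> linarith [ha.1, ha.2, hb.1, hb.2]

theorem norm_inv_smul_self {x : EuclideanSpace ℝ (Fin d)} (hx : 0 < ‖x‖) : ‖‖x‖⁻¹ • x‖ = 1 := by
  rw [norm_smul, norm_inv, norm_norm, inv_mul_cancel₀ hx.ne']

theorem inner_inv_smul_self {x : EuclideanSpace ℝ (Fin d)} (hx : 0 < ‖x‖) :
    ⟪x, ‖x‖⁻¹ • x⟫ = ‖x‖ := by
  rw [inner_smul_right, real_inner_self_eq_norm_sq, sq, inv_mul_cancel_left₀ hx.ne']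

theorem abs_le_of_slice_of_ball {S : Set (EuclideanSpace ℝ (Fin d))}
    {q a x : EuclideanSpace ℝ (Fin d)} {ρ s : ℝ} (ha : ‖a‖ = 1) (hS : S ⊆ closedBall q ρ)
    (hx : x ∈ S) (hxs : x + s • a ∈ S) : |s| ≤ 2 * ρ := by
  have h1 := mem_closedBall_iff_norm.1 (hS hx)
  have h2 := mem_closedBall_iff_norm.1 (hS hxs)
  calc |s| = ‖s • a‖ := by rw [norm_smul, ha, mul_one, Real.norm_eq_abs]
    _ = ‖(x + s • a - q) - (x - q)‖ := by congr 1; abel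
    _ ≤ ‖x + s • a - q‖ + ‖x - q‖ := norm_sub_le _ _
    _ ≤ 2 * ρ := by linarith

/-- When `ξ_k` is fixed and the resonance is an affine function of `ξ_i` with slope `± 2 ξ_k`, the
possible values of `ξ_i` fill a slab orthogonal to `ξ_k`. -/
theorem sqBound_of_slab (hd : 1 ≤ d) {P : Set (Fin 3 → EuclideanSpace ℝ (Fin d))}
    (hP : MeasurableSet P) {W : Fin 3 → ℝ} (hW : ∀ j, 0 < W j) {k i l : Fin 3} (hki : k ≠ i)
    (hkl : k ≠ l) (hil : i ≠ l) {ρ σ κ α η : ℝ} (hη : |η| = 2) (hρ : 0 < ρ) (hσ : 0 < σ)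
    (hκ : 0 < κ)
    (h : ∀ ξ ∈ P, ∑ j, ξ j = 0 → ‖ξ i‖ ≤ ρ ∧ σ ≤ ‖ξ k‖ ∧ |spatialResonance ξ| ≤ κ ∧
      spatialResonance ξ = α * ‖ξ k‖ ^ 2 + η * ⟪ξ k, ξ i⟫) :
    SqBound (modSet P W) (ENNReal.ofReal (2 ^ (d + 2) * unitVol d * min (W i) (W l) *
      min (2 * ρ) (min κ (W i + W l) / σ) * ρ ^ (d - 1))) := by
  have hmin : 0 < min (W i) (W l) := lt_min (hW _) (hW _)
  have hω : 0 < min κ (W i + W l) := lt_min hκ (add_pos (hW _) (hW _))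
  have hu := unitVol_nonneg d
  refine (SqBound.modSet_of_fiber hP hki hkl hil (V := ENNReal.ofReal (2 ^ (d + 1) * unitVol d *
    min (2 * ρ) (min κ (W i + W l) / σ) * ρ ^ (d - 1))) fun w c => ?_).mono
    (fun z hz _ => hz) (le_of_eq ?_)
  · by_cases hw : σ ≤ ‖w‖
    · obtain ⟨c', hc'⟩ := exists_center_abs_sub_le κ (W i + W l) c
      have hw0 : 0 < ‖w‖ := hσ.trans_le hw
      set S : Set (EuclideanSpace ℝ (Fin d)) :=
        closedBall 0 ρ ∩ {x | |α * ‖w‖ ^ 2 + η * ⟪w, x⟫ - c'| ≤ min κ (W i + W l)} with hS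
      have hSm : MeasurableSet S := by
        refine measurableSet_closedBall.inter (measurableSet_le (Continuous.measurable ?_)
          measurable_const)
        fun_prop
      refine (measure_mono (t := S) ?_).trans (volume_le_of_slices_ball hd hSm
        (norm_inv_smul_self hw0) (lt_min (by positivity) (by positivity)) hρ
        Set.inter_subset_left fun x hx s hxs => le_min
          (abs_le_of_slice_of_ball (norm_inv_smul_self hw0) Set.inter_subset_left hx hxs) ?_)
      · rintro x ⟨ξ, hξ, h0, rfl, rfl, hc⟩
        obtain ⟨h1, h2, h3, h4⟩ := h ξ hξ h0
        refine ⟨mem_closedBall_zero_iff.2 h1, ?_⟩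
        have := hc' _ h3 hc
        rwa [h4] at this
      · have h1 := abs_sub_le_two_mul hx.2 hxs.2
        have h2 : α * ‖w‖ ^ 2 + η * ⟪w, x + s • ‖w‖⁻¹ • w⟫ - (α * ‖w‖ ^ 2 + η * ⟪w, x⟫)
            = η * s * ‖w‖ := by
          rw [inner_add_right, inner_smul_right, inner_inv_smul_self hw0]; ring
        rw [h2, abs_mul, abs_mul, hη, abs_of_pos hw0] at h1
        rw [le_div_iff₀ hσ]
        nlinarith [abs_nonneg s]
    · refine (measure_mono_null ?_ measure_empty).le.trans (zero_le)
      rintro x ⟨ξ, hξ, h0, rfl, -⟩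
      exact absurd (h ξ hξ h0).2.1 hw
  · rw [← ENNReal.ofReal_mul (by positivity)]
    congr 1
    ring

/-- The spatial frequencies of a dyadic block: the resonance is at most `κ`, and `|ξ_j| ∼ N_j` with
the constant `B`. -/
def region (B κ : ℝ) (N : Fin 3 → ℝ) : Set (Fin 3 → EuclideanSpace ℝ (Fin d)) :=
  {ξ | |spatialResonance ξ| ≤ κ ∧ ∀ j, ‖ξ j‖ ≤ B * N j ∧ N j ≤ B * ‖ξ j‖}

theorem measurableSet_region (B κ : ℝ) (N : Fin 3 → ℝ) :
    MeasurableSet (region (d := d) B κ N) := by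
  have h1 : MeasurableSet {ξ : Fin 3 → EuclideanSpace ℝ (Fin d) | |spatialResonance ξ| ≤ κ} :=
    measurableSet_le continuous_spatialResonance.abs.measurable measurable_const
  have h2 : ∀ j, MeasurableSet {ξ : Fin 3 → EuclideanSpace ℝ (Fin d) |
      ‖ξ j‖ ≤ B * N j ∧ N j ≤ B * ‖ξ j‖} := fun j =>
    MeasurableSet.inter (s₁ := {ξ : Fin 3 → EuclideanSpace ℝ (Fin d) | ‖ξ j‖ ≤ B * N j})
      (s₂ := {ξ : Fin 3 → EuclideanSpace ℝ (Fin d) | N j ≤ B * ‖ξ j‖})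
      (measurableSet_le (by fun_prop) measurable_const)
      (measurableSet_le measurable_const (by fun_prop))
  exact h1.inter ((MeasurableSet.iInter h2).congr (Set.ext fun ξ => Set.mem_iInter))

/-- `{a, b} = {0, 1}`: the indices of the two waves with the same sign. In the `(+-)` interactions
`a` and `2` are the high frequency waves, and `b` is the low frequency one. -/
def IsPair (a b : Fin 3) : Prop := (a = 0 ∧ b = 1) ∨ (a = 1 ∧ b = 0)

theorem IsPair.ne {a b : Fin 3} (h : IsPair a b) : a ≠ b ∧ a ≠ 2 ∧ b ≠ 2 := by
  rcases h with ⟨rfl, rfl⟩ | ⟨rfl, rfl⟩ <;> decide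

theorem IsPair.resonance {a b : Fin 3} (h : IsPair a b)
    {ξ : Fin 3 → EuclideanSpace ℝ (Fin d)} (h0 : ∑ j, ξ j = 0) :
    spatialResonance ξ = -2 * ⟪ξ a, ξ b⟫ := by
  rw [spatialResonance_eq h0]
  rcases h with ⟨rfl, rfl⟩ | ⟨rfl, rfl⟩
  · rfl
  · rw [real_inner_comm]

theorem IsPair.sum {a b : Fin 3} (h : IsPair a b)
    {ξ : Fin 3 → EuclideanSpace ℝ (Fin d)} (h0 : ∑ j, ξ j = 0) : ξ 2 + ξ a + ξ b = 0 := by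
  rwa [sum_fin_three_of_ne h.ne.2.1.symm h.ne.2.2.symm h.ne.1] at h0

/-- A bound for the `(+-)` interaction in terms of the modulations of `b` and `2`: for fixed `ξ_a`,
the possible values of `ξ_b` lie in a slab orthogonal to `ξ_a`. -/
theorem sqBound_high (hd : 1 ≤ d) {B κ : ℝ} (hB : 1 ≤ B) (hκ : 0 < κ) {N W : Fin 3 → ℝ}
    (hN : ∀ j, 0 < N j) (hW : ∀ j, 0 < W j) {a b : Fin 3} (hab : IsPair a b) :
    SqBound (modSet (region (d := d) B κ N) W) (ENNReal.ofReal (2 ^ (d + 2) * unitVol d * B ^ d *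
      (min (W b) (W 2) * (N a)⁻¹ * N b ^ (d - 1) * min κ (W b + W 2)))) := by
  obtain ⟨h1, h2, h3⟩ := hab.ne
  have hB0 : 0 < B := by linarith
  have ha := hN a
  have hb := hN b
  have hmin : 0 < min (W b) (W 2) := lt_min (hW _) (hW _)
  have hω : 0 < min κ (W b + W 2) := lt_min hκ (add_pos (hW _) (hW _))
  have hu := unitVol_nonneg d
  refine (sqBound_of_slab (ρ := B * N b) (σ := N a / B) (κ := κ) (α := 0) (η := -2) hd
    (measurableSet_region B κ N) hW h1 h2 h3 (by norm_num) (by positivity) (by positivity) hκ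
    fun ξ hξ h0 => ⟨(hξ.2 b).1, ?_, hξ.1, ?_⟩).mono (fun z hz _ => hz)
    (ENNReal.ofReal_le_ofReal ?_)
  · rw [div_le_iff₀ hB0, mul_comm]; exact (hξ.2 a).2
  · rw [hab.resonance h0]; ring
  · calc _ ≤ 2 ^ (d + 2) * unitVol d * min (W b) (W 2) * (min κ (W b + W 2) / (N a / B)) *
          (B * N b) ^ (d - 1) := by gcongr; exact min_le_right _ _
      _ = _ := by
        obtain ⟨k, rfl⟩ := Nat.exists_eq_add_of_le' hd
        simp only [Nat.add_sub_cancel]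
        field_simp
        ring

/-- A bound for the `(++)` interaction in terms of the modulations of `b` and `2`: for fixed `ξ_a`,
the possible values of `ξ_2` lie in a slab orthogonal to `ξ_a`. -/
theorem sqBound_plusPlus_high (hd : 1 ≤ d) {B κ : ℝ} (hB : 1 ≤ B) (hκ : 0 < κ) {N W : Fin 3 → ℝ}
    (hN : ∀ j, 0 < N j) (hW : ∀ j, 0 < W j) {a b : Fin 3} (hab : IsPair a b) :
    SqBound (modSet (region (d := d) B κ N) W) (ENNReal.ofReal (2 ^ (d + 3) * unitVol d * B ^ d *
      (min (W b) (W 2) * (N a)⁻¹ * N 2 ^ (d - 1) * min (N a * N 2) (W b + W 2)))) := by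
  obtain ⟨h1, h2, h3⟩ := hab.ne
  have hB0 : 0 < B := by linarith
  have ha := hN a
  have hb := hN 2
  have hmin : 0 < min (W b) (W 2) := lt_min (hW _) (hW _)
  have hu := unitVol_nonneg d
  have hWW := add_pos (hW b) (hW 2)
  have hω : 0 < min (N a * N 2) (W b + W 2) := lt_min (by positivity) hWW
  refine (sqBound_of_slab (ρ := B * N 2) (σ := N a / B) (κ := κ) (α := 2) (η := 2) hd
    (measurableSet_region B κ N) hW h2 h1 h3.symm (by norm_num) (by positivity) (by positivity) hκ
    fun ξ hξ h0 => ⟨(hξ.2 2).1, ?_, hξ.1, ?_⟩).mono (fun z hz _ => hz)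
    (ENNReal.ofReal_le_ofReal ?_)
  · rw [div_le_iff₀ hB0, mul_comm]; exact (hξ.2 a).2
  · have h4 := hab.sum h0
    have h5 : ξ b = -(ξ a + ξ 2) := by rw [eq_neg_iff_add_eq_zero, ← h4]; abel
    rw [hab.resonance h0, h5, inner_neg_right, inner_add_right, real_inner_self_eq_norm_sq]
    ring
  · have key : min (2 * (B * N 2)) (min κ (W 2 + W b) / (N a / B)) ≤
        2 * B * ((N a)⁻¹ * min (N a * N 2) (W b + W 2)) := by
      rcases min_choice (N a * N 2) (W b + W 2) with h | h <;> rw [h]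
      · refine (min_le_left _ _).trans (le_of_eq ?_)
        field_simp
      · refine (min_le_right _ _).trans ?_
        calc min κ (W 2 + W b) / (N a / B) ≤ (W 2 + W b) / (N a / B) := by
              gcongr; exact min_le_right _ _
          _ = B * ((N a)⁻¹ * (W b + W 2)) := by field_simp; ring
          _ ≤ _ := by
            have : 0 < (N a)⁻¹ * (W b + W 2) := by positivity
            nlinarith
    calc _ ≤ 2 ^ (d + 2) * unitVol d * min (W b) (W 2) *
          (2 * B * ((N a)⁻¹ * min (N a * N 2) (W b + W 2))) * (B * N 2) ^ (d - 1) := by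
          have hWb := hW b
          have hW2 := hW 2
          rw [min_comm (W b) (W 2)]
          gcongr
      _ = _ := by
        obtain ⟨k, rfl⟩ := Nat.exists_eq_add_of_le' hd
        simp only [Nat.add_sub_cancel]
        ring

end Fiber

/-! ### Cauchy–Schwarz bounds from spherical shells -/

section Shell

open Metric

open scoped RealInnerProductSpace

variable {d : ℕ}

theorem abs_inner_le_of_norm_le {x y : EuclideanSpace ℝ (Fin d)} {r s : ℝ} (hx : ‖x‖ ≤ r)
    (hy : ‖y‖ ≤ s) : |⟪x, y⟫| ≤ r * s :=
  (abs_real_inner_le_norm x y).trans (by gcongr; exact (norm_nonneg x).trans hx)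

theorem modSet_inter (P : Set (Fin 3 → EuclideanSpace ℝ (Fin d))) (W : Fin 3 → ℝ) (a : Fin 3)
    (p : EuclideanSpace ℝ (Fin d)) (r : ℝ) :
    modSet P W ∩ {ζ | ‖(ζ a).1 - p‖ ≤ r} = modSet (P ∩ {ξ | ‖ξ a - p‖ ≤ r}) W := by
  ext ζ
  constructor
  · rintro ⟨⟨h1, h2⟩, h3⟩; exact ⟨⟨h1, h3⟩, h2⟩
  · rintro ⟨⟨h1, h3⟩, h2⟩; exact ⟨⟨h1, h2⟩, h3⟩

theorem measurableSet_local {P : Set (Fin 3 → EuclideanSpace ℝ (Fin d))} (hP : MeasurableSet P)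
    (a : Fin 3) (p : EuclideanSpace ℝ (Fin d)) (r : ℝ) :
    MeasurableSet (P ∩ {ξ | ‖ξ a - p‖ ≤ r}) :=
  hP.inter (measurableSet_le (by fun_prop) measurable_const)

/-- A bound for the `(+-)` interaction in terms of the modulations of `a` and `b`. When `ξ_2` is
fixed, the resonance is a quadratic function of `ξ_b`, and the possible values of `ξ_b` fill a
spherical shell. It is almost flat if `ξ_a` is much larger than `ξ_b`. -/
theorem sqBound_middle (hd : 2 ≤ d) {B κ : ℝ} (hB : 1 ≤ B) (hκ : 0 < κ) {N W : Fin 3 → ℝ}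
    (hN : ∀ j, 0 < N j) (hW : ∀ j, 0 < W j) {a b : Fin 3} (hab : IsPair a b)
    (h2a : N 2 ≤ B * N a) (ha2 : N a ≤ B * N 2) :
    SqBound (modSet (region (d := d) B κ N) W) (ENNReal.ofReal
      ((2 ^ (d + 2) + 2 * d) * unitVol d * (6 * B ^ 5) ^ d *
      (min (W b) (W a) * (N a)⁻¹ * N b ^ (d - 1) * min κ (W b + W a)))) := by
  obtain ⟨h1, h2, h3⟩ := hab.ne
  have hB0 : 0 < B := by linarith
  have ha := hN a
  have hb := hN b
  have h2' := hN 2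
  have hWa := hW a
  have hWb := hW b
  have hmin : 0 < min (W b) (W a) := lt_min (hW _) (hW _)
  have hω : 0 < min κ (W b + W a) := lt_min hκ (add_pos (hW _) (hW _))
  have hu := unitVol_pos d
  set ω := min κ (W b + W a)
  set Q := (N a)⁻¹ * N b ^ (d - 1) * ω with hQ
  have hQ0 : 0 < Q := by positivity
  refine (SqBound.modSet_of_fiber (measurableSet_region B κ N) h3.symm h2.symm h1.symm
    (V := ENNReal.ofReal ((2 ^ (d + 1) + d) * unitVol d * (6 * B ^ 5) ^ d * Q))
    fun w c => ?_).mono (fun z hz _ => hz) (le_of_eq ?_)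
  · by_cases hw : N 2 ≤ B * ‖w‖ ∧ ‖w‖ ≤ B * N 2
    · obtain ⟨c', hc'⟩ := exists_center_abs_sub_le κ (W b + W a) c
      have hw0 : 0 < ‖w‖ := pos_of_mul_pos_right (h2'.trans_le hw.1) hB0.le
      set S : Set (EuclideanSpace ℝ (Fin d)) :=
        closedBall 0 (B * N b) ∩ {x | |2 * ⟪w + x, x⟫ - c'| ≤ ω} with hS
      have hSm : MeasurableSet S := by
        refine measurableSet_closedBall.inter (measurableSet_le (Continuous.measurable ?_)
          measurable_const)
        fun_prop
      have hsub : {x | ∃ ξ ∈ region B κ N, ∑ j, ξ j = 0 ∧ ξ 2 = w ∧ ξ b = x ∧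
          |spatialResonance ξ - c| ≤ W b + W a} ⊆ S := by
        rintro x ⟨ξ, hξ, h0, rfl, rfl, hc⟩
        refine ⟨mem_closedBall_zero_iff.2 (hξ.2 b).1, ?_⟩
        have := hc' _ hξ.1 hc
        have h5 : ξ a = -(ξ 2 + ξ b) := by rw [eq_neg_iff_add_eq_zero, ← hab.sum h0]; abel
        rw [hab.resonance h0, h5, inner_neg_left] at this
        show |2 * ⟪ξ 2 + ξ b, ξ b⟫ - c'| ≤ ω
        convert this using 2
        ring
      refine (measure_mono hsub).trans ?_
      rcases le_total (4 * B ^ 3 * N b) (N a) with hcase | hcase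
      · -- a flat piece of a large sphere
        refine (volume_le_of_slices_ball (t := 2 * B ^ 2 * ω * (N a)⁻¹) (by omega) hSm
          (norm_inv_smul_self hw0) (by positivity) (by positivity) Set.inter_subset_left
          fun x hx s hxs => ?_).trans (ENNReal.ofReal_le_ofReal ?_)
        · set e := ‖w‖⁻¹ • w with he
          have hen : ‖e‖ = 1 := norm_inv_smul_self hw0
          have e1 := abs_sub_le_two_mul hx.2 hxs.2
          have e2 : 2 * ⟪w + (x + s • e), x + s • e⟫ - 2 * ⟪w + x, x⟫ =
              2 * s * (‖w‖ + ⟪x, e⟫ + ⟪x + s • e, e⟫) := by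
            have hwe : ⟪w, e⟫ = ‖w‖ := inner_inv_smul_self hw0
            simp only [inner_add_left, inner_add_right, inner_smul_left, inner_smul_right, hwe,
              real_inner_comm x e]
            simp
            ring
          rw [e2, abs_mul, abs_mul, abs_two] at e1
          have e3 := (abs_le.1 (abs_inner_le_of_norm_le (mem_closedBall_zero_iff.1 hx.1) hen.le)).1
          have e4 := (abs_le.1 (abs_inner_le_of_norm_le (mem_closedBall_zero_iff.1 hxs.1) hen.le)).1
          have e5 : N a ≤ B ^ 2 * ‖w‖ := by nlinarith [hw.1]
          have e6 : N a / (2 * B ^ 2) ≤ ‖w‖ + ⟪x, e⟫ + ⟪x + s • e, e⟫ := by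
            have : 2 * (B * N b) ≤ N a / (2 * B ^ 2) := by
              rw [le_div_iff₀ (by positivity)]; linarith
            have : N a / (B ^ 2) ≤ ‖w‖ := by
              rw [div_le_iff₀ (by positivity)]; linarith
            have h8 : N a / (B ^ 2) = 2 * (N a / (2 * B ^ 2)) := by field_simp
            linarith
          have e7 : 2 * |s| * (N a / (2 * B ^ 2)) ≤ 2 * ω :=
            (mul_le_mul_of_nonneg_left (e6.trans (le_abs_self _)) (by positivity)).trans e1
          rw [← div_eq_mul_inv, le_div_iff₀ ha]
          calc |s| * N a = B ^ 2 * (2 * |s| * (N a / (2 * B ^ 2))) := by field_simp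
            _ ≤ B ^ 2 * (2 * ω) := by gcongr
            _ = _ := by ring
        · obtain ⟨k, rfl⟩ := Nat.exists_eq_add_of_le' hd
          have hk : k + 2 - 1 = k + 1 := by omega
          simp only [hk] at hQ ⊢
          calc 2 ^ (k + 2 + 1) * unitVol (k + 2) * (2 * B ^ 2 * ω * (N a)⁻¹) * (B * N b) ^ (k + 1)
              = 2 ^ (k + 2 + 1) * unitVol (k + 2) * (2 * B ^ (k + 3)) * Q := by
                rw [hQ, mul_pow]; ring
            _ ≤ (2 ^ (k + 2 + 1) + (k + 2 : ℕ)) * unitVol (k + 2) * (6 * B ^ 5) ^ (k + 2) * Q := by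
                have : 2 * B ^ (k + 3) ≤ (6 * B ^ 5) ^ (k + 2) := by
                  rw [mul_pow, ← pow_mul]
                  have g1 : (2 : ℝ) ≤ 6 ^ (k + 2) := by
                    calc (2 : ℝ) ≤ 6 ^ 1 := by norm_num
                      _ ≤ _ := pow_le_pow_right₀ (by norm_num) (by omega)
                  have g2 : B ^ (k + 3) ≤ B ^ (5 * (k + 2)) := pow_le_pow_right₀ hB (by omega)
                  gcongr
                have g3 : (0 : ℝ) ≤ (k + 2 : ℕ) := by positivity
                gcongr
                linarith
      · -- a shell of arbitrary curvature
        have hR : ∀ x ∈ S, ‖x - (-(1 / 2 : ℝ) • w)‖ ≤ 6 * B ^ 5 * N b := by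
          intro x hx
          have g1 := mem_closedBall_zero_iff.1 hx.1
          have g2 : ‖x - (-(1 / 2 : ℝ) • w)‖ ≤ ‖x‖ + 1 / 2 * ‖w‖ := by
            refine (norm_sub_le _ _).trans_eq ?_
            rw [norm_smul]; norm_num
          have g3 : ‖w‖ ≤ B ^ 2 * N a := hw.2.trans (by nlinarith)
          have g4 : B * N b ≤ B ^ 5 * N b := by gcongr; exact le_self_pow₀ hB (by norm_num)
          have g5 : B ^ 2 * N a ≤ 4 * B ^ 5 * N b := by
            calc B ^ 2 * N a ≤ B ^ 2 * (4 * B ^ 3 * N b) := by gcongr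
              _ = _ := by ring
          have g6 : 0 < B ^ 5 * N b := by positivity
          nlinarith
        refine (volume_shell_le (c := -(1 / 2 : ℝ) • w) (m := (c' + ‖w‖ ^ 2 / 2) / 2) (w := ω / 2)
          hd (by positivity) hR fun x hx => ?_).trans (ENNReal.ofReal_le_ofReal ?_)
        · have g1 : ‖x - (-(1 / 2 : ℝ) • w)‖ ^ 2 = ⟪w + x, x⟫ + ‖w‖ ^ 2 / 4 := by
            rw [norm_sub_sq_real, norm_smul, inner_smul_right, inner_add_left,
              real_inner_self_eq_norm_sq, real_inner_comm]
            norm_num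
            ring
          have g2 : |2 * ⟪w + x, x⟫ - c'| ≤ ω := hx.2
          rw [g1]
          rw [abs_le] at *
          constructor <;> linarith [g2.1, g2.2]
        · obtain ⟨k, rfl⟩ := Nat.exists_eq_add_of_le' hd
          have hk : k + 2 - 1 = k + 1 := by omega
          simp only [hk, Nat.add_sub_cancel] at hQ ⊢
          have g1 : N b ^ k * ω ≤ 4 * B ^ 3 * Q := by
            calc N b ^ k * ω = N a * ((N a)⁻¹ * N b ^ k * ω) := by field_simp
              _ ≤ (4 * B ^ 3 * N b) * ((N a)⁻¹ * N b ^ k * ω) := by gcongr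
              _ = _ := by rw [hQ]; ring
          calc 2 * ((k + 2 : ℕ) : ℝ) * unitVol (k + 2) * (ω / 2) * (6 * B ^ 5 * N b) ^ k
              = (k + 2 : ℕ) * unitVol (k + 2) * (6 * B ^ 5) ^ k * (N b ^ k * ω) := by
                rw [mul_pow (6 * B ^ 5)]; ring
            _ ≤ (k + 2 : ℕ) * unitVol (k + 2) * (6 * B ^ 5) ^ k * (4 * B ^ 3 * Q) := by gcongr
            _ = (k + 2 : ℕ) * unitVol (k + 2) * ((6 * B ^ 5) ^ k * (4 * B ^ 3)) * Q := by ring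
            _ ≤ (2 ^ (k + 2 + 1) + (k + 2 : ℕ)) * unitVol (k + 2) * (6 * B ^ 5) ^ (k + 2) * Q := by
                have g2 : 4 * B ^ 3 ≤ (6 * B ^ 5) ^ 2 := by
                  have : B ^ 3 ≤ B ^ 10 := pow_le_pow_right₀ hB (by norm_num)
                  nlinarith [pow_pos hB0 10]
                have g3 : (6 * B ^ 5) ^ k * (4 * B ^ 3) ≤ (6 * B ^ 5) ^ (k + 2) := by
                  rw [pow_add]; gcongr
                gcongr
                have : (0 : ℝ) ≤ 2 ^ (k + 2 + 1) := by positivity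
                linarith
    · refine (measure_mono_null ?_ measure_empty).le.trans (zero_le)
      rintro x ⟨ξ, hξ, h0, rfl, -⟩
      exact absurd ⟨(hξ.2 2).2, (hξ.2 2).1⟩ hw
  · rw [← ENNReal.ofReal_mul (by positivity)]
    congr 1
    rw [hQ]
    ring

/-- A bound for the `(++)` interaction in terms of the modulations of the two high frequency waves,
which are first localised to balls of radius `N_2`: the resonance is a quadratic function of `ξ_a`
whose gradient then has a nearly constant direction. -/
theorem sqBound_plusPlus_low (hd : 1 ≤ d) {B κ : ℝ} (hB : 1 ≤ B) {N W : Fin 3 → ℝ}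
    (hN : ∀ j, 0 < N j) (hW : ∀ j, 0 < W j) {a b : Fin 3} (hab : IsPair a b)
    (h2a : 5 * B ^ 2 * N 2 ≤ N a) :
    SqBound (modSet (region (d := d) B κ N) W) (ENNReal.ofReal
      ((1 + B) ^ d * (2 ^ (d + 3) * unitVol d * B *
      (min (W a) (W b) * (N a)⁻¹ * N 2 ^ (d - 1) * min (N a * N 2) (W a + W b))))) := by
  obtain ⟨h1, h2, h3⟩ := hab.ne
  have hB0 : 0 < B := by linarith
  have ha := hN a
  have h2' := hN 2
  have hWa := hW a
  have hWb := hW b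
  have hmin : 0 < min (W a) (W b) := lt_min (hW _) (hW _)
  have hu := unitVol_pos d
  have hω : 0 < W a + W b := by positivity
  have hloc := SqBound.of_local (d := d) (r := N 2) (R := B * N 2)
    (M := ENNReal.ofReal (2 ^ (d + 3) * unitVol d * B *
      (min (W a) (W b) * (N a)⁻¹ * N 2 ^ (d - 1) * min (N a * N 2) (W a + W b))))
    (measurableSet_modSet (measurableSet_region (d := d) B κ N) W) h1 h2' (by positivity)
    ?_ fun p => ?_
  · refine hloc.mono (fun z hz _ => hz) (le_of_eq ?_)
    rw [← ENNReal.ofReal_mul (by positivity)]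
    congr 3
    field_simp
  · intro ζ hζ h0
    have h4 := hab.sum (ξ := fun j => (ζ j).1) (by
      have := congrArg Prod.fst h0
      rwa [Prod.fst_sum] at this)
    have h5 : (ζ a).1 + (ζ b).1 = -(ζ 2).1 := by
      rw [eq_neg_iff_add_eq_zero, ← h4]; abel
    rw [h5, norm_neg]
    exact (hζ.1.2 2).1
  · rw [modSet_inter]
    refine (SqBound.modSet_of_fiber (measurableSet_local (measurableSet_region B κ N) a p (N 2))
      h2.symm h3.symm h1 (V := ENNReal.ofReal (2 ^ (d + 1) * unitVol d *
      (2 * B * (N a)⁻¹ * min (N a * N 2) (W a + W b)) * N 2 ^ (d - 1)))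
      fun w c => ?_).mono (fun z hz _ => hz) (le_of_eq ?_)
    · by_cases hw : ‖w‖ ≤ B * N 2
      · set S : Set (EuclideanSpace ℝ (Fin d)) := closedBall p (N 2) ∩
          ({x | N a ≤ B * ‖x‖} ∩ {x | |2 * ⟪x, x + w⟫ - c| ≤ W a + W b}) with hS
        have hSm : MeasurableSet S := by
          refine measurableSet_closedBall.inter ((measurableSet_le measurable_const ?_).inter
            (measurableSet_le (Continuous.measurable ?_) measurable_const)) <;> fun_prop
        have hsub : {x | ∃ ξ ∈ region B κ N ∩ {ξ | ‖ξ a - p‖ ≤ N 2}, ∑ j, ξ j = 0 ∧ ξ 2 = w ∧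
            ξ a = x ∧ |spatialResonance ξ - c| ≤ W a + W b} ⊆ S := by
          rintro x ⟨ξ, ⟨hξ, hξp⟩, h0, rfl, rfl, hc⟩
          refine ⟨mem_closedBall_iff_norm.2 hξp, (hξ.2 a).2, ?_⟩
          have h5 : ξ b = -(ξ a + ξ 2) := by rw [eq_neg_iff_add_eq_zero, ← hab.sum h0]; abel
          rw [hab.resonance h0, h5, inner_neg_right] at hc
          show |2 * ⟪ξ a, ξ a + ξ 2⟫ - c| ≤ W a + W b
          convert hc using 2
          ring
        refine (measure_mono hsub).trans ?_
        rcases S.eq_empty_or_nonempty with hSe | ⟨x₀, hx₀⟩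
        · simp [hSe]
        have hx₀' : N a ≤ B * ‖x₀‖ := hx₀.2.1
        have hx₀0 : 0 < ‖x₀‖ := pos_of_mul_pos_right (ha.trans_le hx₀') hB0.le
        set e := ‖x₀‖⁻¹ • x₀ with he
        have hen : ‖e‖ = 1 := norm_inv_smul_self hx₀0
        refine volume_le_of_slices_ball hd hSm hen (by positivity) h2' Set.inter_subset_left
          fun x hx s hxs => ?_
        have hlow : ∀ y ∈ S, ‖x₀‖ - 2 * N 2 ≤ ⟪y, e⟫ := by
          intro y hy
          have g1 : ‖y - x₀‖ ≤ 2 * N 2 := by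
            have g2 := mem_closedBall_iff_norm.1 hy.1
            have g3 := mem_closedBall_iff_norm.1 hx₀.1
            calc ‖y - x₀‖ = ‖(y - p) - (x₀ - p)‖ := by congr 1; abel
              _ ≤ ‖y - p‖ + ‖x₀ - p‖ := norm_sub_le _ _
              _ ≤ _ := by linarith
          have g2 := (abs_le.1 (abs_inner_le_of_norm_le g1 hen.le)).1
          rw [inner_sub_left, inner_inv_smul_self hx₀0] at g2
          linarith
        have g1 := abs_sub_le_two_mul hx.2.2 hxs.2.2
        have g2 : 2 * ⟪x + s • e, x + s • e + w⟫ - 2 * ⟪x, x + w⟫ =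
            2 * s * (⟪x, e⟫ + ⟪x + s • e, e⟫ + ⟪w, e⟫) := by
          simp only [inner_add_left, inner_add_right, inner_smul_left, inner_smul_right,
            real_inner_comm x e, real_inner_comm w e]
          simp
          ring
        rw [g2, abs_mul, abs_mul, abs_two] at g1
        have g3 := (abs_le.1 (abs_inner_le_of_norm_le hw hen.le)).1
        have g4 : N a / B ≤ ⟪x, e⟫ + ⟪x + s • e, e⟫ + ⟪w, e⟫ := by
          have g5 := hlow x hx
          have g6 := hlow _ hxs
          have g7 : 5 * B * N 2 ≤ N a / B := by
            rw [le_div_iff₀ hB0]; linarith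
          have g8 : N a / B ≤ ‖x₀‖ := by rw [div_le_iff₀ hB0]; linarith
          have g9 : N 2 ≤ B * N 2 := le_mul_of_one_le_left h2'.le hB
          linarith
        have g5 : 2 * |s| * (N a / B) ≤ 2 * (W a + W b) :=
          (mul_le_mul_of_nonneg_left (g4.trans (le_abs_self _)) (by positivity)).trans g1
        have g6 : |s| ≤ 2 * N 2 := abs_le_of_slice_of_ball hen Set.inter_subset_left hx hxs
        rcases min_choice (N a * N 2) (W a + W b) with hm | hm <;> rw [hm]
        · calc |s| ≤ 2 * N 2 := g6
            _ ≤ 2 * B * N 2 := by nlinarith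
            _ = _ := by field_simp
        · calc |s| = B * (N a)⁻¹ * (|s| * (N a / B)) := by field_simp
            _ ≤ B * (N a)⁻¹ * (2 * (W a + W b)) := by
              have : |s| * (N a / B) ≤ 2 * (W a + W b) := by
                have : 0 ≤ |s| * (N a / B) := by positivity
                linarith
              gcongr
            _ = _ := by ring
      · refine (measure_mono_null ?_ measure_empty).le.trans (zero_le)
        rintro x ⟨ξ, hξ, h0, rfl, -⟩
        exact absurd (hξ.1.2 2).1 hw
    · rw [← ENNReal.ofReal_mul (by positivity)]
      congr 1
      ring

end Shell

/-! ### The fourfold Cauchy–Schwarz inequality with a common high frequency -/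

section Fourfold

open Metric

open scoped RealInnerProductSpace

variable {d : ℕ}

/-- The unit vector `a` in the direction of the component of `x₀` orthogonal to `e`; the length of
that component is `ρ`. -/
theorem exists_orthogonal_direction {e x₀ : EuclideanSpace ℝ (Fin d)} (he : ‖e‖ = 1)
    (h : |⟪e, x₀⟫| < ‖x₀‖) : ∃ (a : EuclideanSpace ℝ (Fin d)) (ρ : ℝ), ‖a‖ = 1 ∧ ⟪e, a⟫ = 0 ∧
      ‖x₀‖ - |⟪e, x₀⟫| ≤ ρ ∧ 0 < ρ ∧ ⟪x₀, a⟫ = ρ ∧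
      ∀ y, ρ * ⟪y, a⟫ = ⟪x₀, y⟫ - ⟪e, x₀⟫ * ⟪e, y⟫ := by
  set y₀ := x₀ - ⟪e, x₀⟫ • e with hy₀
  have h1 : ‖x₀‖ - |⟪e, x₀⟫| ≤ ‖y₀‖ := by
    have := norm_sub_norm_le x₀ (⟪e, x₀⟫ • e)
    rwa [norm_smul, he, mul_one, Real.norm_eq_abs] at this
  have h2 : 0 < ‖y₀‖ := by linarith
  have hey : ⟪e, y₀⟫ = 0 := by
    rw [hy₀, inner_sub_right, inner_smul_right, real_inner_self_eq_norm_sq, he]; ring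
  refine ⟨‖y₀‖⁻¹ • y₀, ‖y₀‖, norm_inv_smul_self h2, ?_, h1, h2, ?_, fun y => ?_⟩
  · rw [inner_smul_right, hey, mul_zero]
  · have h3 : x₀ = y₀ + ⟪e, x₀⟫ • e := by rw [hy₀]; abel
    conv_lhs => rw [h3]
    rw [inner_add_left, inner_inv_smul_self h2, inner_smul_left, inner_smul_right, hey]
    simp
  · rw [inner_smul_right, mul_inv_cancel_left₀ h2.ne', hy₀, inner_sub_right, inner_smul_right,
      real_inner_comm y x₀, real_inner_comm y e]

theorem norm_mul_inner_inv_smul {u : EuclideanSpace ℝ (Fin d)} (hu : 0 < ‖u‖)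
    (y : EuclideanSpace ℝ (Fin d)) : ‖u‖ * ⟪‖u‖⁻¹ • u, y⟫ = ⟪u, y⟫ := by
  rw [real_inner_smul_left, mul_inv_cancel_left₀ hu.ne']

theorem abs_inner_inv_smul_le {u y : EuclideanSpace ℝ (Fin d)} {σ θ : ℝ} (hσ : 0 < σ)
    (hu : σ ≤ ‖u‖) (h : |⟪u, y⟫| ≤ θ) : |⟪‖u‖⁻¹ • u, y⟫| ≤ θ / σ := by
  have hu0 := hσ.trans_le hu
  rw [← norm_mul_inner_inv_smul hu0, abs_mul, abs_of_pos hu0] at h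
  rw [le_div_iff₀ hσ]
  nlinarith [abs_nonneg ⟪‖u‖⁻¹ • u, y⟫]

theorem norm_sub_le_of_closedBall {x y p : EuclideanSpace ℝ (Fin d)} {r : ℝ}
    (hx : x ∈ closedBall p r) (hy : y ∈ closedBall p r) : ‖x - y‖ ≤ 2 * r := by
  rw [mem_closedBall_iff_norm] at hx hy
  calc ‖x - y‖ = ‖(x - p) - (y - p)‖ := by congr 1; abel
    _ ≤ ‖x - p‖ + ‖y - p‖ := norm_sub_le _ _
    _ ≤ _ := by linarith

theorem inner_quadratic_sub (x v a : EuclideanSpace ℝ (Fin d)) (s : ℝ) :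
    2 * ⟪x + s • a, x + s • a + v⟫ - 2 * ⟪x, x + v⟫ =
      2 * s * (⟪x, a⟫ + ⟪x + s • a + v, a⟫) := by
  simp only [inner_add_left, inner_add_right, inner_smul_left, inner_smul_right,
    real_inner_comm x a, real_inner_comm v a]
  simp
  ring

theorem abs_le_of_mul_le {s g μ ω : ℝ} (hμ : 0 < μ) (hg : μ ≤ g) (h : |2 * s * g| ≤ 2 * ω) :
    |s| ≤ ω / μ := by
  rw [abs_mul, abs_mul, abs_two, abs_of_pos (hμ.trans_le hg)] at h
  rw [le_div_iff₀ hμ]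
  nlinarith [abs_nonneg s]

/-- For two frequency triples with a common `ξ_a = x` and given `ξ_b = u`, `ξ_2' = v`, the points
`x` lie in the slab `|x · u| ≲ κ` and, along it, in a shell. Its normal `2 x + v = x + (x + v)` has
a large component along `x`, because `ξ_b' = -(x + v)` is nearly orthogonal to `x`. The scale `δ` is
so small that the inner products involved vary little on a ball of radius `δ`. -/
theorem volume_high_le (hd : 2 ≤ d) {B : ℝ} (hB : 1 ≤ B) : ∃ C : ℝ, 0 < C ∧
    ∀ {κ M n w c δ : ℝ} {u v : EuclideanSpace ℝ (Fin d)}, 0 < κ → 0 < M → 0 < n → 0 < w →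
      n ≤ B * M → n = 20 * B ^ 6 * δ → κ ≤ δ * n → n / B ≤ ‖u‖ →
      volume {x : EuclideanSpace ℝ (Fin d) | ‖x + v‖ ≤ B * n ∧ M / B ≤ ‖x‖ ∧ |2 * ⟪u, x⟫| ≤ κ ∧
        |2 * ⟪x, x + v⟫| ≤ κ ∧ |-(2 * ⟪u, x⟫) - 2 * ⟪x, x + v⟫ - c| ≤ w} ≤
        ENNReal.ofReal (C * (M⁻¹ * n ^ (d - 1) * (κ / n ^ 2) * min κ w)) := by
  have hB0 : 0 < B := by linarith
  obtain ⟨m, hm⟩ := exists_volume_le_of_cover d B (c := 1 / (20 * B ^ 6)) (by positivity)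
  have hu0 := unitVol_pos d
  refine ⟨(m + 1) * (4 ^ (d + 1) * unitVol d * B ^ 2 * (1 / (20 * B ^ 6)) ^ (d - 2)), by positivity,
    fun {κ M n w c δ u v} hκ hM hn hw hnM hδ hκδ hu => ?_⟩
  have hδ0 : 0 < δ := pos_of_mul_pos_right (hδ ▸ hn) (by positivity)
  have hδn : 1 / (20 * B ^ 6) * n = δ := by rw [hδ]; field_simp
  have hω : 0 < min κ w := lt_min hκ hw
  have hσ : 0 < n / B := by positivity
  have hu' : 0 < ‖u‖ := hσ.trans_le hu
  have hB1 : B ≤ B ^ 4 := le_self_pow₀ hB (by norm_num)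
  have hB2 : 1 ≤ B ^ 4 := one_le_pow₀ hB
  -- `δ` is a small multiple of `M`
  have hδM : 20 * B ^ 5 * δ ≤ M := by
    have : B * (20 * B ^ 5 * δ) ≤ B * M := by
      calc B * (20 * B ^ 5 * δ) = n := by rw [hδ]; ring
        _ ≤ _ := hnM
    exact le_of_mul_le_mul_left this hB0
  have hδMB : 20 * B ^ 4 * δ ≤ M / B := by
    rw [le_div_iff₀ hB0]; calc _ = 20 * B ^ 5 * δ := by ring
      _ ≤ M := hδM
  set e := ‖u‖⁻¹ • u with he
  have hen : ‖e‖ = 1 := norm_inv_smul_self hu'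
  set S := {x : EuclideanSpace ℝ (Fin d) | ‖x + v‖ ≤ B * n ∧ M / B ≤ ‖x‖ ∧ |2 * ⟪u, x⟫| ≤ κ ∧
        |2 * ⟪x, x + v⟫| ≤ κ ∧ |-(2 * ⟪u, x⟫) - 2 * ⟪x, x + v⟫ - c| ≤ w} with hS
  have hSm : MeasurableSet S := by
    have m1 : IsClosed {x : EuclideanSpace ℝ (Fin d) | ‖x + v‖ ≤ B * n} :=
      isClosed_le (by fun_prop) continuous_const
    have m2 : IsClosed {x : EuclideanSpace ℝ (Fin d) | M / B ≤ ‖x‖} :=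
      isClosed_le continuous_const (by fun_prop)
    have m3 : IsClosed {x : EuclideanSpace ℝ (Fin d) | |2 * ⟪u, x⟫| ≤ κ} :=
      isClosed_le (by fun_prop) continuous_const
    have m4 : IsClosed {x : EuclideanSpace ℝ (Fin d) | |2 * ⟪x, x + v⟫| ≤ κ} :=
      isClosed_le (by fun_prop) continuous_const
    have m5 : IsClosed {x : EuclideanSpace ℝ (Fin d) |
        |-(2 * ⟪u, x⟫) - 2 * ⟪x, x + v⟫ - c| ≤ w} :=
      isClosed_le (by fun_prop) continuous_const
    exact (m1.inter (m2.inter (m3.inter (m4.inter m5)))).measurableSet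
  have hslab : ∀ x ∈ S, |⟪e, x⟫| ≤ B * κ / (2 * n) := by
    intro x hx
    have h1 : |⟪u, x⟫| ≤ κ / 2 := by
      have := hx.2.2.1
      rw [abs_mul, abs_two] at this
      linarith
    refine (abs_inner_inv_smul_le hσ hu h1).trans_eq ?_
    field_simp
  have hslabδ : B * κ / (2 * n) ≤ B * δ / 2 := by
    rw [div_le_div_iff₀ (by positivity) (by norm_num)]
    nlinarith
  have hlocal : ∀ p, volume (S ∩ closedBall p (1 / (20 * B ^ 6) * n)) ≤
      ENNReal.ofReal (4 ^ (d + 1) * unitVol d * (min κ w / (M / (2 * B))) * (B * κ / (2 * n)) *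
        δ ^ (d - 2)) := by
    intro p
    rw [hδn]
    rcases (S ∩ closedBall p δ).eq_empty_or_nonempty with hemp | ⟨x₀, hx₀, hx₀p⟩
    · simp [hemp]
    have hx₀M := hx₀.2.1
    have hs₀ := (hslab x₀ hx₀).trans hslabδ
    obtain ⟨a, ρ, ha, hea, hρ, hρ0, hx₀a, hproj⟩ := exists_orthogonal_direction hen
      (x₀ := x₀) (lt_of_le_of_lt hs₀ (by nlinarith))
    have hρM : M / B - B * δ / 2 ≤ ρ := by linarith
    have hρM' : M / (2 * B) ≤ ρ := by
      have : M / B = 2 * (M / (2 * B)) := by field_simp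
      nlinarith
    refine volume_le_of_slices_slab hd (hSm.inter measurableSet_closedBall) ha hen hea (c := 0)
      (by positivity) (by positivity) hδ0 Set.inter_subset_right
      (fun x hx => by rw [sub_zero]; exact hslab x hx.1) fun x hx s hxs => ?_
    set x' := x + s • a with hx'
    -- the normal of the shell has a large component along `a`
    have g1 : ρ - 2 * δ ≤ ⟪x, a⟫ := by
      have h1 := (abs_le.1 (abs_inner_le_of_norm_le (norm_sub_le_of_closedBall hx.2 hx₀p) ha.le)).1
      rw [inner_sub_left, hx₀a] at h1
      linarith
    have g2 : -(6 * B ^ 4 * δ) ≤ ⟪x' + v, a⟫ := by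
      have h1 := hproj (x' + v)
      have h2 : ⟪x₀, x' + v⟫ = ⟪x', x' + v⟫ + ⟪x₀ - x', x' + v⟫ := by
        rw [inner_sub_left]; ring
      have h3 := (abs_le.1 hxs.1.2.2.2.1).1
      have h4 := (abs_le.1 (abs_inner_le_of_norm_le
        (norm_sub_le_of_closedBall hx₀p hxs.2) hxs.1.1)).1
      have h5 : |⟪e, x₀⟫ * ⟪e, x' + v⟫| ≤ B * δ / 2 * (1 * (B * n)) := by
        rw [abs_mul]
        gcongr
        exact abs_inner_le_of_norm_le hen.le hxs.1.1
      have h6 := (abs_le.1 h5).2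
      have h7 : -(3 * B ^ 3 * δ * M) ≤ ρ * ⟪x' + v, a⟫ := by
        have k1 : δ * n ≤ B ^ 2 * (δ * n) := le_mul_of_one_le_left (by positivity) (one_le_pow₀ hB)
        have k2 : B * (δ * n) ≤ B ^ 2 * (δ * n) := by gcongr; exact le_self_pow₀ hB (by norm_num)
        have k3 : B ^ 2 * (δ * n) ≤ B ^ 3 * δ * M := by
          calc B ^ 2 * (δ * n) ≤ B ^ 2 * (δ * (B * M)) := by gcongr
            _ = _ := by ring
        have k4 : B * δ / 2 * (1 * (B * n)) = B ^ 2 * (δ * n) / 2 := by ring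
        have k5 : 2 * δ * (B * n) = 2 * (B * (δ * n)) := by ring
        rw [h1, h2]
        linarith
      by_contra hcon
      push Not at hcon
      have k1 : ρ * ⟪x' + v, a⟫ < ρ * -(6 * B ^ 4 * δ) := mul_lt_mul_of_pos_left hcon hρ0
      have k2 : M / (2 * B) * (6 * B ^ 4 * δ) ≤ ρ * (6 * B ^ 4 * δ) := by gcongr
      have k3 : M / (2 * B) * (6 * B ^ 4 * δ) = 3 * B ^ 3 * δ * M := by field_simp; ring
      linarith
    have g3 : M / (2 * B) ≤ ⟪x, a⟫ + ⟪x' + v, a⟫ := by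
      have k1 : M / B = 2 * (M / (2 * B)) := by field_simp
      have k2 : B * δ ≤ B ^ 4 * δ := by gcongr
      have k3 : δ ≤ B ^ 4 * δ := le_mul_of_one_le_left hδ0.le hB2
      linarith
    refine abs_le_of_mul_le (by positivity) g3 ?_
    rw [← inner_quadratic_sub]
    have hux : ⟪u, x'⟫ = ⟪u, x⟫ := by
      rw [← norm_mul_inner_inv_smul hu', ← norm_mul_inner_inv_smul hu', hx', inner_add_right,
        inner_smul_right, hea]
      ring
    have k1 : |2 * ⟪x', x' + v⟫ - 2 * ⟪x, x + v⟫| ≤ 2 * κ :=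
      abs_sub_le_two_mul (c := 0) (by rw [sub_zero]; exact hx.1.2.2.2.1)
        (by rw [sub_zero]; exact hxs.1.2.2.2.1)
    have k2 : |2 * ⟪x', x' + v⟫ - 2 * ⟪x, x + v⟫| ≤ 2 * w := by
      have h1 := abs_sub_le_two_mul hxs.1.2.2.2.2 hx.1.2.2.2.2
      rw [hux] at h1
      convert h1 using 2
      ring
    rcases min_choice κ w with h | h <;> rw [h]
    exacts [k1, k2]
  refine (hm n (-v) S _ hn (fun x hx => mem_closedBall_iff_norm.2 (by
    rw [sub_neg_eq_add]; exact hx.1)) hlocal).trans ?_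
  rw [← ENNReal.ofReal_natCast, ← ENNReal.ofReal_mul (by positivity)]
  refine ENNReal.ofReal_le_ofReal ?_
  obtain ⟨k, rfl⟩ := Nat.exists_eq_add_of_le' hd
  have hk : k + 2 - 1 = k + 1 := by omega
  simp only [hk, Nat.add_sub_cancel]
  calc (m : ℝ) * (4 ^ (k + 2 + 1) * unitVol (k + 2) * (min κ w / (M / (2 * B))) *
        (B * κ / (2 * n)) * δ ^ k)
      ≤ (m + 1) * (4 ^ (k + 2 + 1) * unitVol (k + 2) * (min κ w / (M / (2 * B))) *
        (B * κ / (2 * n)) * δ ^ k) := by gcongr; linarith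
    _ = _ := by
      rw [← hδn, mul_pow]
      field_simp
      ring

/-- An improvement of `sqBound_high` by the factor `κ / N_b²` for `κ ≪ N_b²`. -/
theorem sqBound_high_gain (hd : 2 ≤ d) {B : ℝ} (hB : 1 ≤ B) : ∃ C : ℝ, 0 < C ∧
    ∀ {κ : ℝ} {N W : Fin 3 → ℝ} {a b : Fin 3}, 0 < κ → (∀ j, 0 < N j) → (∀ j, 0 < W j) →
      IsPair a b → N b ≤ B * N a → κ ≤ N b ^ 2 / (20 * B ^ 6) →
      SqBound (modSet (region (d := d) B κ N) W) (ENNReal.ofReal (C *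
        (min3 W * (N a)⁻¹ * N b ^ (d - 1) * (κ / N b ^ 2) * min κ (W b + W 2)))) := by
  have hB0 : 0 < B := by linarith
  obtain ⟨C, hC, hvol⟩ := volume_high_le hd hB
  refine ⟨2 * C, by positivity, fun {κ N W a b} hκ hN hW hab hba hκN => ?_⟩
  obtain ⟨h1, h2, h3⟩ := hab.ne
  have ha := hN a
  have hb := hN b
  have hmin : 0 < min3 W := lt_min (lt_min (hW _) (hW _)) (hW _)
  refine (SqBound.modSet_of_fourfold (measurableSet_region B κ N) h3 h1.symm h2.symm
    (V := ENNReal.ofReal (C * ((N a)⁻¹ * N b ^ (d - 1) * (κ / N b ^ 2) * min κ (W b + W 2))))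
    fun u v c => ?_).mono (fun z hz _ => hz) (le_of_eq ?_)
  · by_cases hu : N b / B ≤ ‖u‖
    · refine (measure_mono ?_).trans (hvol (u := u) (v := v) (c := c) (δ := N b / (20 * B ^ 6))
        hκ ha hb (add_pos (hW b) (hW 2)) hba (by field_simp)
        (hκN.trans_eq (by ring)) hu)
      rintro x ⟨ξ, hξ, ξ', hξ', h0, h0', rfl, hx', rfl, rfl, hc⟩
      have e1 := hab.resonance h0
      have e2 := hab.resonance h0'
      have e3 : ξ' b = -(ξ a + ξ' 2) := by
        rw [eq_neg_iff_add_eq_zero, ← hab.sum h0', ← hx']; abel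
      rw [hx', e3, inner_neg_right] at e2
      have e1' : spatialResonance ξ = -(2 * ⟪ξ b, ξ a⟫) := by rw [e1, real_inner_comm]; ring
      have e2' : spatialResonance ξ' = 2 * ⟪ξ a, ξ a + ξ' 2⟫ := by rw [e2]; ring
      refine ⟨?_, ?_, ?_, ?_, ?_⟩
      · have := (hξ'.2 b).1
        rwa [e3, norm_neg] at this
      · rw [div_le_iff₀ hB0, mul_comm]; exact (hξ.2 a).2
      · rw [← abs_neg, ← e1']; exact hξ.1
      · rw [← e2']; exact hξ'.1
      · rw [← e1', ← e2']; exact hc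
    · refine (measure_mono_null ?_ measure_empty).le.trans (zero_le)
      rintro x ⟨ξ, hξ, -, -, -, -, -, -, rfl, -⟩
      refine absurd ?_ hu
      rw [div_le_iff₀ hB0, mul_comm]; exact (hξ.2 b).2
  · rw [← ENNReal.ofReal_mul (by positivity)]
    congr 1
    ring

/-- `SqBound.of_local` for the frequency `ξ_a`: the sum `ξ_a + ξ_2 = -ξ_b` is at most `B N_b`. -/
theorem SqBound.of_local_region {B κ r M : ℝ} (hB : 0 ≤ B) {N W : Fin 3 → ℝ} (hN : ∀ j, 0 < N j)
    {a b : Fin 3} (hab : IsPair a b) (hr : 0 < r)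
    (h : ∀ p, SqBound (modSet (region (d := d) B κ N ∩ {ξ | ‖ξ a - p‖ ≤ r}) W)
      (ENNReal.ofReal M)) :
    SqBound (modSet (region (d := d) B κ N) W)
      (ENNReal.ofReal (((r + B * N b) / r) ^ d * M)) := by
  have hb := hN b
  have hloc := SqBound.of_local (d := d) (r := r) (R := B * N b) (M := ENNReal.ofReal M)
    (measurableSet_modSet (measurableSet_region (d := d) B κ N) W) hab.ne.2.1 hr (by positivity)
    ?_ fun p => by rw [modSet_inter]; exact h p
  · rwa [← ENNReal.ofReal_mul (by positivity)] at hloc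
  · intro ζ hζ h0
    have h4 := hab.sum (ξ := fun j => (ζ j).1) (by
      have := congrArg Prod.fst h0
      rwa [Prod.fst_sum] at this)
    have h5 : (ζ a).1 + (ζ 2).1 = -(ζ b).1 := by
      rw [eq_neg_iff_add_eq_zero, ← h4]; abel
    rw [h5, norm_neg]
    exact (hζ.1.2 b).1

/-- An improvement of `sqBound_middle` by the factor `κ / N_b²` for `κ ≪ N_b²`. Given `ξ_b = u` and
`ξ_a' = v`, which are nearly orthogonal once `ξ_a` is localised, the possible values of `ξ_2` lie in
the intersection of two transversal slabs. -/
theorem sqBound_middle_gain (hd : 2 ≤ d) {B : ℝ} (hB : 1 ≤ B) : ∃ C : ℝ, 0 < C ∧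
    ∀ {κ : ℝ} {N W : Fin 3 → ℝ} {a b : Fin 3}, 0 < κ → (∀ j, 0 < N j) → (∀ j, 0 < W j) →
      IsPair a b → N b ≤ B * N a → κ ≤ N b ^ 2 / (20 * B ^ 6) →
      SqBound (modSet (region (d := d) B κ N) W) (ENNReal.ofReal (C *
        (min3 W * (N a)⁻¹ * N b ^ (d - 1) * (κ / N b ^ 2) * min κ (W b + W a)))) := by
  have hB0 : 0 < B := by linarith
  have hu0 := unitVol_pos d
  refine ⟨(1 + 20 * B ^ 7) ^ d * (2 * 4 ^ (d + 1) * unitVol d * B ^ d), by positivity,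
    fun {κ N W a b} hκ hN hW hab hba hκN => ?_⟩
  obtain ⟨h1, h2, h3⟩ := hab.ne
  have ha := hN a
  have hb := hN b
  have hmin : 0 < min3 W := lt_min (lt_min (hW _) (hW _)) (hW _)
  set ω := min κ (W b + W a)
  have hω : 0 < ω := lt_min hκ (add_pos (hW _) (hW _))
  set δ := N b / (20 * B ^ 6) with hδ
  have hδ0 : 0 < δ := by positivity
  have hκδ : κ ≤ δ * N b := hκN.trans_eq (by rw [hδ]; ring)
  have hnδ : N b = 20 * B ^ 6 * δ := by rw [hδ]; field_simp
  have hδM : 20 * B ^ 4 * δ ≤ N a / B := by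
    rw [le_div_iff₀ hB0]
    have : B * (20 * B ^ 4 * δ * B) ≤ B * N a := by
      calc B * (20 * B ^ 4 * δ * B) = N b := by rw [hnδ]; ring
        _ ≤ _ := hba
    exact le_of_mul_le_mul_left this hB0
  have hloc := SqBound.of_local_region (d := d) (κ := κ) (W := W)
    (M := 2 * 4 ^ (d + 1) * unitVol d * B ^ d *
      (min3 W * (N a)⁻¹ * N b ^ (d - 1) * (κ / N b ^ 2) * ω)) hB0.le hN hab hδ0 fun p => ?_
  · refine hloc.mono (fun z hz _ => hz) (le_of_eq ?_)
    have : (δ + B * N b) / δ = 1 + 20 * B ^ 7 := by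
      rw [hnδ]; field_simp
    rw [this]
    congr 1
    ring
  refine (SqBound.modSet_of_fourfold (measurableSet_local (measurableSet_region B κ N) a p δ)
    h1.symm h3 h2 (V := ENNReal.ofReal (4 ^ (d + 1) * unitVol d * (ω / (N a / (2 * B))) *
      (B * κ / (2 * N b)) * (B * N b) ^ (d - 2)))
    fun u v c => ?_).mono (fun z hz _ => hz) (le_of_eq ?_)
  · set S := {x : EuclideanSpace ℝ (Fin d) | ‖x + v‖ ≤ B * N b ∧ ‖x + u + v‖ ≤ 2 * δ ∧
      |2 * ⟪u, x + u⟫| ≤ κ ∧ |2 * ⟪v, x + v⟫| ≤ κ ∧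
      |2 * ⟪u, x + u⟫ - 2 * ⟪v, x + v⟫ - c| ≤ W b + W a} with hS
    have hSm : MeasurableSet S := by
      have m1 : IsClosed {x : EuclideanSpace ℝ (Fin d) | ‖x + v‖ ≤ B * N b} :=
        isClosed_le (by fun_prop) continuous_const
      have m2 : IsClosed {x : EuclideanSpace ℝ (Fin d) | ‖x + u + v‖ ≤ 2 * δ} :=
        isClosed_le (by fun_prop) continuous_const
      have m3 : IsClosed {x : EuclideanSpace ℝ (Fin d) | |2 * ⟪u, x + u⟫| ≤ κ} :=
        isClosed_le (by fun_prop) continuous_const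
      have m4 : IsClosed {x : EuclideanSpace ℝ (Fin d) | |2 * ⟪v, x + v⟫| ≤ κ} :=
        isClosed_le (by fun_prop) continuous_const
      have m5 : IsClosed {x : EuclideanSpace ℝ (Fin d) |
          |2 * ⟪u, x + u⟫ - 2 * ⟪v, x + v⟫ - c| ≤ W b + W a} :=
        isClosed_le (by fun_prop) continuous_const
      exact (m1.inter (m2.inter (m3.inter (m4.inter m5)))).measurableSet
    by_cases huv : N b / B ≤ ‖u‖ ∧ N a / B ≤ ‖v‖
    · refine (measure_mono (t := S) ?_).trans ?_
      · rintro x ⟨ξ, ⟨hξ, hξp⟩, ξ', ⟨hξ', hξp'⟩, h0, h0', rfl, hx', rfl, rfl, hc⟩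
        have e1 := hab.resonance h0
        have e2 := hab.resonance h0'
        have e3 : ξ a = -(ξ 2 + ξ b) := by
          rw [eq_neg_iff_add_eq_zero, ← hab.sum h0]; abel
        have e4 : ξ' b = -(ξ 2 + ξ' a) := by
          rw [eq_neg_iff_add_eq_zero, ← hab.sum h0', ← hx']; abel
        have e5 := norm_sub_le_of_closedBall (mem_closedBall_iff_norm.2 hξp)
          (mem_closedBall_iff_norm.2 hξp')
        have e1' : spatialResonance ξ = 2 * ⟪ξ b, ξ 2 + ξ b⟫ := by
          rw [e1, e3, inner_neg_left, real_inner_comm]; ring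
        have e2' : spatialResonance ξ' = 2 * ⟪ξ' a, ξ 2 + ξ' a⟫ := by
          rw [e2, e4, inner_neg_right]; ring
        refine ⟨?_, ?_, ?_, ?_, ?_⟩
        · have := (hξ'.2 b).1
          rwa [e4, norm_neg] at this
        · rw [e3, ← neg_add', norm_neg] at e5
          exact e5
        · rw [← e1']; exact hξ.1
        · rw [← e2']; exact hξ'.1
        · rw [← e1', ← e2']; exact hc
      · rcases S.eq_empty_or_nonempty with hemp | ⟨x₀, hx₀⟩
        · simp [hemp]
        have hσ : 0 < N b / B := by positivity
        have hu' : 0 < ‖u‖ := hσ.trans_le huv.1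
        set e := ‖u‖⁻¹ • u with he
        have hen : ‖e‖ = 1 := norm_inv_smul_self hu'
        have half : ∀ {y : ℝ}, |2 * y| ≤ κ → |y| ≤ κ / 2 := fun {y} hy => by
          rw [abs_mul, abs_two] at hy; linarith
        have hslab : ∀ x ∈ S, |⟪e, x⟫ - -‖u‖| ≤ B * κ / (2 * N b) := by
          intro x hx
          have k1 := abs_inner_inv_smul_le hσ huv.1 (half hx.2.2.1)
          rw [← he, inner_add_right, he, real_inner_comm u, inner_inv_smul_self hu'] at k1
          rw [sub_neg_eq_add, he]
          refine k1.trans_eq ?_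
          field_simp
        have hslabδ : B * κ / (2 * N b) ≤ B * δ / 2 := by
          rw [div_le_div_iff₀ (by positivity) (by norm_num)]
          nlinarith
        -- `u` and `v` are nearly orthogonal
        have hev : |⟪e, v⟫| ≤ B * δ / 2 + 2 * δ := by
          have k1 := (abs_inner_inv_smul_le hσ huv.1 (half hx₀.2.2.1)).trans_eq
            (by field_simp : κ / 2 / (N b / B) = B * κ / (2 * N b))
          have k2 := abs_inner_le_of_norm_le hen.le hx₀.2.1
          rw [← he] at k1
          have k3 : ⟪e, v⟫ = ⟪e, x₀ + u + v⟫ - ⟪e, x₀ + u⟫ := by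
            rw [← inner_sub_right]; congr 1; abel
          rw [k3]
          refine (abs_sub _ _).trans ?_
          linarith
        have hB1 : B ≤ B ^ 4 := le_self_pow₀ hB (by norm_num)
        have hB2 : 1 ≤ B ^ 4 := one_le_pow₀ hB
        have k2 : B * δ ≤ B ^ 4 * δ := by gcongr
        have k3 : δ ≤ B ^ 4 * δ := le_mul_of_one_le_left hδ0.le hB2
        obtain ⟨f, ρ, hf, hef, hρ, hρ0, hvf, -⟩ := exists_orthogonal_direction hen
          (x₀ := v) (lt_of_le_of_lt hev (by linarith [huv.2]))
        have hρM : N a / (2 * B) ≤ ρ := by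
          have : N a / B = 2 * (N a / (2 * B)) := by field_simp
          linarith [huv.2]
        refine volume_le_of_slices_slab (q := -v) hd hSm hf hen hef (by positivity)
          (by positivity) (by positivity) (fun x hx => mem_closedBall_iff_norm.2 (by
            rw [sub_neg_eq_add]; exact hx.1)) hslab fun x hx s hxs => ?_
        refine abs_le_of_mul_le (by positivity) (hρM.trans_eq hvf.symm) ?_
        have k4 : 2 * s * ⟪v, f⟫ = 2 * ⟪v, x + s • f + v⟫ - 2 * ⟪v, x + v⟫ := by
          simp only [inner_add_right, inner_smul_right]; ring
        have k5 : ⟪u, x + s • f + u⟫ = ⟪u, x + u⟫ := by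
          rw [← norm_mul_inner_inv_smul hu', ← norm_mul_inner_inv_smul hu']
          simp only [inner_add_right, inner_smul_right]
          rw [← he, hef]
          ring
        have k6 : |2 * ⟪v, x + s • f + v⟫ - 2 * ⟪v, x + v⟫| ≤ 2 * κ :=
          abs_sub_le_two_mul (c := 0) (by rw [sub_zero]; exact hx.2.2.2.1)
            (by rw [sub_zero]; exact hxs.2.2.2.1)
        have k7 : |2 * ⟪v, x + s • f + v⟫ - 2 * ⟪v, x + v⟫| ≤ 2 * (W b + W a) := by
          have h1 := abs_sub_le_two_mul hxs.2.2.2.2 hx.2.2.2.2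
          rw [k5] at h1
          convert h1 using 2
          ring
        rw [k4]
        rcases min_choice κ (W b + W a) with h | h
        · rw [show ω = κ from h]; exact k6
        · rw [show ω = W b + W a from h]; exact k7
    · refine (measure_mono_null ?_ measure_empty).le.trans (zero_le)
      rintro x ⟨ξ, hξ, ξ', hξ', -, -, -, -, rfl, rfl, -⟩
      refine absurd ⟨?_, ?_⟩ huv
      · rw [div_le_iff₀ hB0, mul_comm]; exact (hξ.1.2 b).2
      · rw [div_le_iff₀ hB0, mul_comm]; exact (hξ'.1.2 a).2
  · rw [← ENNReal.ofReal_mul (by positivity)]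
    congr 1
    obtain ⟨k, rfl⟩ := Nat.exists_eq_add_of_le' hd
    have hk : k + 2 - 1 = k + 1 := by omega
    simp only [hk, Nat.add_sub_cancel]
    field_simp
    rw [mul_pow]
    ring

end Fourfold

/-! ### The fourfold Cauchy–Schwarz inequality with the common low frequency -/

section Low

open Metric

open scoped RealInnerProductSpace

variable {d : ℕ}

/-- For two frequency triples with a common `ξ_b = x` and given `ξ_a = u`, `ξ_2' = y - u`, the
points `x` lie in the slab `|x · u| ≲ κ` and in a shell. If `ξ_a` is localised, then `x + y` is
small, and the normal `2 x + y` of the shell is close to `x`. -/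
theorem volume_low_le (hd : 2 ≤ d) {B : ℝ} (hB : 1 ≤ B) : ∃ C : ℝ, 0 < C ∧
    ∀ {κ M n w c δ : ℝ} {u y : EuclideanSpace ℝ (Fin d)}, 0 < κ → 0 < M → 0 < n → 0 < w →
      n = 20 * B ^ 6 * δ → M / B ≤ ‖u‖ →
      volume {x : EuclideanSpace ℝ (Fin d) | ‖x‖ ≤ B * n ∧ n / B ≤ ‖x‖ ∧ ‖x + y‖ ≤ 2 * δ ∧
        |2 * ⟪u, x⟫| ≤ κ ∧ |-(2 * ⟪x, x + y⟫) - c| ≤ w} ≤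
        ENNReal.ofReal (C * (M⁻¹ * n ^ (d - 1) * (κ / n ^ 2) * w)) := by
  have hB0 : 0 < B := by linarith
  obtain ⟨m, hm⟩ := exists_volume_le_of_cover d B (c := 1 / (20 * B ^ 6)) (by positivity)
  have hu0 := unitVol_pos d
  refine ⟨(m + 1) * (4 ^ (d + 1) * unitVol d * B ^ 2 * (1 / (20 * B ^ 6)) ^ (d - 2)), by positivity,
    fun {κ M n w c δ u y} hκ hM hn hw hδ hu => ?_⟩
  have hδ0 : 0 < δ := pos_of_mul_pos_right (hδ ▸ hn) (by positivity)
  have hδn : 1 / (20 * B ^ 6) * n = δ := by rw [hδ]; field_simp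
  have hσ : 0 < M / B := by positivity
  have hu' : 0 < ‖u‖ := hσ.trans_le hu
  have hB5 : 1 ≤ B ^ 5 := one_le_pow₀ hB
  have hnB : n / (4 * B) = 5 * (B ^ 5 * δ) := by rw [hδ]; field_simp; ring
  have hnB1 : n / B = 4 * (n / (4 * B)) := by field_simp
  have hnB2 : n / (2 * B) = 2 * (n / (4 * B)) := by field_simp; ring
  have hδB : δ ≤ B ^ 5 * δ := le_mul_of_one_le_left hδ0.le hB5
  set S := {x : EuclideanSpace ℝ (Fin d) | ‖x‖ ≤ B * n ∧ n / B ≤ ‖x‖ ∧ ‖x + y‖ ≤ 2 * δ ∧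
        |2 * ⟪u, x⟫| ≤ κ ∧ |-(2 * ⟪x, x + y⟫) - c| ≤ w} with hS
  have hSm : MeasurableSet S := by
    have m1 : IsClosed {x : EuclideanSpace ℝ (Fin d) | ‖x‖ ≤ B * n} :=
      isClosed_le (by fun_prop) continuous_const
    have m2 : IsClosed {x : EuclideanSpace ℝ (Fin d) | n / B ≤ ‖x‖} :=
      isClosed_le continuous_const (by fun_prop)
    have m3 : IsClosed {x : EuclideanSpace ℝ (Fin d) | ‖x + y‖ ≤ 2 * δ} :=
      isClosed_le (by fun_prop) continuous_const
    have m4 : IsClosed {x : EuclideanSpace ℝ (Fin d) | |2 * ⟪u, x⟫| ≤ κ} :=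
      isClosed_le (by fun_prop) continuous_const
    have m5 : IsClosed {x : EuclideanSpace ℝ (Fin d) | |-(2 * ⟪x, x + y⟫) - c| ≤ w} :=
      isClosed_le (by fun_prop) continuous_const
    exact (m1.inter (m2.inter (m3.inter (m4.inter m5)))).measurableSet
  -- slices along a direction that is nearly that of the points of `S`
  have hslice : ∀ {p x₀ a : EuclideanSpace ℝ (Fin d)} {ρ : ℝ}, x₀ ∈ closedBall p δ → ‖a‖ = 1 →
      ⟪x₀, a⟫ = ρ → 3 * (n / (4 * B)) ≤ ρ → ∀ x ∈ S ∩ closedBall p δ, ∀ s : ℝ,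
      x + s • a ∈ S ∩ closedBall p δ → |s| ≤ w / (n / (2 * B)) := by
    intro p x₀ a ρ hx₀p ha hx₀a hρ x hx s hxs
    set x' := x + s • a with hx'
    have g1 := (abs_le.1 (abs_inner_le_of_norm_le (norm_sub_le_of_closedBall hx.2 hx₀p) ha.le)).1
    rw [inner_sub_left, hx₀a] at g1
    have g2 := (abs_le.1 (abs_inner_le_of_norm_le hxs.1.2.2.1 ha.le)).1
    have g3 : n / (2 * B) ≤ ⟪x, a⟫ + ⟪x' + y, a⟫ := by linarith
    refine abs_le_of_mul_le (by positivity) g3 ?_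
    rw [← inner_quadratic_sub]
    have h1 := abs_sub_le_two_mul hxs.1.2.2.2.2 hx.1.2.2.2.2
    convert h1 using 2
    ring
  have hlocal : ∀ p, volume (S ∩ closedBall p (1 / (20 * B ^ 6) * n)) ≤
      ENNReal.ofReal (4 ^ (d + 1) * unitVol d * (w / (n / (2 * B))) * (B * κ / (2 * M)) *
        δ ^ (d - 2)) := by
    intro p
    rw [hδn]
    rcases (S ∩ closedBall p δ).eq_empty_or_nonempty with hemp | ⟨x₀, hx₀, hx₀p⟩
    · simp [hemp]
    have hSm' := hSm.inter (measurableSet_closedBall (x := p) (ε := δ))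
    rcases le_total (B * κ / (2 * M)) (n / (4 * B)) with hcase | hcase
    · set e := ‖u‖⁻¹ • u with he
      have hen : ‖e‖ = 1 := norm_inv_smul_self hu'
      have hslab : ∀ x ∈ S, |⟪e, x⟫| ≤ B * κ / (2 * M) := by
        intro x hx
        have h1 : |⟪u, x⟫| ≤ κ / 2 := by
          have := hx.2.2.2.1
          rw [abs_mul, abs_two] at this
          linarith
        refine (abs_inner_inv_smul_le hσ hu h1).trans_eq ?_
        field_simp
      have hs₀ := (hslab x₀ hx₀).trans hcase
      have hx₀n := hx₀.2.1
      have hn4 : 0 < n / (4 * B) := by positivity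
      obtain ⟨a, ρ, ha, hea, hρ, hρ0, hx₀a, -⟩ := exists_orthogonal_direction hen
        (x₀ := x₀) (by linarith)
      exact volume_le_of_slices_slab hd hSm' ha hen hea (c := 0)
        (by positivity) (by positivity) hδ0 Set.inter_subset_right
        (fun x hx => by rw [sub_zero]; exact hslab x hx.1)
        (hslice hx₀p ha hx₀a (by linarith))
    · -- the slab is no restriction
      have hx₀n := hx₀.2.1
      have hx₀0 : 0 < ‖x₀‖ := lt_of_lt_of_le (by positivity) hx₀n
      refine (volume_le_of_slices_ball (by omega) hSm' (norm_inv_smul_self hx₀0) (by positivity)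
        hδ0 Set.inter_subset_right (hslice hx₀p (norm_inv_smul_self hx₀0)
        (inner_inv_smul_self hx₀0) (by linarith))).trans (ENNReal.ofReal_le_ofReal ?_)
      have h1 : d - 1 = d - 2 + 1 := by omega
      rw [h1, pow_succ]
      calc 2 ^ (d + 1) * unitVol d * (w / (n / (2 * B))) * (δ ^ (d - 2) * δ)
          ≤ 4 ^ (d + 1) * unitVol d * (w / (n / (2 * B))) *
            (δ ^ (d - 2) * (B * κ / (2 * M))) := by
            gcongr
            · norm_num
            · linarith
        _ = _ := by ring
  refine (hm n 0 S _ hn (fun x hx => mem_closedBall_zero_iff.2 hx.1) hlocal).trans ?_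
  rw [← ENNReal.ofReal_natCast, ← ENNReal.ofReal_mul (by positivity)]
  refine ENNReal.ofReal_le_ofReal ?_
  obtain ⟨k, rfl⟩ := Nat.exists_eq_add_of_le' hd
  have hk : k + 2 - 1 = k + 1 := by omega
  simp only [hk, Nat.add_sub_cancel]
  calc (m : ℝ) * (4 ^ (k + 2 + 1) * unitVol (k + 2) * (w / (n / (2 * B))) *
        (B * κ / (2 * M)) * δ ^ k)
      ≤ (m + 1) * (4 ^ (k + 2 + 1) * unitVol (k + 2) * (w / (n / (2 * B))) *
        (B * κ / (2 * M)) * δ ^ k) := by gcongr; linarith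
    _ = _ := by
      rw [← hδn, mul_pow]
      field_simp
      ring

/-- A bound for the `(+-)` interaction in terms of the modulations of the two high frequency waves,
after a localisation of `ξ_a` to balls of radius comparable to `N_b`. -/
theorem sqBound_low (hd : 2 ≤ d) {B : ℝ} (hB : 1 ≤ B) : ∃ C : ℝ, 0 < C ∧
    ∀ {κ : ℝ} {N W : Fin 3 → ℝ} {a b : Fin 3}, 0 < κ → (∀ j, 0 < N j) → (∀ j, 0 < W j) →
      IsPair a b →
      SqBound (modSet (region (d := d) B κ N) W) (ENNReal.ofReal (C *
        (min3 W * (N a)⁻¹ * N b ^ (d - 1) * (κ / N b ^ 2) * (W a + W 2)))) := by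
  have hB0 : 0 < B := by linarith
  obtain ⟨C, hC, hvol⟩ := volume_low_le hd hB
  refine ⟨(1 + 20 * B ^ 7) ^ d * (2 * C), by positivity,
    fun {κ N W a b} hκ hN hW hab => ?_⟩
  obtain ⟨h1, h2, h3⟩ := hab.ne
  have ha := hN a
  have hb := hN b
  have hWa := hW a
  have hW2 := hW 2
  have hmin : 0 < min3 W := lt_min (lt_min (hW _) (hW _)) (hW _)
  set δ := N b / (20 * B ^ 6) with hδ
  have hδ0 : 0 < δ := by positivity
  have hnδ : N b = 20 * B ^ 6 * δ := by rw [hδ]; field_simp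
  have hloc := SqBound.of_local_region (d := d) (κ := κ) (W := W)
    (M := 2 * C * (min3 W * (N a)⁻¹ * N b ^ (d - 1) * (κ / N b ^ 2) * (W a + W 2)))
    hB0.le hN hab hδ0 fun p => ?_
  · refine hloc.mono (fun z hz _ => hz) (le_of_eq ?_)
    have : (δ + B * N b) / δ = 1 + 20 * B ^ 7 := by
      rw [hnδ]; field_simp
    rw [this]
    congr 1
    ring
  refine (SqBound.modSet_of_fourfold (measurableSet_local (measurableSet_region B κ N) a p δ)
    h2 h1 h3.symm (V := ENNReal.ofReal (C *
      ((N a)⁻¹ * N b ^ (d - 1) * (κ / N b ^ 2) * (W a + W 2))))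
    fun u v c => ?_).mono (fun z hz _ => hz) (le_of_eq ?_)
  · by_cases hu : N a / B ≤ ‖u‖
    · refine (measure_mono ?_).trans (hvol (u := u) (y := u + v) (c := c) (δ := δ)
        hκ ha hb (by positivity) hnδ hu)
      rintro x ⟨ξ, ⟨hξ, hξp⟩, ξ', ⟨hξ', hξp'⟩, h0, h0', rfl, hx', rfl, rfl, hc⟩
      have e1 := hab.resonance h0
      have e2 := hab.resonance h0'
      have e3 : ξ' a = -(ξ b + ξ' 2) := by
        rw [eq_neg_iff_add_eq_zero, ← hab.sum h0', ← hx']; abel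
      have e5 := norm_sub_le_of_closedBall (mem_closedBall_iff_norm.2 hξp)
        (mem_closedBall_iff_norm.2 hξp')
      have e6 : ξ a - ξ' a = ξ b + (ξ a + ξ' 2) := by rw [e3]; abel
      refine ⟨(hξ.2 b).1, ?_, ?_, ?_, ?_⟩
      · rw [div_le_iff₀ hB0, mul_comm]; exact (hξ.2 b).2
      · rwa [← e6]
      · rw [← abs_neg, ← neg_mul, ← e1]; exact hξ.1
      · have e7 : spatialResonance ξ - spatialResonance ξ' =
            -(2 * ⟪ξ b, ξ b + (ξ a + ξ' 2)⟫) := by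
          rw [← e6, inner_sub_right, e1, e2, hx', real_inner_comm (ξ b) (ξ a),
            real_inner_comm (ξ b) (ξ' a)]
          ring
        rw [← e7]; exact hc
    · refine (measure_mono_null ?_ measure_empty).le.trans (zero_le)
      rintro x ⟨ξ, hξ, -, -, -, -, -, -, rfl, -⟩
      refine absurd ?_ hu
      rw [div_le_iff₀ hB0, mul_comm]; exact (hξ.1.2 a).2
  · rw [← ENNReal.ofReal_mul (by positivity)]
    congr 1
    ring

end Low

/-! ### Case distinction on the order of the modulations -/

section Combine

theorem order_stats {v : Fin 3 → ℝ} {i j k : Fin 3} (hij : i ≠ j) (hjk : j ≠ k) (hik : i ≠ k)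
    (h1 : v i ≤ v j) (h2 : v j ≤ v k) : min3 v = v i ∧ med3 v = v j ∧ max3 v = v k := by
  have h3 := h1.trans h2
  fin_cases i <;> fin_cases j <;> fin_cases k <;> simp at * <;> simp [min3, med3, max3, *]

theorem min_eq_min3 {v : Fin 3 → ℝ} {i j k : Fin 3} (hij : i ≠ j) (hjk : j ≠ k) (hik : i ≠ k)
    (hi : v i ≤ v k) (hj : v j ≤ v k) :
    min (v i) (v j) = min3 v ∧ v i + v j ≤ 2 * med3 v := by
  rcases le_total (v i) (v j) with h | h
  · obtain ⟨e1, e2, -⟩ := order_stats hij hjk hik h hj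
    exact ⟨by rw [e1, min_eq_left h], by rw [e2]; linarith⟩
  · obtain ⟨e1, e2, -⟩ := order_stats hij.symm hik hjk h hi
    exact ⟨by rw [e1, min_eq_right h], by rw [e2]; linarith⟩

theorem min3_pos {v : Fin 3 → ℝ} (h : ∀ j, 0 < v j) : 0 < min3 v :=
  lt_min (lt_min (h _) (h _)) (h _)

theorem med3_pos {v : Fin 3 → ℝ} (h : ∀ j, 0 < v j) : 0 < med3 v :=
  lt_max_of_lt_left (lt_min (h _) (h _))

theorem max3_pos {v : Fin 3 → ℝ} (h : ∀ j, 0 < v j) : 0 < max3 v :=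
  lt_max_of_lt_right (h _)

theorem min3_le (v : Fin 3 → ℝ) (j : Fin 3) : min3 v ≤ v j := by
  fin_cases j <;> simp [min3]

theorem le_max3 (v : Fin 3 → ℝ) (j : Fin 3) : v j ≤ max3 v := by
  fin_cases j <;> simp [max3]

theorem min3_mul {A : ℝ} (hA : 0 ≤ A) (v : Fin 3 → ℝ) :
    min3 (fun j => A * v j) = A * min3 v := by
  simp [min3, mul_min_of_nonneg _ _ hA]

theorem med3_mul {A : ℝ} (hA : 0 ≤ A) (v : Fin 3 → ℝ) :
    med3 (fun j => A * v j) = A * med3 v := by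
  simp [med3, mul_min_of_nonneg _ _ hA, mul_max_of_nonneg _ _ hA]

variable {d : ℕ}

/-- A bound without the gain `κ / n²`, together with one that has this gain for `κ ≪ n²`. -/
theorem SqBound.combine {X : Set (Fin 3 → Freq d)} {B c₁ c₂ κ n q m s t : ℝ} (hB : 1 ≤ B)
    (hc₁ : 0 < c₁) (hc₂ : 0 < c₂) (hκ : 0 < κ) (hn : 0 < n) (hq : 0 < q) (hm : 0 < m)
    (hs : 0 < s) (hst : s ≤ (B + 1) * t)
    (h1 : SqBound X (ENNReal.ofReal (c₁ * (m * q * min κ s))))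
    (h2 : κ ≤ n ^ 2 / (20 * B ^ 6) →
      SqBound X (ENNReal.ofReal (c₂ * (m * q * (κ / n ^ 2) * min κ s)))) :
    SqBound X (ENNReal.ofReal ((B + 1) * (20 * B ^ 6 * c₁ + c₂) *
      (m * q * min 1 (κ / n ^ 2) * min κ t))) := by
  have hB6 : 1 ≤ B ^ 6 := one_le_pow₀ hB
  have ht : 0 < t := pos_of_mul_pos_right (hs.trans_le hst) (by linarith)
  have hω : 0 < min κ t := lt_min hκ ht
  have hωs : 0 < min κ s := lt_min hκ hs
  have hmin : min κ s ≤ (B + 1) * min κ t := by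
    rw [mul_min_of_nonneg _ _ (by linarith)]
    exact min_le_min (le_mul_of_one_le_left hκ.le (by linarith)) hst
  rcases le_total κ (n ^ 2 / (20 * B ^ 6)) with h | h
  · refine (h2 h).mono (fun z hz _ => hz) (ENNReal.ofReal_le_ofReal ?_)
    have h3 : κ / n ^ 2 ≤ 1 := by
      rw [div_le_one (by positivity)]
      refine h.trans (div_le_self (by positivity) (by linarith))
    rw [min_eq_right h3]
    calc c₂ * (m * q * (κ / n ^ 2) * min κ s)
        ≤ (20 * B ^ 6 * c₁ + c₂) * (m * q * (κ / n ^ 2) * ((B + 1) * min κ t)) := by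
          gcongr
          have : 0 < 20 * B ^ 6 * c₁ := by positivity
          linarith
      _ = _ := by ring
  · refine h1.mono (fun z hz _ => hz) (ENNReal.ofReal_le_ofReal ?_)
    have h3 : 1 ≤ 20 * B ^ 6 * min 1 (κ / n ^ 2) := by
      rw [mul_min_of_nonneg _ _ (by positivity)]
      refine le_min (by linarith) ?_
      rw [div_le_iff₀ (by positivity)] at h
      rw [← mul_div_assoc, le_div_iff₀ (by positivity)]
      linarith
    have h4 : 0 < min 1 (κ / n ^ 2) := lt_min one_pos (by positivity)
    calc c₁ * (m * q * min κ s)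
        ≤ c₁ * (m * q * ((B + 1) * min κ t)) := by gcongr
      _ ≤ (20 * B ^ 6 * min 1 (κ / n ^ 2)) * (c₁ * (m * q * ((B + 1) * min κ t))) :=
          le_mul_of_one_le_left (by positivity) h3
      _ = (20 * B ^ 6 * c₁) * (m * q * min 1 (κ / n ^ 2) * ((B + 1) * min κ t)) := by ring
      _ ≤ (20 * B ^ 6 * c₁ + c₂) * (m * q * min 1 (κ / n ^ 2) * ((B + 1) * min κ t)) := by
          gcongr
          linarith
      _ = _ := by ring

/-- `sqBound_high` and `sqBound_high_gain` together. The hypotheses on `W` hold if `W_a` is the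
largest modulation, or if `W_b` is the largest, `W_a` the median, and the two are comparable. -/
theorem sqBound_high_min (hd : 2 ≤ d) {B : ℝ} (hB : 1 ≤ B) : ∃ C : ℝ, 0 < C ∧
    ∀ {κ : ℝ} {N W : Fin 3 → ℝ} {a b : Fin 3}, 0 < κ → (∀ j, 0 < N j) → (∀ j, 0 < W j) →
      IsPair a b → N b ≤ B * N a → min (W b) (W 2) = min3 W → W b + W 2 ≤ (B + 1) * med3 W →
      SqBound (modSet (region (d := d) B κ N) W) (ENNReal.ofReal (C *
        (min3 W * ((N a)⁻¹ * N b ^ (d - 1)) * min 1 (κ / N b ^ 2) * min κ (med3 W)))) := by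
  have hB0 : 0 < B := by linarith
  have hu := unitVol_pos d
  obtain ⟨C, hC, hhigh⟩ := sqBound_high_gain hd hB
  refine ⟨_, ?_, fun {κ N W a b} hκ hN hW hab hba h1 h2 => SqBound.combine
    (c₁ := 2 ^ (d + 2) * unitVol d * B ^ d) hB (by positivity) hC hκ (hN b)
    (mul_pos (inv_pos.2 (hN a)) (pow_pos (hN b) _)) (min3_pos hW) (add_pos (hW b) (hW 2)) h2
    ?_ fun h3 => ?_⟩
  · positivity
  · convert sqBound_high (one_le_two.trans hd) hB hκ hN hW hab using 3
    rw [h1]; ring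
  · convert hhigh hκ hN hW hab hba h3 using 3
    ring

/-- `sqBound_middle` and `sqBound_middle_gain` together. The hypotheses on `W` hold if `W_2` is the
largest modulation, or if `W_b` is the largest, `W_2` the median, and the two are comparable. -/
theorem sqBound_middle_min (hd : 2 ≤ d) {B : ℝ} (hB : 1 ≤ B) : ∃ C : ℝ, 0 < C ∧
    ∀ {κ : ℝ} {N W : Fin 3 → ℝ} {a b : Fin 3}, 0 < κ → (∀ j, 0 < N j) → (∀ j, 0 < W j) →
      IsPair a b → N 2 ≤ B * N a → N a ≤ B * N 2 → N b ≤ B * N a →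
      min (W b) (W a) = min3 W → W b + W a ≤ (B + 1) * med3 W →
      SqBound (modSet (region (d := d) B κ N) W) (ENNReal.ofReal (C *
        (min3 W * ((N a)⁻¹ * N b ^ (d - 1)) * min 1 (κ / N b ^ 2) * min κ (med3 W)))) := by
  have hB0 : 0 < B := by linarith
  have hu := unitVol_pos d
  obtain ⟨C, hC, hmid⟩ := sqBound_middle_gain hd hB
  refine ⟨_, ?_, fun {κ N W a b} hκ hN hW hab h2a ha2 hba h1 h2 => SqBound.combine
    (c₁ := (2 ^ (d + 2) + 2 * d) * unitVol d * (6 * B ^ 5) ^ d) hB (by positivity) hC hκ (hN b)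
    (mul_pos (inv_pos.2 (hN a)) (pow_pos (hN b) _)) (min3_pos hW) (add_pos (hW b) (hW a)) h2
    ?_ fun h3 => ?_⟩
  · positivity
  · convert sqBound_middle hd hB hκ hN hW hab h2a ha2 using 3
    rw [h1]; ring
  · convert hmid hκ hN hW hab hba h3 using 3
    ring

/-- The `(+-)` interaction outside the coherent regime: either `W_b` does not dominate the other two
modulations, or `κ ≲ N_b²`. -/
theorem sqBound_plusMinus (hd : 2 ≤ d) {B : ℝ} (hB : 1 ≤ B) : ∃ C : ℝ, 0 < C ∧
    ∀ {κ : ℝ} {N W : Fin 3 → ℝ} {a b : Fin 3}, 0 < κ → (∀ j, 0 < N j) → (∀ j, 0 < W j) →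
      IsPair a b → N 2 ≤ B * N a → N a ≤ B * N 2 → N b ≤ B * N a →
      (W b ≤ B * med3 W ∨ (med3 W ≤ B * κ ∧ κ ≤ B * N b ^ 2)) →
      SqBound (modSet (region (d := d) B κ N) W) (ENNReal.ofReal (C *
        (min3 W * ((N a)⁻¹ * N b ^ (d - 1)) * min 1 (κ / N b ^ 2) * min κ (med3 W)))) := by
  have hB0 : 0 < B := by linarith
  obtain ⟨C₁, hC₁, hhigh⟩ := sqBound_high_min hd hB
  obtain ⟨C₂, hC₂, hmid⟩ := sqBound_middle_min hd hB
  obtain ⟨C₃, hC₃, hlow⟩ := sqBound_low hd hB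
  refine ⟨max (max C₁ C₂) (2 * B ^ 2 * C₃), by positivity,
    fun {κ N W a b} hκ hN hW hab h2a ha2 hba hdom => ?_⟩
  obtain ⟨hab1, ha2', hb2'⟩ := hab.ne
  have ha := hN a
  have hb := hN b
  have hm := min3_pos hW
  have ht := med3_pos hW
  have hG : 0 < min 1 (κ / N b ^ 2) := lt_min one_pos (by positivity)
  have hω : 0 < min κ (med3 W) := lt_min hκ ht
  set Y := min3 W * ((N a)⁻¹ * N b ^ (d - 1)) * min 1 (κ / N b ^ 2) * min κ (med3 W) with hY
  have hY0 : 0 < Y := by positivity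
  have key₁ (h1 : min (W b) (W 2) = min3 W) (h2 : W b + W 2 ≤ (B + 1) * med3 W) :
      SqBound (modSet (region (d := d) B κ N) W)
        (ENNReal.ofReal (max (max C₁ C₂) (2 * B ^ 2 * C₃) * Y)) :=
    (hhigh hκ hN hW hab hba h1 h2).mono (fun z hz _ => hz) (ENNReal.ofReal_le_ofReal
      (mul_le_mul_of_nonneg_right ((le_max_left _ _).trans (le_max_left _ _)) hY0.le))
  have key₂ (h1 : min (W b) (W a) = min3 W) (h2 : W b + W a ≤ (B + 1) * med3 W) :
      SqBound (modSet (region (d := d) B κ N) W)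
        (ENNReal.ofReal (max (max C₁ C₂) (2 * B ^ 2 * C₃) * Y)) :=
    (hmid hκ hN hW hab h2a ha2 hba h1 h2).mono (fun z hz _ => hz) (ENNReal.ofReal_le_ofReal
      (mul_le_mul_of_nonneg_right ((le_max_right _ _).trans (le_max_left _ _)) hY0.le))
  have key₃ (h1 : W a + W 2 ≤ 2 * med3 W) (h2 : med3 W ≤ B * κ) (h3 : κ ≤ B * N b ^ 2) :
      SqBound (modSet (region (d := d) B κ N) W)
        (ENNReal.ofReal (max (max C₁ C₂) (2 * B ^ 2 * C₃) * Y)) := by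
    refine (hlow hκ hN hW hab).mono (fun z hz _ => hz) (ENNReal.ofReal_le_ofReal ?_)
    have h4 : κ / N b ^ 2 ≤ B * min 1 (κ / N b ^ 2) := by
      rw [mul_min_of_nonneg _ _ hB0.le]
      refine le_min ?_ (le_mul_of_one_le_left (by positivity) hB)
      rw [mul_one, div_le_iff₀ (by positivity)]
      exact h3
    have h5 : med3 W ≤ B * min κ (med3 W) := by
      rw [mul_min_of_nonneg _ _ hB0.le]
      exact le_min h2 (le_mul_of_one_le_left ht.le hB)
    have h6 : W a + W 2 ≤ 2 * (B * min κ (med3 W)) := by linarith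
    have hWs := add_pos (hW a) (hW 2)
    calc C₃ * (min3 W * (N a)⁻¹ * N b ^ (d - 1) * (κ / N b ^ 2) * (W a + W 2))
        ≤ C₃ * (min3 W * (N a)⁻¹ * N b ^ (d - 1) * (B * min 1 (κ / N b ^ 2)) *
          (2 * (B * min κ (med3 W)))) := by gcongr
      _ = 2 * B ^ 2 * C₃ * Y := by rw [hY]; ring
      _ ≤ _ := mul_le_mul_of_nonneg_right (le_max_right _ _) hY0.le
  have hB2 : 2 * med3 W ≤ (B + 1) * med3 W := by gcongr; linarith
  rcases le_total (W a) (W b) with h1 | h1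
  · rcases le_total (W b) (W 2) with h2 | h2
    · obtain ⟨e1, e2⟩ := min_eq_min3 hab1.symm ha2' hb2' h2 (h1.trans h2)
      exact key₂ e1 (e2.trans hB2)
    · rcases hdom with h | ⟨h, h'⟩
      · rcases le_total (W a) (W 2) with h3 | h3
        · obtain ⟨e1, e2, -⟩ := order_stats ha2' hb2'.symm hab1 h3 h2
          exact key₂ (by rw [e1, min_eq_right h1]) (by linarith)
        · obtain ⟨e1, e2, -⟩ := order_stats ha2'.symm hab1 hb2'.symm h3 h1
          exact key₁ (by rw [e1, min_eq_right h2]) (by linarith)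
      · exact key₃ (min_eq_min3 ha2' hb2'.symm hab1 h1 h2).2 h h'
  · rcases le_total (W a) (W 2) with h2 | h2
    · obtain ⟨e1, e2⟩ := min_eq_min3 hab1.symm ha2' hb2' (h1.trans h2) h2
      exact key₂ e1 (e2.trans hB2)
    · obtain ⟨e1, e2⟩ := min_eq_min3 hb2' ha2'.symm hab1.symm h1 h2
      exact key₁ e1 (e2.trans hB2)

/-- The `(+-)` interaction in the coherent regime, in which `W_b` dominates. -/
theorem sqBound_coherent (hd : 2 ≤ d) {B : ℝ} (hB : 1 ≤ B) : ∃ C : ℝ, 0 < C ∧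
    ∀ {κ : ℝ} {N W : Fin 3 → ℝ} {a b : Fin 3}, 0 < κ → (∀ j, 0 < N j) → (∀ j, 0 < W j) →
      IsPair a b → N 2 ≤ B * N a → N a ≤ B * N 2 → W a ≤ W b → W 2 ≤ W b →
      SqBound (modSet (region (d := d) B κ N) W) (ENNReal.ofReal (C *
        (min3 W * ((N a)⁻¹ * N b ^ (d - 1)) * min κ (κ / N b ^ 2 * med3 W)))) := by
  have hB0 : 0 < B := by linarith
  have hu := unitVol_pos d
  obtain ⟨C₃, hC₃, hlow⟩ := sqBound_low hd hB
  set D₁ := 2 ^ (d + 2) * unitVol d * B ^ d with hD₁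
  set D₂ := (2 ^ (d + 2) + 2 * d) * unitVol d * (6 * B ^ 5) ^ d with hD₂
  have hD₁0 : 0 < D₁ := by positivity
  have hD₂0 : 0 < D₂ := by positivity
  refine ⟨D₁ + D₂ + 2 * C₃, by positivity, fun {κ N W a b} hκ hN hW hab h2a ha2 hWab hW2b => ?_⟩
  obtain ⟨hab1, ha2', hb2'⟩ := hab.ne
  have ha := hN a
  have hb := hN b
  have hm := min3_pos hW
  have ht := med3_pos hW
  rcases min_choice κ (κ / N b ^ 2 * med3 W) with h | h <;> rw [h]
  · have conv : ∀ {D s : ℝ}, 0 < D → D ≤ D₁ + D₂ → 0 < s →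
        D * (min3 W * (N a)⁻¹ * N b ^ (d - 1) * min κ s) ≤
        (D₁ + D₂ + 2 * C₃) * (min3 W * ((N a)⁻¹ * N b ^ (d - 1)) * κ) := by
      intro D s hD hDD hs
      have := lt_min hκ hs
      rw [← mul_assoc (min3 W)]
      gcongr
      · linarith
      · exact min_le_left _ _
    rcases le_total (W a) (W 2) with h3 | h3
    · obtain ⟨e1, -, -⟩ := order_stats ha2' hb2'.symm hab1 h3 hW2b
      refine (sqBound_middle hd hB hκ hN hW hab h2a ha2).mono (fun z hz _ => hz)
        (ENNReal.ofReal_le_ofReal ?_)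
      rw [min_eq_right hWab, ← hD₂, ← e1]
      exact conv hD₂0 (by linarith) (add_pos (hW b) hm)
    · obtain ⟨e1, -, -⟩ := order_stats ha2'.symm hab1 hb2'.symm h3 hWab
      refine (sqBound_high (by omega) hB hκ hN hW hab).mono (fun z hz _ => hz)
        (ENNReal.ofReal_le_ofReal ?_)
      rw [min_eq_right hW2b, ← hD₁, ← e1]
      exact conv hD₁0 (by linarith) (add_pos (hW b) hm)
  · have hsum := (min_eq_min3 ha2' hb2'.symm hab1 hWab hW2b).2
    have hWs := add_pos (hW a) (hW 2)
    refine (hlow hκ hN hW hab).mono (fun z hz _ => hz) (ENNReal.ofReal_le_ofReal ?_)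
    calc C₃ * (min3 W * (N a)⁻¹ * N b ^ (d - 1) * (κ / N b ^ 2) * (W a + W 2))
        ≤ C₃ * (min3 W * (N a)⁻¹ * N b ^ (d - 1) * (κ / N b ^ 2) * (2 * med3 W)) := by gcongr
      _ = 2 * C₃ * (min3 W * ((N a)⁻¹ * N b ^ (d - 1)) * (κ / N b ^ 2 * med3 W)) := by ring
      _ ≤ _ := by
          gcongr
          linarith

/-- The `(++)` interaction; `M` is the common size of the two high frequencies. -/
theorem sqBound_plusPlus (hd : 2 ≤ d) {B : ℝ} (hB : 1 ≤ B) : ∃ C : ℝ, 0 < C ∧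
    ∀ {κ M : ℝ} {N W : Fin 3 → ℝ}, 0 < κ → (∀ j, 0 < N j) → (∀ j, 0 < W j) →
      N 0 ≤ M → N 1 ≤ M → M ≤ B * N 0 → M ≤ B * N 1 → 5 * B ^ 2 * N 2 ≤ N 0 →
      SqBound (modSet (region (d := d) B κ N) W) (ENNReal.ofReal (C *
        (min3 W * (M⁻¹ * N 2 ^ (d - 1)) * min (M * N 2) (med3 W)))) := by
  have hB0 : 0 < B := by linarith
  have hu := unitVol_pos d
  set D₁ := 2 ^ (d + 3) * unitVol d * B ^ d
  set D₂ := (1 + B) ^ d * (2 ^ (d + 3) * unitVol d * B)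
  have hD₁0 : 0 < D₁ := by positivity
  have hD₂0 : 0 < D₂ := by positivity
  refine ⟨(D₁ + D₂) * (2 * B), by positivity, fun {κ M N W} hκ hN hW h0 h1 h0' h1' h2 => ?_⟩
  have hM : 0 < M := (hN 0).trans_le h0
  have hn := hN 2
  have hm := min3_pos hW
  have ht := med3_pos hW
  have conv : ∀ {D x m s : ℝ}, 0 < D → D ≤ D₁ + D₂ → 0 < x → x ≤ M → M ≤ B * x → m = min3 W →
      0 < s → s ≤ 2 * med3 W → D * (m * x⁻¹ * N 2 ^ (d - 1) * min (x * N 2) s) ≤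
      (D₁ + D₂) * (2 * B) * (min3 W * (M⁻¹ * N 2 ^ (d - 1)) * min (M * N 2) (med3 W)) := by
    intro D x m s hD hDD hx hxM hMx hm' hs hst
    have k1 : x⁻¹ ≤ B * M⁻¹ := by
      rw [← div_eq_mul_inv, inv_eq_one_div, div_le_div_iff₀ hx hM]
      linarith
    have k2 : min (x * N 2) s ≤ 2 * min (M * N 2) (med3 W) := by
      rw [mul_min_of_nonneg _ _ (by norm_num)]
      refine min_le_min ?_ hst
      nlinarith
    have k3 : 0 < min (x * N 2) s := lt_min (by positivity) hs
    rw [hm']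
    calc D * (min3 W * x⁻¹ * N 2 ^ (d - 1) * min (x * N 2) s)
        ≤ (D₁ + D₂) * (min3 W * (B * M⁻¹) * N 2 ^ (d - 1) *
          (2 * min (M * N 2) (med3 W))) := by gcongr
      _ = _ := by ring
  have key₀ : min (W 1) (W 2) = min3 W → W 1 + W 2 ≤ 2 * med3 W →
      SqBound (modSet (region (d := d) B κ N) W) (ENNReal.ofReal ((D₁ + D₂) * (2 * B) *
        (min3 W * (M⁻¹ * N 2 ^ (d - 1)) * min (M * N 2) (med3 W)))) := fun e1 e2 =>
    (sqBound_plusPlus_high (by omega) hB hκ hN hW (Or.inl ⟨rfl, rfl⟩)).mono (fun z hz _ => hz)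
      (ENNReal.ofReal_le_ofReal (conv hD₁0 (by linarith) (hN 0) h0 h0' e1
        (add_pos (hW 1) (hW 2)) e2))
  have key₁ : min (W 0) (W 2) = min3 W → W 0 + W 2 ≤ 2 * med3 W →
      SqBound (modSet (region (d := d) B κ N) W) (ENNReal.ofReal ((D₁ + D₂) * (2 * B) *
        (min3 W * (M⁻¹ * N 2 ^ (d - 1)) * min (M * N 2) (med3 W)))) := fun e1 e2 =>
    (sqBound_plusPlus_high (by omega) hB hκ hN hW (Or.inr ⟨rfl, rfl⟩)).mono (fun z hz _ => hz)
      (ENNReal.ofReal_le_ofReal (conv hD₁0 (by linarith) (hN 1) h1 h1' e1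
        (add_pos (hW 0) (hW 2)) e2))
  have key₂ : min (W 0) (W 1) = min3 W → W 0 + W 1 ≤ 2 * med3 W →
      SqBound (modSet (region (d := d) B κ N) W) (ENNReal.ofReal ((D₁ + D₂) * (2 * B) *
        (min3 W * (M⁻¹ * N 2 ^ (d - 1)) * min (M * N 2) (med3 W)))) := fun e1 e2 =>
    (sqBound_plusPlus_low (by omega) hB hN hW (Or.inl ⟨rfl, rfl⟩) h2).mono (fun z hz _ => hz)
      (ENNReal.ofReal_le_ofReal ((le_of_eq (by ring)).trans
        (conv hD₂0 (by linarith) (hN 0) h0 h0' e1 (add_pos (hW 0) (hW 1)) e2)))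
  have n01 : (0 : Fin 3) ≠ 1 := by decide
  have n02 : (0 : Fin 3) ≠ 2 := by decide
  have n12 : (1 : Fin 3) ≠ 2 := by decide
  rcases le_total (W 0) (W 1) with g1 | g1
  · rcases le_total (W 1) (W 2) with g2 | g2
    · obtain ⟨e1, e2⟩ := min_eq_min3 n01 n12 n02 (g1.trans g2) g2
      exact key₂ e1 e2
    · obtain ⟨e1, e2⟩ := min_eq_min3 n02 n12.symm n01 g1 g2
      exact key₁ e1 e2
  · rcases le_total (W 0) (W 2) with g2 | g2
    · obtain ⟨e1, e2⟩ := min_eq_min3 n01 n12 n02 g2 (g1.trans g2)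
      exact key₂ e1 e2
    · obtain ⟨e1, e2⟩ := min_eq_min3 n12 n02.symm n01.symm g1 g2
      exact key₀ e1 e2

end Combine

/-! ### Norms of the dyadic blocks -/

section Block

variable {d : ℕ}

theorem measurableSet_blockSet (A H : ℝ) (N L : Fin 3 → ℝ) :
    MeasurableSet (blockSet d A H N L) := by
  have hres : Continuous (resonance (d := d)) :=
    continuous_spatialResonance.comp (f := fun z : Fin 3 → Freq d => fun j => (z j).1)
      (by fun_prop)
  have hmod : ∀ j, Continuous fun z : Fin 3 → Freq d => modulation j (z j) := by
    intro j
    fin_cases j <;> simp only [modulation, dispersion] <;> simp <;> fun_prop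
  have hsim : ∀ {g : (Fin 3 → Freq d) → ℝ} (t : ℝ), Continuous g →
      MeasurableSet {z | Sim A (g z) t} := fun {g} t hg => by
    have h1 : IsClosed {z | g z ≤ A * t} := isClosed_le hg continuous_const
    have h2 : IsClosed {z | t ≤ A * g z} := isClosed_le continuous_const (by fun_prop)
    exact (h1.inter h2).measurableSet
  refine (hsim H hres.abs).inter ((MeasurableSet.iInter fun j => (hsim (N j)
    (g := fun z => ‖(z j).1‖) (by fun_prop)).inter (hsim (L j) (hmod j).abs)).congr
    (Set.ext fun z => Set.mem_iInter))

theorem blockSet_subset {A B H : ℝ} {N L : Fin 3 → ℝ} (hAB : A ≤ B)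
    (hN : ∀ j, 0 < N j) : blockSet d A H N L ⊆ modSet (region B (A * H) N) fun j => A * L j := by
  intro z hz
  refine ⟨⟨hz.1.1, fun j => ⟨(hz.2 j).1.1.trans ?_, (hz.2 j).1.2.trans ?_⟩⟩,
    fun j => (hz.2 j).2.1⟩
  · have := hN j
    gcongr
  · gcongr

theorem commonFactor_mul_rpow {N L : Fin 3 → ℝ} (hd : 1 ≤ d) (hN : ∀ j, 0 < N j)
    (hL : ∀ j, 0 < L j) {Y : ℝ} (hY : 0 < Y) :
    commonFactor d N L * Y ^ (1 / 2 : ℝ) =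
      (min3 L * ((max3 N)⁻¹ * min3 N ^ (d - 1)) * Y) ^ (1 / 2 : ℝ) := by
  have h1 := min3_pos hL
  have h2 := min3_pos hN
  have h3 := max3_pos hN
  rw [commonFactor, Real.mul_rpow (by positivity) hY.le, Real.mul_rpow h1.le (by positivity),
    Real.mul_rpow (by positivity) (by positivity), Real.inv_rpow h3.le, ← Real.rpow_neg h3.le,
    ← Real.rpow_natCast, ← Real.rpow_mul h2.le, Nat.cast_sub hd, ← mul_assoc]
  congr 4
  · norm_num
  · push_cast; ring

/-- Bounds for the squared trilinear form turn into bounds for the norm of a dyadic block. -/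
theorem blockNorm_le_of_sqBound (hd : 1 ≤ d) {A B H D C Y : ℝ} {N L : Fin 3 → ℝ}
    (hAB : A ≤ B) (hN : ∀ j, 0 < N j) (hL : ∀ j, 0 < L j) (hY : 0 < Y) (hD : 0 < D)
    (hC : 1 ≤ C) (hDC : D ≤ C)
    (h : SqBound (modSet (region (d := d) B (A * H) N) fun j => A * L j)
      (ENNReal.ofReal (D * (min3 L * ((max3 N)⁻¹ * min3 N ^ (d - 1)) * Y)))) :
    blockNorm d A H N L ≤ ENNReal.ofReal (C * (commonFactor d N L * Y ^ (1 / 2 : ℝ))) := by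
  have h1 := min3_pos hL
  have h2 := min3_pos hN
  have h3 := max3_pos hN
  refine (multiplierNorm_indicator_le (measurableSet_blockSet A H N L) (by positivity)
    (h.mono (fun z hz _ => blockSet_subset hAB hN hz) le_rfl)).trans
    (ENNReal.ofReal_le_ofReal ?_)
  rw [Real.mul_rpow hD.le (by positivity), commonFactor_mul_rpow hd hN hL hY]
  gcongr
  calc D ^ (1 / 2 : ℝ) ≤ C ^ (1 / 2 : ℝ) := by gcongr
    _ ≤ C ^ (1 : ℝ) := Real.rpow_le_rpow_of_exponent_le hC (by norm_num)
    _ = C := Real.rpow_one C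

theorem blockNorm_eq_zero {A H : ℝ} {N L : Fin 3 → ℝ}
    (h : ∀ z ∈ blockSet d A H N L, ∑ j, z j ≠ 0) : blockNorm d A H N L = 0 := by
  have h0 : SqBound (∅ : Set (Fin 3 → Freq d)) 0 :=
    SqBound.of_fiber MeasurableSet.empty (k := 0) (i := 1) (by decide) fun w => by simp
  have h1 := multiplierNorm_indicator_le (measurableSet_blockSet (d := d) A H N L) le_rfl
    (h0.mono (fun z hz hz0 => absurd hz0 (h z hz)) (zero_le))
  rw [Real.zero_rpow (by norm_num), ENNReal.ofReal_zero] at h1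
  exact le_antisymm h1 (zero_le)

/-- In the `(++)` case `h = 2 |ξ_0|² + 2 ξ_0 · ξ_2` is of size `N_0²`. -/
theorem sim_of_plusPlus {A K H : ℝ} (hA : 1 ≤ A) (hK : 5 * A ^ 2 ≤ K) {N L : Fin 3 → ℝ}
    (hN : ∀ j, 0 < N j) (hH : 0 < H) (hPP : PlusPlus A K N) {z : Fin 3 → Freq d}
    (hz : z ∈ blockSet d A H N L) (h0 : ∑ j, z j = 0) : Sim (3 * A ^ 3) H (N 0 ^ 2) := by
  have hA0 : 0 < A := by linarith
  have hn0 := hN 0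
  have hn2 := hN 2
  set ξ : Fin 3 → EuclideanSpace ℝ (Fin d) := fun j => (z j).1 with hξ
  have hsum : ∑ j, ξ j = 0 := by
    have := congrArg Prod.fst h0
    rwa [Prod.fst_sum] at this
  have hres : resonance z = 2 * ‖ξ 0‖ ^ 2 + 2 * inner ℝ (ξ 0) (ξ 2) := by
    have h1 : resonance z = spatialResonance ξ := rfl
    have h2 : ξ 1 = -(ξ 0 + ξ 2) := by
      rw [eq_neg_iff_add_eq_zero, ← hsum, Fin.sum_univ_three]; abel
    rw [h1, spatialResonance_eq hsum, h2, inner_neg_right, inner_add_right,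
      real_inner_self_eq_norm_sq]
    ring
  obtain ⟨⟨r1, r2⟩, hz'⟩ := hz
  obtain ⟨a1, a2⟩ := (hz' 0).1
  obtain ⟨b1, -⟩ := (hz' 2).1
  change ‖ξ 0‖ ≤ A * N 0 at a1
  change N 0 ≤ A * ‖ξ 0‖ at a2
  change ‖ξ 2‖ ≤ A * N 2 at b1
  have hsmall : 2 * ‖ξ 2‖ ≤ ‖ξ 0‖ := by
    have k1 : K * N 2 ≤ N 0 := hPP.2.1
    have k2 : 5 * A ^ 2 * N 2 ≤ A * ‖ξ 0‖ := by nlinarith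
    have k3 : A * (5 * A * N 2) ≤ A * ‖ξ 0‖ := by linarith
    have k4 := le_of_mul_le_mul_left k3 hA0
    have : 0 < A * N 2 := by positivity
    linarith
  have hin := abs_le.1 (abs_real_inner_le_norm (ξ 0) (ξ 2))
  have hprod : ‖ξ 0‖ * ‖ξ 2‖ ≤ ‖ξ 0‖ ^ 2 / 2 := by nlinarith [norm_nonneg (ξ 0)]
  have hlow : ‖ξ 0‖ ^ 2 ≤ |resonance z| := by
    rw [hres]; exact le_trans (by linarith [hin.1]) (le_abs_self _)
  have hup : |resonance z| ≤ 3 * ‖ξ 0‖ ^ 2 := by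
    rw [hres, abs_le]; constructor <;> nlinarith [hin.1, hin.2, sq_nonneg ‖ξ 0‖]
  constructor
  · calc H ≤ A * |resonance z| := r2
      _ ≤ A * (3 * ‖ξ 0‖ ^ 2) := by gcongr
      _ ≤ A * (3 * (A * N 0) ^ 2) := by gcongr
      _ = _ := by ring
  · calc N 0 ^ 2 ≤ (A * ‖ξ 0‖) ^ 2 := by gcongr
      _ = A ^ 2 * ‖ξ 0‖ ^ 2 := by ring
      _ ≤ A ^ 2 * (A * H) := by gcongr; exact hlow.trans r1
      _ ≤ 3 * A ^ 3 * H := by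
        have : 0 < A ^ 3 * H := by positivity
        linarith

/-- Outside the `(++)` case there is a low frequency wave `b` among the two waves of the same sign.
The other two have comparable frequencies, and `b` may be taken to have the lowest frequency up to
a constant. -/
theorem exists_pair {A K H : ℝ} (hA : 1 ≤ A) (hK : 1 ≤ K) {N L : Fin 3 → ℝ}
    (h : Admissible A H N L) (hPP : ¬ PlusPlus A K N) :
    ∃ a b, IsPair a b ∧ N b ≤ N a ∧ N 2 ≤ A * N a ∧ N a ≤ A * K * N 2 ∧ max3 N ≤ A * N a ∧
      N b ≤ K * min3 N ∧ (Sim A (N a) (N 2) ∨ N a ≤ A * N b) := by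
  have hpair : ∃ a b, IsPair a b ∧ N b ≤ N a := by
    rcases le_total (N 0) (N 1) with h1 | h1
    exacts [⟨1, 0, Or.inr ⟨rfl, rfl⟩, h1⟩, ⟨0, 1, Or.inl ⟨rfl, rfl⟩, h1⟩]
  obtain ⟨a, b, hab, hba⟩ := hpair
  obtain ⟨hab1, ha2, hb2⟩ := hab.ne
  have ha := h.N_pos a
  have hb := h.N_pos b
  have h2 := h.N_pos 2
  have hcomp := h.N_comp.1
  have hAK : A ≤ A * K := le_mul_of_one_le_right (by linarith) hK
  have haA : N a ≤ A * N a := le_mul_of_one_le_left ha.le hA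
  have h2A : N 2 ≤ A * N 2 := le_mul_of_one_le_left h2.le hA
  have hbK : N b ≤ K * N b := le_mul_of_one_le_left hb.le hK
  have hAK2 : A * N 2 ≤ A * K * N 2 := by gcongr
  refine ⟨a, b, hab, hba, ?_⟩
  rcases le_total (N b) (N 2) with h1 | h1
  · rcases le_total (N a) (N 2) with h3 | h3
    · obtain ⟨e1, e2, e3⟩ := order_stats hab1.symm ha2 hb2 hba h3
      rw [e2, e3] at hcomp
      exact ⟨hcomp, by linarith, by rw [e3]; exact hcomp, by rw [e1]; exact hbK,
        Or.inl ⟨by linarith, hcomp⟩⟩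
    · obtain ⟨e1, e2, e3⟩ := order_stats hb2 ha2.symm hab1.symm h1 h3
      rw [e2, e3] at hcomp
      exact ⟨by linarith, by linarith, by rw [e3]; exact haA, by rw [e1]; exact hbK,
        Or.inl ⟨hcomp, by linarith⟩⟩
  · obtain ⟨e1, e2, e3⟩ := order_stats hb2.symm hab1.symm ha2.symm h1 hba
    rw [e2, e3] at hcomp
    have h4 : N b ≤ K * N 2 := by
      by_contra! hcon
      refine hPP ?_
      rcases hab with ⟨rfl, rfl⟩ | ⟨rfl, rfl⟩
      · exact ⟨⟨hcomp, by linarith⟩, hcon.le.trans hba, hcon.le⟩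
      · exact ⟨⟨by linarith, hcomp⟩, hcon.le, hcon.le.trans hba⟩
    refine ⟨by linarith, ?_, by rw [e3]; exact haA, by rw [e1]; exact h4, Or.inr hcomp⟩
    calc N a ≤ A * N b := hcomp
      _ ≤ A * (K * N 2) := by gcongr
      _ = _ := by ring

theorem inv_mul_pow_le {B x y X Y : ℝ} (hB : 1 ≤ B) (hd : 1 ≤ d) (hx : 0 < x) (hX : 0 < X)
    (hy : 0 < y) (hXx : X ≤ B * x) (hyY : y ≤ B * Y) :
    x⁻¹ * y ^ (d - 1) ≤ B ^ d * (X⁻¹ * Y ^ (d - 1)) := by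
  have hB0 : 0 < B := by linarith
  have h1 : x⁻¹ ≤ B * X⁻¹ := by
    rw [← div_eq_mul_inv, inv_eq_one_div, div_le_div_iff₀ hx hX]
    linarith
  calc x⁻¹ * y ^ (d - 1) ≤ (B * X⁻¹) * (B * Y) ^ (d - 1) := by gcongr
    _ = B ^ (d - 1 + 1) * (X⁻¹ * Y ^ (d - 1)) := by ring
    _ = _ := by rw [Nat.sub_add_cancel hd]

/-- In the `(++)` case the block norm has the asserted bound. -/
theorem blockNorm_plusPlus_le (hd : 2 ≤ d) {A K : ℝ} (hA : 1 ≤ A) (hK : 5 * A ^ 2 ≤ K) :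
    ∃ C₀ : ℝ, ∀ C, C₀ ≤ C → ∀ {H : ℝ} {N L : Fin 3 → ℝ}, Admissible A H N L → PlusPlus A K N →
      blockNorm d A H N L ≤ ENNReal.ofReal (C *
        (commonFactor d N L * min (max3 N * min3 N) (med3 L) ^ (1 / 2 : ℝ))) := by
  have hA0 : 0 < A := by linarith
  obtain ⟨D, hD, hbound⟩ := sqBound_plusPlus hd hA
  refine ⟨max 1 (D * A * A), fun C hC {H N L} h hPP => ?_⟩
  have hW : ∀ j, 0 < A * L j := fun j => mul_pos hA0 (h.L_pos j)
  have hL := min3_pos h.L_pos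
  have hl := med3_pos h.L_pos
  have hM := max3_pos h.N_pos
  have hn := min3_pos h.N_pos
  have hn2 := h.N_pos 2
  have hY : 0 < min (max3 N * min3 N) (med3 L) := lt_min (by positivity) hl
  obtain ⟨⟨h01, h10⟩, h02, h12⟩ := hPP
  unfold MuchGreater at h02 h12
  have hK1 : 1 ≤ K := le_trans (by nlinarith) hK
  have h20 : N 2 ≤ N 0 := le_trans (le_mul_of_one_le_left hn2.le hK1) h02
  have h21 : N 2 ≤ N 1 := le_trans (le_mul_of_one_le_left hn2.le hK1) h12
  have hmin : min3 N = N 2 := le_antisymm (min3_le N 2) (le_min (le_min h20 h21) le_rfl)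
  have hA' : ∀ j, N j ≤ A * N j := fun j => le_mul_of_one_le_left (h.N_pos j).le hA
  refine blockNorm_le_of_sqBound (by omega) le_rfl h.N_pos h.L_pos hY (D := D * A * A)
    (by positivity) ((le_max_left _ _).trans hC) ((le_max_right _ _).trans hC)
    ((hbound (κ := A * H) (M := max3 N) (mul_pos hA0 h.H_pos) h.N_pos hW (le_max3 N 0)
      (le_max3 N 1) (max_le (max_le (hA' 0) h10) (h20.trans (hA' 0)))
      (max_le (max_le h01 (hA' 1)) (h21.trans (hA' 1)))
      (le_trans (by gcongr) h02)).mono (fun z hz _ => hz) (ENNReal.ofReal_le_ofReal ?_))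
  rw [min3_mul hA0.le, med3_mul hA0.le, ← hmin]
  have h3 : min (max3 N * min3 N) (A * med3 L) ≤ A * min (max3 N * min3 N) (med3 L) := by
    rw [mul_min_of_nonneg _ _ hA0.le]
    exact min_le_min (le_mul_of_one_le_left (by positivity) hA) le_rfl
  calc D * (A * min3 L * ((max3 N)⁻¹ * min3 N ^ (d - 1)) * min (max3 N * min3 N) (A * med3 L))
      ≤ D * (A * min3 L * ((max3 N)⁻¹ * min3 N ^ (d - 1)) *
        (A * min (max3 N * min3 N) (med3 L))) := by gcongr
    _ = _ := by ring

/-- In the coherent `(+-)` case the block norm has the asserted bound. -/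
theorem blockNorm_coherent_le (hd : 2 ≤ d) {A K : ℝ} (hA : 1 ≤ A) (hK : 1 ≤ K) :
    ∃ C₀ : ℝ, ∀ C, C₀ ≤ C → ∀ {H : ℝ} {N L : Fin 3 → ℝ}, Admissible A H N L →
      PlusMinusCoherent A K H N L →
      blockNorm d A H N L ≤ ENNReal.ofReal (C *
        (commonFactor d N L * min H (H / min3 N ^ 2 * med3 L) ^ (1 / 2 : ℝ))) := by
  have hA0 : 0 < A := by linarith
  obtain ⟨D, hD, hbound⟩ := sqBound_coherent hd hA
  refine ⟨max 1 (D * A * A ^ d * A ^ 2), fun C hC {H N L} h hcoh => ?_⟩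
  have hpair : ∃ a b, IsPair a b ∧ CoherentAt a b A K H N L := by
    rcases hcoh with h1 | h1
    exacts [⟨0, 1, Or.inl ⟨rfl, rfl⟩, h1⟩, ⟨1, 0, Or.inr ⟨rfl, rfl⟩, h1⟩]
  obtain ⟨a, b, hab, ⟨⟨ha2, h2a⟩, hKa, hK2⟩, ⟨-, -, hLa⟩, ⟨-, -, hL2⟩, -⟩ := hpair
  obtain ⟨hab1, ha2', hb2'⟩ := hab.ne
  unfold MuchGreater at hKa hK2 hLa hL2
  have hW : ∀ j, 0 < A * L j := fun j => mul_pos hA0 (h.L_pos j)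
  have hLab : L a ≤ L b := le_trans (le_mul_of_one_le_left (h.L_pos a).le hK) hLa
  have hL2b : L 2 ≤ L b := le_trans (le_mul_of_one_le_left (h.L_pos 2).le hK) hL2
  have hba : N b ≤ N a := le_trans (le_mul_of_one_le_left (h.N_pos b).le hK) hKa
  have hb2 : N b ≤ N 2 := le_trans (le_mul_of_one_le_left (h.N_pos b).le hK) hK2
  have hH := h.H_pos
  have ha := h.N_pos a
  have hb := h.N_pos b
  have h2 := h.N_pos 2
  have hL := min3_pos h.L_pos
  have hl := med3_pos h.L_pos
  have hM := max3_pos h.N_pos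
  have hn := min3_pos h.N_pos
  have haA : N a ≤ A * N a := le_mul_of_one_le_left ha.le hA
  have hstat : min3 N = N b ∧ max3 N ≤ A * N a := by
    rcases le_total (N a) (N 2) with h3 | h3
    · obtain ⟨e1, -, e3⟩ := order_stats hab1.symm ha2' hb2' hba h3
      exact ⟨e1, by rw [e3]; exact h2a⟩
    · obtain ⟨e1, -, e3⟩ := order_stats hb2' ha2'.symm hab1.symm hb2 h3
      exact ⟨e1, by rw [e3]; exact haA⟩
  obtain ⟨hmin, hmax⟩ := hstat
  have hY : 0 < min H (H / min3 N ^ 2 * med3 L) := lt_min hH (by positivity)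
  refine blockNorm_le_of_sqBound (by omega) le_rfl h.N_pos h.L_pos hY
    (D := D * A * A ^ d * A ^ 2)
    (by positivity) ((le_max_left _ _).trans hC) ((le_max_right _ _).trans hC)
    ((hbound (κ := A * H) (mul_pos hA0 h.H_pos) h.N_pos hW hab h2a ha2
      (by gcongr) (by gcongr)).mono (fun z hz _ => hz) (ENNReal.ofReal_le_ofReal ?_))
  rw [min3_mul hA0.le, med3_mul hA0.le]
  have h3 : min (A * H) (A * H / N b ^ 2 * (A * med3 L)) ≤
      A ^ 2 * min H (H / min3 N ^ 2 * med3 L) := by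
    rw [mul_min_of_nonneg _ _ (by positivity), hmin]
    refine min_le_min ?_ (le_of_eq (by ring))
    gcongr
    exact le_self_pow₀ hA (by norm_num)
  have h4 := inv_mul_pow_le (d := d) (Y := min3 N) hA (by omega) ha hM hb hmax
    (by rw [hmin]; exact le_mul_of_one_le_left hb.le hA)
  have h5 : 0 < min (A * H) (A * H / N b ^ 2 * (A * med3 L)) :=
    lt_min (by positivity) (by positivity)
  calc D * (A * min3 L * ((N a)⁻¹ * N b ^ (d - 1)) *
        min (A * H) (A * H / N b ^ 2 * (A * med3 L)))
      ≤ D * (A * min3 L * (A ^ d * ((max3 N)⁻¹ * min3 N ^ (d - 1))) *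
        (A ^ 2 * min H (H / min3 N ^ 2 * med3 L))) := by gcongr
    _ = _ := by ring

/-- If `L_b` dominates the other modulations then `H ∼ L_b`, and outside the coherent case this
forces `H ≲ N_b²`. -/
theorem modulation_alternative {A K H : ℝ} (hA : 1 ≤ A) (hK : 1 ≤ K) {N L : Fin 3 → ℝ}
    (h : Admissible A H N L) {a b : Fin 3} (hab : IsPair a b) (hcoh : ¬ CoherentAt a b A K H N L)
    (hcomp : Sim A (N a) (N 2) ∨ N a ≤ A * N b) :
    L b ≤ A ^ 3 * K * med3 L ∨ (med3 L ≤ H ∧ A * H ≤ A ^ 3 * K * N b ^ 2) := by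
  have hA0 : 0 < A := by linarith
  have hK0 : 0 < K := by linarith
  have hA1 : 1 ≤ A ^ 2 := one_le_pow₀ hA
  have hA2 : A ≤ A ^ 3 := le_self_pow₀ hA (by norm_num)
  have hl := med3_pos h.L_pos
  have ha := h.N_pos a
  have hb := h.N_pos b
  have hH := h.H_pos
  obtain ⟨hab1, ha2', hb2'⟩ := hab.ne
  refine or_iff_not_imp_left.2 fun hdom => ?_
  push Not at hdom
  have hAK : A ≤ A ^ 3 * K := hA2.trans (le_mul_of_one_le_right (by positivity) hK)
  have hb' : A * med3 L < L b := lt_of_le_of_lt (by gcongr) hdom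
  have hb'' : med3 L < L b := lt_of_le_of_lt (le_mul_of_one_le_left hl.le hA) hb'
  -- `L_b` is the largest modulation
  have hle : L a ≤ med3 L ∧ L 2 ≤ med3 L ∧ max3 L = L b := by
    rcases le_total (L a) (L 2) with h1 | h1 <;> rcases le_total (L b) (L 2) with h2 | h2 <;>
      rcases le_total (L a) (L b) with h3 | h3
    · obtain ⟨-, e, -⟩ := order_stats hab1 hb2' ha2' h3 h2
      linarith
    · obtain ⟨-, e, -⟩ := order_stats hab1.symm ha2' hb2' h3 h1
      linarith
    · obtain ⟨-, e, e'⟩ := order_stats ha2' hb2'.symm hab1 h1 h2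
      exact ⟨by linarith, by linarith, e'⟩
    · obtain ⟨-, e, -⟩ := order_stats hab1.symm ha2' hb2' h3 h1
      linarith
    · obtain ⟨-, e, -⟩ := order_stats hab1 hb2' ha2' h3 h2
      linarith
    · obtain ⟨-, e, -⟩ := order_stats hb2' ha2'.symm hab1.symm h2 h1
      linarith
    · obtain ⟨-, e, e'⟩ := order_stats ha2'.symm hab1 hb2'.symm h1 h3
      exact ⟨by linarith, by linarith, e'⟩
    · obtain ⟨-, e, -⟩ := order_stats hb2'.symm hab1.symm ha2'.symm h2 h3
      linarith
  obtain ⟨hla, hl2, hmax⟩ := hle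
  obtain ⟨hc1, hc2⟩ := h.L_comp
  rw [hmax] at hc1 hc2
  have hHL : H ≤ A * L b := (le_max_left _ _).trans hc2
  have hLH : L b ≤ A * H := by
    rcases max_choice H (med3 L) with h1 | h1 <;> rw [h1] at hc1
    · exact hc1
    · linarith
  have hmH : A ^ 2 * K * med3 L ≤ H := by
    have : A * (A ^ 2 * K * med3 L) ≤ A * H := by
      calc _ = A ^ 3 * K * med3 L := by ring
        _ ≤ _ := hdom.le.trans hLH
    exact le_of_mul_le_mul_left this hA0
  have hKH : K * med3 L ≤ H := le_trans (by gcongr; exact le_mul_of_one_le_left hK0.le hA1) hmH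
  have hKL : K * med3 L ≤ L b :=
    le_trans (by gcongr; exact le_mul_of_one_le_left hK0.le (hA.trans hA2)) hdom.le
  refine ⟨le_trans (le_mul_of_one_le_left hl.le hK) hKH, ?_⟩
  have hfin : H ≤ A ^ 2 * K * N b ^ 2 → A * H ≤ A ^ 3 * K * N b ^ 2 := fun h1 => by
    calc A * H ≤ A * (A ^ 2 * K * N b ^ 2) := by gcongr
      _ = _ := by ring
  refine hfin ?_
  have hprod : H ≤ A * (N a * N b) := by
    have := h.H_le
    rcases hab with ⟨rfl, rfl⟩ | ⟨rfl, rfl⟩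
    · exact this
    · rwa [mul_comm (N 1)]
  have hAK2 : A * K ≤ A ^ 2 * K := by gcongr; exact le_self_pow₀ hA (by norm_num)
  have hlarge : N a ≤ A * K * N b → H ≤ A ^ 2 * K * N b ^ 2 := fun h1 => by
    calc H ≤ A * (N a * N b) := hprod
      _ ≤ A * (A * K * N b * N b) := by gcongr
      _ = _ := by ring
  rcases hcomp with hsim | hcomp
  · by_contra! hcon
    refine hcoh ⟨⟨hsim, ?_, ?_⟩, ⟨⟨hHL, hLH⟩, ?_, ?_⟩, ⟨⟨hHL, hLH⟩, ?_, ?_⟩, ⟨hHL, hLH⟩, ?_, ?_⟩ <;>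
      unfold MuchGreater
    · by_contra! h1
      refine absurd (hlarge (h1.le.trans ?_)) (not_le.2 hcon)
      gcongr
      exact le_mul_of_one_le_left hK0.le hA
    · by_contra! h1
      refine absurd (hlarge (hsim.1.trans ?_)) (not_le.2 hcon)
      calc A * N 2 ≤ A * (K * N b) := by gcongr
        _ = _ := by ring
    · exact le_trans (by gcongr) hKH
    · exact le_trans (by gcongr) hKL
    · exact le_trans (by gcongr) hKH
    · exact le_trans (by gcongr) hKL
    · refine le_trans ?_ hcon.le
      gcongr
      exact le_mul_of_one_le_left hK0.le hA1
    · by_contra! h1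
      refine absurd ?_ (not_le.2 hcon)
      calc H ≤ A * L b := hHL
        _ ≤ A * (K * N b ^ 2) := by gcongr
        _ = A * K * N b ^ 2 := by ring
        _ ≤ _ := by gcongr
  · exact hlarge (hcomp.trans (by gcongr; exact le_mul_of_one_le_right hA0.le hK))

/-- In the remaining cases the block norm has the asserted bound, without loss of an `ε`. -/
theorem blockNorm_plusMinus_le (hd : 2 ≤ d) {A K : ℝ} (hA : 1 ≤ A) (hK : 1 ≤ K) :
    ∃ C₀ : ℝ, ∀ C, C₀ ≤ C → ∀ {H : ℝ} {N L : Fin 3 → ℝ}, Admissible A H N L →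
      ¬ PlusPlus A K N → ¬ PlusMinusCoherent A K H N L →
      blockNorm d A H N L ≤ ENNReal.ofReal (C * (commonFactor d N L *
        (min H (med3 L) * min 1 (H / min3 N ^ 2)) ^ (1 / 2 : ℝ))) := by
  have hA0 : 0 < A := by linarith
  have hK0 : 0 < K := by linarith
  set B := A ^ 3 * K with hBdef
  have hA3 : A ≤ A ^ 3 := le_self_pow₀ hA (by norm_num)
  have hA3K : A ^ 3 ≤ B := le_mul_of_one_le_right (by positivity) hK
  have hAB : A ≤ B := hA3.trans hA3K
  have hB : 1 ≤ B := hA.trans hAB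
  have hB0 : 0 < B := by linarith
  have hKB : K ≤ B := le_mul_of_one_le_left hK0.le (hA.trans hA3)
  have hAKB : A * K ≤ B := by rw [hBdef]; gcongr
  obtain ⟨D, hD, hbound⟩ := sqBound_plusMinus hd hB
  refine ⟨max 1 (D * A * B ^ d * A * A), fun C hC {H N L} h hPP hcoh => ?_⟩
  obtain ⟨a, b, hab, hba, h2a, ha2, hmax, hmin, hcomp⟩ := exists_pair hA hK h hPP
  have hcoh' : ¬ CoherentAt a b A K H N L := by
    rcases hab with ⟨rfl, rfl⟩ | ⟨rfl, rfl⟩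
    exacts [fun h1 => hcoh (Or.inl h1), fun h1 => hcoh (Or.inr h1)]
  have halt := modulation_alternative hA hK h hab hcoh' hcomp
  have hW : ∀ j, 0 < A * L j := fun j => mul_pos hA0 (h.L_pos j)
  have hH := h.H_pos
  have ha := h.N_pos a
  have hb := h.N_pos b
  have h2 := h.N_pos 2
  have hL := min3_pos h.L_pos
  have hl := med3_pos h.L_pos
  have hM := max3_pos h.N_pos
  have hn := min3_pos h.N_pos
  have hG : 0 < min 1 (H / min3 N ^ 2) := lt_min one_pos (by positivity)
  have hω : 0 < min H (med3 L) := lt_min hH hl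
  refine blockNorm_le_of_sqBound (by omega) hAB h.N_pos h.L_pos (mul_pos hω hG)
    (D := D * A * B ^ d * A * A)
    (by positivity) ((le_max_left _ _).trans hC) ((le_max_right _ _).trans hC)
    ((hbound (κ := A * H) (mul_pos hA0 h.H_pos) h.N_pos hW hab (h2a.trans (by gcongr))
      (ha2.trans (by gcongr)) (hba.trans (le_mul_of_one_le_left ha.le hB)) ?_).mono
      (fun z hz _ => hz) (ENNReal.ofReal_le_ofReal ?_))
  · rw [med3_mul hA0.le]
    rcases halt with h1 | ⟨h1, h3⟩
    · left
      calc A * L b ≤ A * (B * med3 L) := by gcongr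
        _ = _ := by ring
    · right
      refine ⟨?_, h3⟩
      calc A * med3 L ≤ A * H := by gcongr
        _ ≤ _ := le_mul_of_one_le_left (by positivity) hB
  rw [min3_mul hA0.le, med3_mul hA0.le, ← mul_min_of_nonneg _ _ hA0.le]
  have h3 : min 1 (A * H / N b ^ 2) ≤ A * min 1 (H / min3 N ^ 2) := by
    rw [mul_min_of_nonneg _ _ hA0.le, mul_div_assoc]
    refine min_le_min (by linarith) ?_
    gcongr
    exact min3_le N b
  have h4 := inv_mul_pow_le (d := d) hB (by omega) ha hM hb (hmax.trans (by gcongr))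
    (hmin.trans (by gcongr))
  have h5 : 0 < min 1 (A * H / N b ^ 2) := lt_min one_pos (by positivity)
  calc D * (A * min3 L * ((N a)⁻¹ * N b ^ (d - 1)) * min 1 (A * H / N b ^ 2) *
        (A * min H (med3 L)))
      ≤ D * (A * min3 L * (B ^ d * ((max3 N)⁻¹ * min3 N ^ (d - 1))) *
        (A * min 1 (H / min3 N ^ 2)) * (A * min H (med3 L))) := by gcongr
    _ = _ := by ring

end Block

end DyadicBlock

end

open DyadicBlock
theorem mainTheorem2 (d : ℕ) (hd : 2 ≤ d) (A : ℝ) (hA : 1 ≤ A) :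
    ∃ K₀ : ℝ, 1 ≤ K₀ ∧ ∀ K : ℝ, K₀ ≤ K →
      ∀ ε : ℝ, (0 < ε ∨ (d = 2 ∧ ε = 0)) →
        ∃ C : ℝ, 0 < C ∧ ∀ (H : ℝ) (N L : Fin 3 → ℝ), Admissible A H N L →
          (PlusPlus A K N →
            (¬ Sim C H (N 0 ^ 2) → blockNorm d A H N L = 0) ∧
            (Sim C H (N 0 ^ 2) → blockNorm d A H N L ≤ ENNReal.ofReal (C *
              (commonFactor d N L * min (max3 N * min3 N) (med3 L) ^ (1 / 2 : ℝ))))) ∧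
          (PlusMinusCoherent A K H N L →
            blockNorm d A H N L ≤ ENNReal.ofReal (C *
              (commonFactor d N L * min H (H / min3 N ^ 2 * med3 L) ^ (1 / 2 : ℝ)))) ∧
          (¬ PlusPlus A K N → ¬ PlusMinusCoherent A K H N L →
            blockNorm d A H N L ≤ ENNReal.ofReal (C *
              (commonFactor d N L * min H (med3 L) ^ (1 / 2 : ℝ) *
                min 1 (H / min3 N ^ 2) ^ (1 / 2 - ε)))) := by
  have hA2 : 1 ≤ A ^ 2 := one_le_pow₀ hA
  refine ⟨5 * A ^ 2, by linarith, fun K hK ε hε => ?_⟩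
  have hε0 : 0 ≤ ε := by
    rcases hε with h | h
    exacts [h.le, h.2.ge]
  have hK1 : 1 ≤ K := by linarith
  obtain ⟨C₁, h₁⟩ := blockNorm_plusPlus_le hd hA hK
  obtain ⟨C₂, h₂⟩ := blockNorm_coherent_le hd hA hK1
  obtain ⟨C₃, h₃⟩ := blockNorm_plusMinus_le hd hA hK1
  set C := max (3 * A ^ 3) (max C₁ (max C₂ C₃))
  have hCA : 3 * A ^ 3 ≤ C := le_max_left _ _
  have hC₁ : C₁ ≤ C := (le_max_left _ _).trans (le_max_right _ _)
  have hC₂ : C₂ ≤ C := (le_max_left _ _).trans ((le_max_right _ _).trans (le_max_right _ _))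
  have hC₃ : C₃ ≤ C := (le_max_right _ _).trans ((le_max_right _ _).trans (le_max_right _ _))
  have hC0 : 0 < C := lt_of_lt_of_le (by positivity) hCA
  refine ⟨C, hC0, fun H N L h => ⟨fun hPP => ⟨fun hsim => ?_, fun _ => h₁ C hC₁ h hPP⟩,
    fun hcoh => h₂ C hC₂ h hcoh, fun hPP hcoh => (h₃ C hC₃ h hPP hcoh).trans ?_⟩⟩
  · refine blockNorm_eq_zero fun z hz h0 => hsim ?_
    have hH := h.H_pos
    have hN := h.N_pos 0
    obtain ⟨h1, h2⟩ := sim_of_plusPlus hA hK h.N_pos h.H_pos hPP hz h0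
    exact ⟨h1.trans (by gcongr), h2.trans (by gcongr)⟩
  · have hH := h.H_pos
    have hn := min3_pos h.N_pos
    have hM := max3_pos h.N_pos
    have hL := min3_pos h.L_pos
    have hG : 0 < min 1 (H / min3 N ^ 2) := lt_min one_pos (by positivity)
    have hω : 0 < min H (med3 L) := lt_min hH (med3_pos h.L_pos)
    have hF : 0 ≤ commonFactor d N L := by unfold commonFactor; positivity
    refine ENNReal.ofReal_le_ofReal (mul_le_mul_of_nonneg_left ?_ hC0.le)
    rw [Real.mul_rpow hω.le hG.le, ← mul_assoc]
    -- the gain is at most `1`, so that a smaller exponent only weakens the bound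
    exact mul_le_mul_of_nonneg_left (Real.rpow_le_rpow_of_exponent_ge hG (min_le_left _ _)
      (by linarith)) (by positivity)
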